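/- **Conventions.** Let $k$ be a field. All schemes are Noetherian and separated. A variety over $k$ is an integral scheme of finite type over $k$. A morphism of schemes is *essentially of finite type* if it is quasi-compact and locally of the form $\operatorname{Spec}B\to\operatorname{Spec}A$ with $B$ a localization of an $A$-algebra of finite type. It is *essentially smooth* if it is locally of this form with $B$ a localization of a smooth $A$-algebra. For a $k$-scheme $U$ let $Cp(U)$ be the category whose objects are the couples $(T,Z)$ of a $U$-scheme $T$ essentially of finite type over $U$ and a (possibly empty) closed subset $Z\subset T$. Its morphisms $(T,Z)\to(T',Z')$ are the morphisms of $U$-schemes $f:T\to T'$ with $f^{-1}(Z')\subset Z$. For a contravariant functor $F$ from $Cp(U)$ to abelian groups write $F_Z(T)=F(T,Z)$. * $F$ is *homotopy invariant* if for every $(T,Z)\in Cp(U)$ with $T$ smooth or essentially smooth over $k$, the map $F_Z(T)\to F_{Z\times\mathbb A^1}(T\times\mathbb A^1)$ induced by the projection is an isomorphism. * $F$ satisfies the *vanishing property* if $F_\emptyset(T)=0$ for all $T$. * $F$ is *endowed with transfers* if for every finite flat morphism $\pi:T'\to T$ of $U$-schemes in $Cp(U)$ and every closed $Z\subset T$ a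 homomorphism $\mathrm{Tr}_\pi:F_{\pi^{-1}(Z)}(T')\to F_Z(T)$ is given, such that: 1. for every cartesian square with sides $\pi:T'\to T$ finite flat, $f:T_1\to T$, $\pi_1:T_1'\to T_1$ and $f':T_1'\to T'$, one has $F(f)\circ\mathrm{Tr}_\pi=\mathrm{Tr}_{\pi_1}\circ F(f')$ on $F_{\pi^{-1}(Z)}(T')$, with values in $F_{f^{-1}(Z)}(T_1)$; 2. if $T'=T_1'\amalg T_2'$ with inclusions $i_1,i_2$, then $\mathrm{Tr}_\pi=\mathrm{Tr}_{\pi i_1}\circ F(i_1)+\mathrm{Tr}_{\pi i_2}\circ F(i_2)$; 3. if $\pi$ is an isomorphism, then $\mathrm{Tr}_\pi$ and $F(\pi)$ are inverse to each other. Let $X$ be a smooth affine variety over $k$ and let $F$ be a contravariant functor from $Cp(X)$ to abelian groups. * $F$ has *finite monodromy* if there are a finite étale morphism $\rho:Y\to X\times_kX$ and a morphism $s:X\to Y$ with $\rho\circ s$ the diagonal, such that the functors $p_1^*F$ and $p_2^*F$ on $Cp(Y)$ are isomorphic. Here $p_i=\mathrm{pr}_i\circ\rho:Y\to X$ and $(p_i^*F)(T\to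 Y,Z)=F(T\to Y\xrightarrow{p_i}X,Z)$. * Let $x\subset X$ be a finite set of points, $\mathcal U=\operatorname{Spec}\mathcal O_{X,x}$ the semi-local scheme at $x$ and $j:\mathcal U\to X$ the canonical morphism. $F$ is *effaceable at $x$* if for every $m\ge1$ and every closed subset $Z\subset X$ of codimension $m$ there is a closed subset $Z'\subset\mathcal U$ with $Z'\supset j^{-1}(Z)$ and $\operatorname{codim}_{\mathcal U}Z'\ge m-1$ such that the composite $$F_Z(X)\xrightarrow{F(j)}F_{j^{-1}(Z)}(\mathcal U)\xrightarrow{F(\mathrm{id}_{\mathcal U})}F_{Z'}(\mathcal U)$$ is zero. (The empty set has codimension $\infty$.) **Theorem 5.4.** Let $X$ be a smooth affine variety over an infinite field $k$ and $x\subset X$ a finite set of points. Let $F$ be a contravariant functor from $Cp(X)$ to abelian groups that is homotopy invariant, endowed with transfers, satisfies the vanishing property and has finite monodromy. Then $F$ is effaceable at $x$. -/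

import Mathlib

open CategoryTheory CategoryTheory.Limits AlgebraicGeometry Opposite TopologicalSpace

universe v u

namespace EffacementTheorem

/-! ### Essentially of finite type and essentially smooth morphisms -/

/-- Every point of the source has an affine open neighbourhood `V`, mapped into some affine open
`W` of the target, such that the ring homomorphism `Γ(Y, W) ⟶ Γ(X, V)` satisfies `P`. -/
def Locally (P : ∀ {A B : Type u} [CommRing A] [CommRing B], (A →+* B) → Prop)
    {X Y : Scheme.{u}} (f : X ⟶ Y) : Prop :=
  ∀ x : X, ∃ (W : Y.affineOpens) (V : X.affineOpens) (e : V.1 ≤ f ⁻¹ᵁ W.1),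
    x ∈ V.1 ∧ P (f.appLE W.1 V.1 e).hom

/-- A morphism of schemes is essentially of finite type if it is quasi-compact and is locally
given by ring homomorphisms `A → B` such that `B` is a localization of an `A`-algebra of finite
type. -/
def IsEssFiniteType {X Y : Scheme.{u}} (f : X ⟶ Y) : Prop :=
  QuasiCompact f ∧ Locally (fun φ => φ.EssFiniteType) f

/-- A ring homomorphism `A → B` is essentially smooth if `B` is a localization of a
smooth `A`-algebra `C`. -/
def RingHomEssSmooth {A B : Type u} [CommRing A] [CommRing B] (φ : A →+* B) : Prop :=
  ∃ (C : Type u) (_ : CommRing C) (α : A →+* C) (β : C →+* B) (M : Submonoid C),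
    α.Smooth ∧ β.comp α = φ ∧ @IsLocalization C _ M B _ β.toAlgebra

/-- A morphism of schemes is (locally) essentially smooth if it is locally given by ring
homomorphisms `A → B` such that `B` is a localization of a smooth `A`-algebra. Smooth morphisms
are a special case (see `isEssSmooth_of_smooth`). -/
def IsEssSmooth {X Y : Scheme.{u}} (f : X ⟶ Y) : Prop :=
  Locally (fun φ => RingHomEssSmooth φ) f

lemma isEssSmooth_of_smooth {X Y : Scheme.{u}} (f : X ⟶ Y) [Smooth f] : IsEssSmooth f := by
  intro x
  obtain ⟨_, ⟨W, hW, rfl⟩, hxW, -⟩ :=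
    Y.isBasis_affineOpens.exists_subset_of_mem_open (Set.mem_univ (f x)) isOpen_univ
  obtain ⟨_, ⟨V, hV, rfl⟩, hxV, hVW⟩ :=
    X.isBasis_affineOpens.exists_subset_of_mem_open (show x ∈ f ⁻¹ᵁ W from hxW) (f ⁻¹ᵁ W).2
  refine ⟨⟨W, hW⟩, ⟨V, hV⟩, hVW, hxV, ?_⟩
  refine ⟨Γ(X, V), inferInstance, (f.appLE W V hVW).hom, RingHom.id _, ⊥, ?_, rfl, ?_⟩
  · exact HasRingHomProperty.appLE @Smooth f inferInstance ⟨W, hW⟩ ⟨V, hV⟩ hVW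
  · exact @IsLocalization.self Γ(X, V) _ ⊥ (by
      rintro _ rfl
      exact isUnit_one)

lemma isEssFiniteType_of_locallyOfFiniteType {X Y : Scheme.{u}} (f : X ⟶ Y)
    [LocallyOfFiniteType f] [QuasiCompact f] : IsEssFiniteType f := by
  refine ⟨inferInstance, fun x => ?_⟩
  obtain ⟨_, ⟨W, hW, rfl⟩, hxW, -⟩ :=
    Y.isBasis_affineOpens.exists_subset_of_mem_open (Set.mem_univ (f x)) isOpen_univ
  obtain ⟨_, ⟨V, hV, rfl⟩, hxV, hVW⟩ :=
    X.isBasis_affineOpens.exists_subset_of_mem_open (show x ∈ f ⁻¹ᵁ W from hxW) (f ⁻¹ᵁ W).2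
  exact ⟨⟨W, hW⟩, ⟨V, hV⟩, hVW, hxV,
    (HasRingHomProperty.appLE @LocallyOfFiniteType f inferInstance
      ⟨W, hW⟩ ⟨V, hV⟩ hVW).essFiniteType⟩

/-- Inside an affine open neighbourhood `V` and any open neighbourhood `O` of `x` there is an
affine open neighbourhood `V'` of `x` whose ring of sections is essentially of finite type over
that of `V`. -/
lemma exists_affineOpens_essFiniteType {X : Scheme.{u}} (V : X.affineOpens) (O : X.Opens)
    (x : X) (hV : x ∈ V.1) (hO : x ∈ O) :
    ∃ (V' : X.affineOpens) (h : V'.1 ≤ V.1), V'.1 ≤ O ∧ x ∈ V'.1 ∧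
      (X.presheaf.map (homOfLE h).op).hom.EssFiniteType := by
  obtain ⟨g, hg, hxg⟩ := V.2.exists_basicOpen_le ⟨x, hO⟩ hV
  refine ⟨X.affineBasicOpen g, X.basicOpen_le g, hg, hxg, ?_⟩
  let := (X.presheaf.map (homOfLE (X.basicOpen_le g)).op).hom.toAlgebra
  have : IsLocalization.Away g Γ(X, X.basicOpen g) := V.2.isLocalization_basicOpen g
  have := Algebra.EssFiniteType.of_isLocalization Γ(X, X.basicOpen g) (Submonoid.powers g)
  exact this

lemma IsEssFiniteType.comp {X Y Z : Scheme.{u}} {f : X ⟶ Y} {g : Y ⟶ Z}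
    (hf : IsEssFiniteType f) (hg : IsEssFiniteType g) : IsEssFiniteType (f ≫ g) := by
  obtain ⟨hf₁, hf₂⟩ := hf
  obtain ⟨hg₁, hg₂⟩ := hg
  refine ⟨inferInstance, fun x => ?_⟩
  obtain ⟨W, V, e, hxV, hφ⟩ := hf₂ x
  obtain ⟨W₁, V₁, e₁, hxV₁, hφ₁⟩ := hg₂ (f x)
  obtain ⟨S, hSV, hSW, hxS, hS⟩ := exists_affineOpens_essFiniteType V₁ W.1 (f x) hxV₁ (e hxV)
  obtain ⟨T, hTV, hTS, hxT, hT⟩ := exists_affineOpens_essFiniteType V (f ⁻¹ᵁ S.1) x hxV hxS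
  refine ⟨W₁, T, hTS.trans (fun y hy => e₁ (hSV hy)), hxT, ?_⟩
  have h₁ : (g.appLE W₁.1 S.1 (hSV.trans e₁)).hom.EssFiniteType := by
    have := hφ₁.comp hS
    rwa [← CommRingCat.hom_comp, Scheme.Hom.appLE_map] at this
  have h₂ : (f.appLE S.1 T.1 hTS).hom.EssFiniteType := by
    have := hφ.comp hT
    rw [← CommRingCat.hom_comp, Scheme.Hom.appLE_map,
      ← Scheme.Hom.map_appLE f hTS (homOfLE hSW).op, CommRingCat.hom_comp] at this
    exact RingHom.EssFiniteType.of_comp _ this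
  have := h₁.comp h₂
  rwa [← CommRingCat.hom_comp, Scheme.Hom.appLE_comp_appLE] at this

lemma isEssFiniteType_SpecMap {A B : CommRingCat.{u}} (φ : A ⟶ B) (h : φ.hom.EssFiniteType) :
    IsEssFiniteType (Spec.map φ) := by
  refine ⟨inferInstance, fun x => ⟨⟨⊤, isAffineOpen_top _⟩, ⟨⊤, isAffineOpen_top _⟩, le_rfl,
    trivial, ?_⟩⟩
  have e : (Spec.map φ).appLE ⊤ ⊤ le_rfl =
      (Scheme.ΓSpecIso A).hom ≫ φ ≫ (Scheme.ΓSpecIso B).inv := by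
    rw [← Category.assoc, Iso.eq_comp_inv]
    exact (congrArg (· ≫ _) (Scheme.Hom.appLE_eq_app _)).trans (Scheme.ΓSpecIso_naturality φ)
  have iso {R S : CommRingCat.{u}} (i : R ⟶ S) [IsIso i] : i.hom.EssFiniteType :=
    (RingHom.FiniteType.of_surjective _
      (ConcreteCategory.bijective_of_isIso i).surjective).essFiniteType
  change ((Spec.map φ).appLE ⊤ ⊤ le_rfl).hom.EssFiniteType
  rw [e, CommRingCat.hom_comp, CommRingCat.hom_comp]
  exact (iso _).comp (h.comp (iso _))

/-! ### The category of couples -/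

/-- The objects of the category `Cp(U)`: a separated scheme `T` over `U`, essentially of finite
type over `U`, together with a (possibly empty) closed subset of `T`. If `U` is Noetherian, then
so is `T`. Schemes essentially of finite type are admitted because semi-local schemes
`Spec 𝒪_{X,x}` have to be objects of `Cp(X)`. -/
structure Couple (U : Scheme.{u}) where
  /-- the underlying `U`-scheme -/
  obj : Over U
  separated : obj.left.IsSeparated
  essFiniteType : IsEssFiniteType obj.hom
  /-- the closed subset -/
  supp : Closeds obj.left

namespace Couple

variable {U : Scheme.{u}}

/-- The preimage of the closed subset of the target under a morphism of `U`-schemes. -/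
def preimageSupp {P Q : Couple U} (f : P.obj ⟶ Q.obj) : Closeds P.obj.left :=
  Q.supp.preimage f.left.continuous

/-- Morphisms `(T, Z) ⟶ (T', Z')` in `Cp(U)`: the morphisms `f : T ⟶ T'` of `U`-schemes with
`f⁻¹(Z') ⊆ Z`. -/
@[ext]
structure Hom (P Q : Couple U) where
  /-- the underlying morphism of `U`-schemes -/
  hom : P.obj ⟶ Q.obj
  preimage_le : preimageSupp hom ≤ P.supp

instance : Category (Couple U) where
  Hom := Hom
  id P := ⟨𝟙 P.obj, fun _ h => h⟩
  comp f g := ⟨f.hom ≫ g.hom, fun t h => f.preimage_le (g.preimage_le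
    (show f.hom.left t ∈ preimageSupp g.hom from h))⟩

/-- The underlying morphism of schemes of a morphism of couples. -/
abbrev Hom.left {P Q : Couple U} (f : P ⟶ Q) : P.obj.left ⟶ Q.obj.left :=
  (Hom.hom f).left

/-- `f : (T, Z) ⟶ (T', Z')` satisfies `Z = f⁻¹(Z')`. -/
def Hom.IsStrict {P Q : Couple U} (f : P ⟶ Q) : Prop :=
  P.supp = preimageSupp (Hom.hom f)

/-- `f : (T, Z) ⟶ (T', Z')` is given by a finite flat morphism `T ⟶ T'`, and `Z = f⁻¹(Z')`. -/
structure Hom.IsFiniteFlat {P Q : Couple U} (f : P ⟶ Q) : Prop where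
  isFinite : IsFinite (Hom.left f)
  flat : Flat (Hom.left f)
  strict : Hom.IsStrict f

/-- The functor `Cp(V) ⥤ Cp(U)` given by a morphism `g : V ⟶ U` essentially of finite type:
`(T ⟶ V, Z)` is sent to `(T ⟶ V ⟶ U, Z)`. -/
def map {V : Scheme.{u}} (g : V ⟶ U) (hg : IsEssFiniteType g) : Couple V ⥤ Couple U where
  obj P := ⟨(Over.map g).obj P.obj, P.separated, P.essFiniteType.comp hg, P.supp⟩
  map f := ⟨(Over.map g).map (Hom.hom f), Hom.preimage_le f⟩
  map_id P := Hom.ext ((Over.map g).map_id P.obj)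
  map_comp f h := Hom.ext ((Over.map g).map_comp (Hom.hom f) (Hom.hom h))

end Couple

/-- The scheme `𝔸¹ × T`. -/
noncomputable abbrev AffineLine (T : Scheme.{u}) : Scheme.{u} := AffineSpace PUnit.{u + 1} T

/-- The projection `𝔸¹ × T ⟶ T`. -/
noncomputable abbrev affineLineProj (T : Scheme.{u}) : AffineLine T ⟶ T := AffineLine T ↘ T

/-- The couple `(𝔸¹ × T, 𝔸¹ × Z)`. -/
noncomputable def Couple.affineLine {U : Scheme.{u}} (P : Couple U) : Couple U where
  obj := Over.mk (affineLineProj P.obj.left ≫ P.obj.hom)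
  separated := by
    have := P.separated
    have : IsSeparated (affineLineProj P.obj.left ≫ terminal.from P.obj.left) := inferInstance
    have e : terminal.from (AffineLine P.obj.left) =
        affineLineProj P.obj.left ≫ terminal.from P.obj.left := Subsingleton.elim _ _
    have h : (AffineLine P.obj.left).IsSeparated := ⟨e ▸ this⟩
    exact h
  essFiniteType := (isEssFiniteType_of_locallyOfFiniteType _).comp P.essFiniteType
  supp := P.supp.preimage (affineLineProj P.obj.left).continuous

/-- The morphism `(𝔸¹ × T, 𝔸¹ × Z) ⟶ (T, Z)` given by the projection. -/
noncomputable def Couple.affineLineHom {U : Scheme.{u}} (P : Couple U) : P.affineLine ⟶ P :=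
  ⟨Over.homMk (affineLineProj P.obj.left) rfl, le_rfl⟩

/-! ### Functors on couples -/

/-- Contravariant functors `Cp(U) ⥤ Ab`. -/
abbrev CoupleFunctor (U : Scheme.{u}) := (Couple U)ᵒᵖ ⥤ AddCommGrpCat.{v}

namespace CoupleFunctor

variable {U : Scheme.{u}}

/-- `F` is homotopy invariant (relative to the structure morphism `q : U ⟶ S`, here `S = Spec k`):
for every couple `(T, Z)` with `T` essentially smooth over `S` (smooth `S`-schemes are included)
the projection induces an isomorphism `F_Z(T) ⟶ F_{𝔸¹ × Z}(𝔸¹ × T)`. -/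
def IsHomotopyInvariant {S : Scheme.{u}} (q : U ⟶ S) (F : CoupleFunctor.{v} U) : Prop :=
  ∀ P : Couple U, IsEssSmooth (P.obj.hom ≫ q) → IsIso (F.map P.affineLineHom.op)

/-- The vanishing property: `F(T, ∅) = 0`. -/
def HasVanishing (F : CoupleFunctor.{v} U) : Prop :=
  ∀ P : Couple U, P.supp = ⊥ → IsZero (F.obj (op P))

/-- Transfers on a contravariant functor `F : Cp(U) ⥤ Ab`: homomorphisms
`Tr : F_{π⁻¹(Z)}(T') ⟶ F_Z(T)` for all finite flat `π : T' ⟶ T` and closed `Z ⊆ T`, compatible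
with base change, additive, and normalized. -/
structure Transfers (F : CoupleFunctor.{v} U) where
  /-- the transfer map -/
  tr : ∀ {P' P : Couple U} (π : P' ⟶ P), Couple.Hom.IsFiniteFlat π →
    (F.obj (op P') ⟶ F.obj (op P))
  /-- compatibility with base change along an arbitrary `f : T₁ ⟶ T`, with supports
  `Z ⊆ T`, `Z' = π⁻¹(Z)`, `Z₁ = f⁻¹(Z)`, `Z₁' = π₁⁻¹(Z₁)` -/
  base_change : ∀ {P' P P₁' P₁ : Couple U} (f' : P₁' ⟶ P') (π₁ : P₁' ⟶ P₁) (π : P' ⟶ P)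
    (f : P₁ ⟶ P) (hπ : Couple.Hom.IsFiniteFlat π) (hπ₁ : Couple.Hom.IsFiniteFlat π₁),
    Couple.Hom.IsStrict f →
    IsPullback (Couple.Hom.left f') (Couple.Hom.left π₁) (Couple.Hom.left π)
      (Couple.Hom.left f) →
    tr π hπ ≫ F.map f.op = F.map f'.op ≫ tr π₁ hπ₁
  /-- additivity for a finite flat `π : T' ⟶ T` where `T' = T₁' ⨿ T₂'` by means of the
  inclusions `i₁`, `i₂` -/
  additive : ∀ {P₁' P₂' P' P : Couple U} (i₁ : P₁' ⟶ P') (i₂ : P₂' ⟶ P') (π : P' ⟶ P)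
    (hπ : Couple.Hom.IsFiniteFlat π) (h₁ : Couple.Hom.IsFiniteFlat (i₁ ≫ π))
    (h₂ : Couple.Hom.IsFiniteFlat (i₂ ≫ π)),
    Nonempty (IsColimit (BinaryCofan.mk (Couple.Hom.left i₁) (Couple.Hom.left i₂))) →
    tr π hπ = F.map i₁.op ≫ tr (i₁ ≫ π) h₁ + F.map i₂.op ≫ tr (i₂ ≫ π) h₂
  /-- normalization: for an isomorphism `π` the maps `Tr` and `F(π)` are mutually inverse -/
  tr_comp_map : ∀ {P' P : Couple U} (π : P' ⟶ P) [IsIso π] (hπ : Couple.Hom.IsFiniteFlat π),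
    tr π hπ ≫ F.map π.op = 𝟙 _
  map_comp_tr : ∀ {P' P : Couple U} (π : P' ⟶ P) [IsIso π] (hπ : Couple.Hom.IsFiniteFlat π),
    F.map π.op ≫ tr π hπ = 𝟙 _

/-- The pull-back `g^* F` of `F` along `g : V ⟶ U`:
`(g^* F)(T ⟶ V, Z) = F(T ⟶ V ⟶ U, Z)`. -/
def pullback {V : Scheme.{u}} (F : CoupleFunctor.{v} U) (g : V ⟶ U) (hg : IsEssFiniteType g) :
    CoupleFunctor.{v} V :=
  (Couple.map g hg).op ⋙ F

/-- `F : Cp(X) ⥤ Ab` has finite monodromy, where `q : X ⟶ S` is the structure morphism (with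
`S = Spec k`): there are a finite étale morphism `ρ : Y ⟶ X × X` and a section `s : X ⟶ Y` of it
over the diagonal such that `p₁^* F ≅ p₂^* F` for the two projections `p₁`, `p₂ : Y ⟶ X`. -/
def HasFiniteMonodromy {X S : Scheme.{u}} (q : X ⟶ S) [LocallyOfFiniteType q] [QuasiCompact q]
    (F : CoupleFunctor.{v} X) : Prop :=
  ∃ (Y : Scheme.{u}) (ρ : Y ⟶ Limits.pullback q q) (_ : IsFinite ρ) (_ : Etale ρ) (s : X ⟶ Y),
    s ≫ ρ = pullback.diagonal q ∧
      Nonempty (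
        F.pullback (ρ ≫ pullback.fst q q) (isEssFiniteType_of_locallyOfFiniteType _) ≅
        F.pullback (ρ ≫ pullback.snd q q) (isEssFiniteType_of_locallyOfFiniteType _))

end CoupleFunctor

/-! ### Semi-local schemes, codimension, effaceability -/

/-- The elements of `Γ(X, ⊤)` that do not vanish at any point of `x`. -/
def nonvanishing (X : Scheme.{u}) (x : Set X) : Submonoid Γ(X, ⊤) where
  carrier := {g | ∀ t ∈ x, t ∈ X.basicOpen g}
  one_mem' t _ := by simp
  mul_mem' ha hb t ht := by
    rw [Scheme.basicOpen_mul]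
    exact ⟨ha t ht, hb t ht⟩

/-- The semi-local ring `𝒪_{X,x}` of an affine scheme `X` at a (finite) set of points `x`. -/
abbrev semilocalRing (X : Scheme.{u}) (x : Set X) : CommRingCat.{u} :=
  .of (Localization (nonvanishing X x))

/-- The canonical morphism `j : Spec 𝒪_{X,x} ⟶ X` for an affine scheme `X`. -/
noncomputable def semilocalHom (X : Scheme.{u}) [IsAffine X] (x : Set X) :
    Spec (semilocalRing X x) ⟶ X :=
  Spec.map (CommRingCat.ofHom (algebraMap Γ(X, ⊤) (Localization (nonvanishing X x)))) ≫
    X.isoSpec.inv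

/-- The codimension of a closed subset: the infimum of the dimensions of the local rings
`𝒪_{X,z}` (equivalently, of the lengths of chains of generizations of `z`) over all points `z`
of `Z`. The empty set has codimension `⊤`. -/
noncomputable def codim {X : Scheme.{u}} (Z : Closeds X) : ℕ∞ :=
  ⨅ z ∈ Z, Order.coheight z

section

variable {X : Scheme.{u}} [IsAffine X]

/-- The couple `(X, Z)` in `Cp(X)`. -/
def selfCouple (Z : Closeds X) : Couple X :=
  ⟨Over.mk (𝟙 X), inferInstanceAs X.IsSeparated, isEssFiniteType_of_locallyOfFiniteType (𝟙 X), Z⟩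

/-- The couple `(𝒰, Z')` in `Cp(X)`, where `𝒰 = Spec 𝒪_{X,x}`. -/
noncomputable def semilocalCouple (x : Set X) (Z' : Closeds (Spec (semilocalRing X x))) :
    Couple X where
  obj := Over.mk (semilocalHom X x)
  separated := inferInstanceAs (Spec (semilocalRing X x)).IsSeparated
  essFiniteType :=
    (isEssFiniteType_SpecMap _ (RingHom.essFiniteType_algebraMap.mpr inferInstance)).comp
      (isEssFiniteType_of_locallyOfFiniteType _)
  supp := Z'

/-- The closed subset `Z ∩ 𝒰 = j⁻¹(Z)` of `𝒰 = Spec 𝒪_{X,x}`. -/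
noncomputable def restrictSupp (x : Set X) (Z : Closeds X) :
    Closeds (Spec (semilocalRing X x)) :=
  Z.preimage (semilocalHom X x).continuous

/-- The morphism `j : (𝒰, Z ∩ 𝒰) ⟶ (X, Z)`. -/
noncomputable def semilocalCoupleHom (x : Set X) (Z : Closeds X) :
    semilocalCouple x (restrictSupp x Z) ⟶ selfCouple Z :=
  ⟨Over.homMk (semilocalHom X x) (Category.comp_id _), le_rfl⟩

/-- The morphism `id : (𝒰, Z') ⟶ (𝒰, Z)` for `Z ⊆ Z'`. -/
noncomputable def semilocalCoupleId (x : Set X) {Z Z' : Closeds (Spec (semilocalRing X x))}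
    (h : Z ≤ Z') : semilocalCouple x Z' ⟶ semilocalCouple x Z :=
  ⟨𝟙 (Over.mk (semilocalHom X x)), fun _ ht => h ht⟩

/-- `F : Cp(X) ⥤ Ab` is effaceable at `x`: for every closed subset `Z` of `X` of codimension
`m ≥ 1` there is a closed subset `Z'` of `𝒰 = Spec 𝒪_{X,x}` containing `Z ∩ 𝒰`, of codimension at
least `m - 1`, such that the composite `F_Z(X) ⟶ F_{Z ∩ 𝒰}(𝒰) ⟶ F_{Z'}(𝒰)` is zero. -/
def CoupleFunctor.IsEffaceableAt (F : CoupleFunctor.{v} X) (x : Set X) : Prop :=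
  ∀ m : ℕ∞, 1 ≤ m → ∀ Z : Closeds X, codim Z = m →
    ∃ (Z' : Closeds (Spec (semilocalRing X x))) (h : restrictSupp x Z ≤ Z'),
      m - 1 ≤ codim Z' ∧
      F.map (semilocalCoupleHom x Z).op ≫ F.map (semilocalCoupleId x h).op = 0

end

end EffacementTheorem

/-! Write `X = Spec B`, `Z = V(I)`, and let `U = Spec R` be the semi-local scheme, with `j : U ⟶ X`.
The plan is to factor `j : (U, Z') ⟶ (X, Z)` through a section `σ` of a relative affine curve `Spec
A` over `U`, and to show by a homotopy argument with transfers that restriction along `σ` is zero.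

The curve comes from coordinates `t_0, …, t_n` on `X` such that `B` is finite over `k[t_0, …, t_n]`,
`B/I` is finite over `Q = k[t_1, …, t_n]`, and the `dt_i` generate the differentials at the points
of `x` (`exists_coordinates`). Noether normalization over an infinite field gives the two finiteness
conditions. Replacing `t_i` by `G_i(t_i) + f_i`, with `G_i` monic of large degree, keeps them and
prescribes the differentials. Miracle flatness (`flat_of_depthGE`) then makes `B` flat over `k[t_0,
…, t_n]`. The curve is `U ×_{Spec Q} X`, pulled back along the finite étale `Y ⟶ X × X` of the
monodromy condition; the diagonal and the section `X ⟶ Y` give `σ`.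

Let `V(J) ⊂ Spec A` be the preimage of `Z` under the second projection. It is finite over `U` and
lies over `Z'`, the preimage in `U` of the image of `Z` in `Spec Q`. Forgetting one coordinate costs
at most one in codimension (`exists_height_le_height_add_one`). Since `σ` followed by the second
projection is `j`, it suffices that `F` sends `σ : (U, Z') ⟶ (Spec A, V(J))` to zero when `Spec A`
is an `X`-scheme by the second projection. Finite monodromy replaces this by the first projection,
which factors through `U`; so finite flat maps `Spec A ⟶ 𝔸¹_U` over `U` become maps of `X`-schemes
and have transfers.

`exists_rectified_coordinate` provides such a map `s` whose fibre over `0` is `σ(U) ⨿ W'`, where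
neither `W'` nor the fibre over `1` meets `V(J)`. Transfer a class supported on `V(J)` along `s` and
restrict to `0` and to `1`: homotopy invariance makes the results equal. By base change and
vanishing the result at `1` is zero, while at `0` only the restriction along `σ` survives. Hence
this restriction vanishes (`Transfers.map_eq_zero`). -/

namespace EffacementTheorem

/-! ### Depth and flatness -/

section Depth

open RingTheory.Sequence IsLocalRing Pointwise

universe w

variable {R : Type u} [CommRing R]

/-- There is a weakly `M`-regular sequence of length `d` in the maximal ideal. -/
def DepthGE [IsLocalRing R] (d : ℕ) (M : Type w) [AddCommGroup M] [Module R M] : Prop :=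
  ∃ rs : List R, rs.length = d ∧ (∀ r ∈ rs, r ∈ maximalIdeal R) ∧ IsWeaklyRegular M rs

variable {M : Type w} [AddCommGroup M] [Module R M]

/-- `(M / yM) / xM ≅ (M / xM) / yM`. -/
noncomputable def quotSMulTopSwap (x y : R) (M : Type w) [AddCommGroup M] [Module R M] :
    QuotSMulTop y (QuotSMulTop x M) ≃ₗ[R] QuotSMulTop x (QuotSMulTop y M) := by
  have h (x y : R) : QuotSMulTop y (QuotSMulTop x M) ≃ₗ[R]
      M ⧸ (Ideal.ofList [x, y] • ⊤ : Submodule R M) :=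
    (Submodule.quotEquivOfEq _ _ (by
      rw [Ideal.ofList_singleton, Submodule.ideal_span_singleton_smul])) ≪≫ₗ
      (Submodule.quotOfListConsSMulTopEquivQuotSMulTopInner M x [y]).symm
  exact h x y ≪≫ₗ Submodule.quotEquivOfEq _ _ (by simp [sup_comm]) ≪≫ₗ (h y x).symm

lemma isSMulRegular_quotSMulTop_iff {x y : R} :
    IsSMulRegular (QuotSMulTop x M) y ↔ ∀ m n : M, y • m = x • n → ∃ l, m = x • l := by
  rw [isSMulRegular_quotient_iff_mem_of_smul_mem]
  simp only [Submodule.mem_smul_pointwise_iff_exists, Submodule.mem_top, true_and]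
  exact ⟨fun h m n e => (h m ⟨n, e.symm⟩).imp fun _ => Eq.symm,
    fun h m ⟨n, e⟩ => (h m n e.symm).imp fun _ => Eq.symm⟩

/-- This half of the permutability of regular sequences needs no finiteness of `M`. -/
lemma isSMulRegular_quotSMulTop_symm {x y : R} (hx : IsSMulRegular M x)
    (h : IsSMulRegular (QuotSMulTop x M) y) :
    IsSMulRegular (QuotSMulTop y M) x := by
  rw [isSMulRegular_quotSMulTop_iff] at h ⊢
  intro m n e
  obtain ⟨l, rfl⟩ := h n m e.symm
  exact ⟨l, hx (by simp only [e, smul_comm y x])⟩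

variable [IsLocalRing R]

lemma DepthGE.congr {d : ℕ} {N : Type*} [AddCommGroup N] [Module R N] (e : M ≃ₗ[R] N)
    (h : DepthGE (R := R) d M) : DepthGE (R := R) d N := by
  obtain ⟨rs, h₁, h₂, h₃⟩ := h
  exact ⟨rs, h₁, h₂, (e.isWeaklyRegular_congr rs).mp h₃⟩

lemma depthGE_succ_iff {d : ℕ} : DepthGE (R := R) (d + 1) M ↔
    ∃ x ∈ maximalIdeal R, IsSMulRegular M x ∧ DepthGE (R := R) d (QuotSMulTop x M) := by
  constructor
  · rintro ⟨_ | ⟨x, rs⟩, h₁, h₂, h₃⟩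
    · simp at h₁
    · rw [isWeaklyRegular_cons_iff] at h₃
      exact ⟨x, h₂ x (by simp), h₃.1, rs, by simpa using h₁,
        fun r hr => h₂ r (by simp [hr]), h₃.2⟩
  · rintro ⟨x, hx, hxM, rs, h₁, h₂, h₃⟩
    exact ⟨x :: rs, by simp [h₁], by simpa using ⟨hx, h₂⟩, .cons hxM h₃⟩

lemma depthGE_zero : DepthGE (R := R) 0 M := ⟨[], rfl, by simp, .nil R M⟩

/-- The socle of `M` vanishes. -/
def SocleTrivial (R : Type u) [CommRing R] [IsLocalRing R] (M : Type w) [AddCommGroup M]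
    [Module R M] : Prop :=
  ∀ m : M, (∀ r ∈ maximalIdeal R, r • m = 0) → m = 0

lemma SocleTrivial.of_isSMulRegular {x : R} (hx : x ∈ maximalIdeal R) (h : IsSMulRegular M x) :
    SocleTrivial R M :=
  fun m hm => h (by simp [hm x hx])

lemma DepthGE.socleTrivial {d : ℕ} (h : DepthGE (R := R) (d + 1) M) : SocleTrivial R M := by
  obtain ⟨x, hx, hM, -⟩ := depthGE_succ_iff.mp h
  exact .of_isSMulRegular hx hM

lemma SocleTrivial.prod {N : Type*} [AddCommGroup N] [Module R N] (hM : SocleTrivial R M)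
    (hN : SocleTrivial R N) : SocleTrivial R (M × N) := fun m hm =>
  Prod.ext (hM _ fun r hr => congrArg Prod.fst (hm r hr))
    (hN _ fun r hr => congrArg Prod.snd (hm r hr))

/-- If the maximal ideal consisted of zero divisors, prime avoidance would put it inside a single
associated prime, and the element with that annihilator would lie in the socle. -/
lemma SocleTrivial.exists_isSMulRegular [IsNoetherianRing R] [Module.Finite R M]
    (h : SocleTrivial R M) : ∃ y ∈ maximalIdeal R, IsSMulRegular M y := by
  by_contra! H
  have hsub : (maximalIdeal R : Set R) ⊆ ⋃ p ∈ associatedPrimes R M, p := by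
    rw [biUnion_associatedPrimes_eq_compl_regular]
    exact fun r hr => H r hr
  obtain ⟨p, hp, hle⟩ := (Ideal.subset_union_prime_finite (associatedPrimes.finite R M)
    (f := id) ⊥ ⊥ (fun p hp _ _ => hp.isPrime)).mp hsub
  replace hp : IsAssociatedPrime p M := hp
  rw [isAssociatedPrime_iff] at hp
  obtain ⟨hprime, m, rfl⟩ := hp
  have hm : m = 0 := h m fun r hr => by simpa using hle hr
  subst hm
  exact hprime.ne_top (by ext; simp)

/-- For regular elements of the maximal ideal both socles compute `Ext¹(κ, M)`. By hand, the class
of `m` modulo `x` corresponds to the class of `n` modulo `y`, where `y m = x n`. -/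
lemma SocleTrivial.quotSMulTop {x y : R} (hx : IsSMulRegular M x) (hy : IsSMulRegular M y)
    (hym : y ∈ maximalIdeal R) (h : SocleTrivial R (QuotSMulTop y M)) :
    SocleTrivial R (QuotSMulTop x M) := by
  intro m hm
  induction m using Submodule.Quotient.induction_on with | _ m
  simp only [← Submodule.Quotient.mk_smul, Submodule.Quotient.mk_eq_zero,
    Submodule.mem_smul_pointwise_iff_exists, Submodule.mem_top, true_and] at hm ⊢
  obtain ⟨n, hn⟩ := hm y hym
  have := h (Submodule.Quotient.mk n) fun r hr => by
    obtain ⟨l, hl⟩ := hm r hr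
    rw [← Submodule.Quotient.mk_smul, Submodule.Quotient.mk_eq_zero,
      Submodule.mem_smul_pointwise_iff_exists]
    exact ⟨l, trivial, hx (by simp only [smul_comm x y, hl, smul_comm x r, hn, smul_comm y r])⟩
  rw [Submodule.Quotient.mk_eq_zero, Submodule.mem_smul_pointwise_iff_exists] at this
  obtain ⟨l, -, rfl⟩ := this
  exact ⟨l, hy (by simp only [← hn, smul_comm x y])⟩

/-- Depth does not depend on the regular sequence chosen to witness it: any regular element of the
maximal ideal may serve as its first term. -/
lemma DepthGE.quotSMulTop [IsNoetherianRing R] {d : ℕ} {x : R} (hx : x ∈ maximalIdeal R)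
    [Module.Finite R M] (h : DepthGE (R := R) (d + 1) M) (hxM : IsSMulRegular M x) :
    DepthGE (R := R) d (QuotSMulTop x M) := by
  induction d generalizing M x with
  | zero => exact depthGE_zero
  | succ d ih =>
    obtain ⟨u, hu, huM, hd⟩ := depthGE_succ_iff.mp h
    -- Neither of `x`, `u` need be regular modulo the other, so they are linked by a third element
    -- `y` regular modulo both. Applying the socle criterion to a product of modules yields one `y`
    -- for all of them.
    obtain ⟨y, hy, hyN⟩ := SocleTrivial.exists_isSMulRegular (R := R)
      (M := M × QuotSMulTop x M × QuotSMulTop u M)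
      (h.socleTrivial.prod ((hd.socleTrivial.quotSMulTop hxM huM hu).prod hd.socleTrivial))
    have hyM : IsSMulRegular M y := fun a b e => congrArg Prod.fst
      (@hyN (a, 0, 0) (b, 0, 0) (by simpa using e))
    have hyx : IsSMulRegular (QuotSMulTop x M) y := fun a b e => congrArg (fun z => z.2.1)
      (@hyN (0, a, 0) (0, b, 0) (by simpa using e))
    have hyu : IsSMulRegular (QuotSMulTop u M) y := fun a b e => congrArg (fun z => z.2.2)
      (@hyN (0, 0, a) (0, 0, b) (by simpa using e))
    have h₁ : DepthGE (R := R) (d + 1) (QuotSMulTop y M) := depthGE_succ_iff.mpr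
      ⟨u, hu, isSMulRegular_quotSMulTop_symm huM hyu, (ih hy hd hyu).congr
        (quotSMulTopSwap u y M)⟩
    exact depthGE_succ_iff.mpr ⟨y, hy, hyx,
      (ih hx h₁ (isSMulRegular_quotSMulTop_symm hxM hyx)).congr (quotSMulTopSwap y x M)⟩

/-- The submodule `N` of elements killed by `p` satisfies `N ∩ uM = uN`, so by Nakayama it is not
contained in `uM`. An element of `N` that survives in `M/uM` is killed there by `p` and by `u ∉ p`.
-/
lemma exists_associatedPrime_quotSMulTop [IsNoetherianRing R] [Module.Finite R M] {u : R}
    (hu : u ∈ maximalIdeal R) (huM : IsSMulRegular M u) {p : Ideal R} (hp : IsAssociatedPrime p M) :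
    ∃ q, IsAssociatedPrime q (QuotSMulTop u M) ∧ p < q := by
  rw [isAssociatedPrime_iff] at hp
  obtain ⟨hprime, m, rfl⟩ := hp
  set p := (⊥ : Submodule R M).colon {m} with hpdef
  have hup : u ∉ p := fun h => by
    have : m = 0 := huM (by simpa [p] using h)
    subst this
    exact hprime.ne_top (by ext; simp [p])
  let N : Submodule R M :=
    { carrier := {n | ∀ r ∈ p, r • n = 0}
      add_mem' := fun ha hb r hr => by rw [smul_add, ha r hr, hb r hr, add_zero]
      zero_mem' := fun r _ => smul_zero r
      smul_mem' := fun c n hn r hr => by rw [smul_comm, hn r hr, smul_zero] }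
  have hmN : m ∈ N := fun r hr => by simpa [p] using hr
  obtain ⟨n, hn, hnu⟩ : ∃ n ∈ N, n ∉ u • (⊤ : Submodule R M) := by
    by_contra! H
    have hle : N ≤ Ideal.span {u} • N := by
      intro n hn
      obtain ⟨l, -, rfl⟩ := (Submodule.mem_smul_pointwise_iff_exists _ _ _).mp (H n hn)
      refine Submodule.smul_mem_smul (Ideal.mem_span_singleton_self u) fun r hr => huM ?_
      simpa only [smul_comm r u, smul_zero] using hn r hr
    have hN := Submodule.eq_bot_of_le_smul_of_le_jacobson_bot _ N (IsNoetherian.noetherian N) hle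
      (by rw [IsLocalRing.jacobson_eq_maximalIdeal _ bot_ne_top, Ideal.span_singleton_le_iff_mem]
          exact hu)
    have : m = 0 := by simpa [hN] using hmN
    subst this
    exact hprime.ne_top (by ext; simp [p])
  obtain ⟨q, hq, hle⟩ := exists_le_isAssociatedPrime_of_isNoetherianRing R
    (Submodule.Quotient.mk n : QuotSMulTop u M) (by simpa using hnu)
  refine ⟨q, hq, lt_of_le_of_ne (fun r hr => hle ?_) fun e => hup ?_⟩
  · simp [← Submodule.Quotient.mk_smul, hn r hr]
  · rw [e]
    refine hle ?_
    simp only [Submodule.mem_colon_singleton, ← Submodule.Quotient.mk_smul, Submodule.mem_bot,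
      Submodule.Quotient.mk_eq_zero]
    exact Submodule.smul_mem_pointwise_smul _ _ _ trivial

/-- Each regular element divided out produces a strictly larger associated prime. The resulting
chain shows that depth is at most `dim R/p`. -/
lemma DepthGE.le_coheight [IsNoetherianRing R] {d : ℕ} [Module.Finite R M]
    (h : DepthGE (R := R) d M) {p : Ideal R} (hp : IsAssociatedPrime p M) :
    (d : ℕ∞) ≤ Order.coheight (⟨p, hp.isPrime⟩ : PrimeSpectrum R) := by
  induction d generalizing M p with
  | zero => simp
  | succ d ih =>
    obtain ⟨u, hu, huM, hd⟩ := depthGE_succ_iff.mp h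
    obtain ⟨q, hq, hlt⟩ := exists_associatedPrime_quotSMulTop hu huM hp
    push_cast
    have h₁ := ih hd hq
    have h₂ : (⟨p, hp.isPrime⟩ : PrimeSpectrum R) < ⟨q, hq.isPrime⟩ := hlt
    exact (add_le_add h₁ le_rfl).trans (Order.coheight_add_one_le h₂)

/-- This is Krull's height theorem in `R/p`, whose maximal ideal is minimal over the images of `rs`.
-/
lemma coheight_le_length [IsNoetherianRing R] (p : PrimeSpectrum R) (rs : List R)
    (h : ∀ q : PrimeSpectrum R, p ≤ q → (∀ r ∈ rs, r ∈ q.asIdeal) → q.asIdeal = maximalIdeal R)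
    (hrs : ∀ r ∈ rs, r ∈ maximalIdeal R) :
    Order.coheight p ≤ rs.length := by
  classical
  let π := Ideal.Quotient.mk p.asIdeal
  have : IsLocalRing (R ⧸ p.asIdeal) := .of_surjective' π Ideal.Quotient.mk_surjective
  have hmap : (maximalIdeal (R ⧸ p.asIdeal)).comap π = maximalIdeal R :=
    have : (maximalIdeal (R ⧸ p.asIdeal)).comap π |>.IsMaximal :=
      Ideal.comap_isMaximal_of_surjective _ Ideal.Quotient.mk_surjective
    IsLocalRing.eq_maximalIdeal this
  have h₁ : maximalIdeal (R ⧸ p.asIdeal) ∈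
      (Ideal.span (π '' {r | r ∈ rs})).minimalPrimes := by
    refine ⟨⟨inferInstance, Ideal.span_le.mpr ?_⟩, fun q hq _ => ?_⟩
    · rintro _ ⟨r, hr, rfl⟩
      have := hrs r hr
      rwa [← hmap] at this
    · have := hq.1
      have e := h ⟨q.comap π, inferInstance⟩ (fun r hr => by
        change π r ∈ q
        rw [Ideal.Quotient.eq_zero_iff_mem.mpr hr]
        exact q.zero_mem) (fun r hr => hq.2 (Ideal.subset_span ⟨r, hr, rfl⟩))
      simp only at e
      rw [← hmap] at e
      exact (Ideal.comap_injective_of_surjective _ Ideal.Quotient.mk_surjective e).ge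
  have h₂ : (maximalIdeal (R ⧸ p.asIdeal)).height ≤ rs.length := by
    have hfin : (π '' {r | r ∈ rs}).Finite := rs.finite_toSet.image _
    refine (Ideal.height_le_card_of_mem_minimalPrimes_span (s := π '' {r | r ∈ rs}) hfin h₁).trans ?_
    refine Nat.cast_le.mpr ((Set.ncard_image_le rs.finite_toSet).trans ?_)
    have : {r | r ∈ rs} = (rs.toFinset : Set R) := by ext; simp
    rw [this, Set.ncard_coe_finset]
    exact rs.toFinset_card_le
  have h₃ := maximalIdeal_height_eq_ringKrullDim (R := R ⧸ p.asIdeal)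
  rw [ringKrullDim_quotient] at h₃
  have h₄ : (Order.coheight p : WithBot ℕ∞) =
      Order.krullDim (PrimeSpectrum.zeroLocus (p.asIdeal : Set R)) :=
    Order.coheight_eq_krullDim_Ici p
  rw [← h₄] at h₃
  exact (WithBot.coe_le_coe.mp h₃.ge).trans h₂

/-- In a finite module of depth at least `d`, a sequence of `d` parameters is regular. -/
theorem DepthGE.isWeaklyRegular [IsNoetherianRing R] [Module.Finite R M] {rs : List R}
    (h : DepthGE (R := R) rs.length M) (hrs : ∀ r ∈ rs, r ∈ maximalIdeal R)
    (hsupp : ∀ q ∈ Module.support R M, (∀ r ∈ rs, r ∈ q.asIdeal) →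
      q.asIdeal = maximalIdeal R) : IsWeaklyRegular M rs := by
  induction rs generalizing M with
  | nil => exact .nil R M
  | cons x rs ih =>
    -- A zero divisor `x` lies in an associated prime `p`. Then `rs` alone cuts out the closed point
    -- of `Spec R/p`, so `dim R/p` is at most the length of `rs`, one less than the depth permits.
    have hx : IsSMulRegular M x := by
      by_contra hx
      have : x ∈ ⋃ p ∈ associatedPrimes R M, (p : Set R) := by
        rw [biUnion_associatedPrimes_eq_compl_regular]
        exact hx
      obtain ⟨p, hp, hxp⟩ := Set.mem_iUnion₂.mp this
      have hp' : IsAssociatedPrime p M := hp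
      have h₁ := h.le_coheight hp'
      have h₂ := coheight_le_length ⟨p, hp'.isPrime⟩ rs (fun q hq hr => hsupp q
        (Module.mem_support_mono hq
          (by
            rw [Module.support_eq_zeroLocus, ← Submodule.annihilator_top]
            exact hp'.annihilator_le)) (by
            simpa using ⟨hq hxp, hr⟩)) (fun r hr => hrs r (by simp [hr]))
      have h₃ := h₁.trans h₂
      simp only [List.length_cons, Nat.cast_le] at h₃
      lia
    refine .cons hx (ih (h.quotSMulTop (hrs x (by simp)) hx) (fun r hr => hrs r (by simp [hr])) ?_)
    intro q hq hr
    rw [Module.support_quotSMulTop] at hq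
    refine hsupp q hq.1 ?_
    have : x ∈ q.asIdeal := by simpa [PrimeSpectrum.mem_zeroLocus] using hq.2
    simpa using ⟨this, hr⟩

end Depth

end EffacementTheorem

namespace EffacementTheorem

/-! ### Miracle flatness. -/

section MiracleFlatness

open RingTheory.Sequence IsLocalRing Pointwise

universe w

lemma isWeaklyRegular_ringEquiv {R R' : Type*} [CommRing R] [CommRing R'] (e : R ≃+* R')
    {rs : List R} (h : IsWeaklyRegular R rs) : IsWeaklyRegular R' (rs.map e) :=
  (AddEquiv.isWeaklyRegular_congr (e := e.toAddEquiv) (List.forall₂_map_right_iff.mpr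
    (List.forall₂_same.mpr fun r _ x => e.map_mul r x))).mp h

lemma DepthGE.ringEquiv {R R' : Type u} [CommRing R] [CommRing R'] [IsLocalRing R]
    [IsLocalRing R'] (e : R ≃+* R') {d : ℕ} (h : DepthGE (R := R) d R) :
    DepthGE (R := R') d R' := by
  obtain ⟨rs, h₁, h₂, h₃⟩ := h
  refine ⟨rs.map e, by simpa, ?_, isWeaklyRegular_ringEquiv e h₃⟩
  simp only [List.mem_map, forall_exists_index, and_imp, forall_apply_eq_imp_iff₂]
  intro r hr
  have := h₂ r hr
  rw [mem_maximalIdeal, mem_nonunits_iff] at this ⊢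
  simpa using this

lemma DepthGE.mono {R : Type u} [CommRing R] [IsLocalRing R] {M : Type w} [AddCommGroup M]
    [Module R M] {d e : ℕ} (h : DepthGE (R := R) d M) (hle : e ≤ d) : DepthGE (R := R) e M := by
  obtain ⟨rs, h₁, h₂, h₃⟩ := h
  refine ⟨rs.take e, by simp [h₁, hle], fun r hr => h₂ r (List.mem_of_mem_take hr), ?_⟩
  rw [← List.take_append_drop e rs, isWeaklyRegular_append_iff] at h₃
  exact h₃.1

/-- A finite module over a Noetherian local ring is free if it admits a weakly regular sequence
generating the maximal ideal. -/
theorem free_of_isWeaklyRegular {S : Type u} [CommRing S] [IsLocalRing S] [IsNoetherianRing S]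
    {M : Type w} [AddCommGroup M] [Module S M] [Module.Finite S M] (rs : List S)
    (h : Ideal.ofList rs = maximalIdeal S) (hM : IsWeaklyRegular M rs) : Module.Free S M := by
  generalize hn : rs.length = n
  induction n generalizing S M with
  | zero =>
    obtain rfl : rs = [] := by simpa using hn
    have hS : IsField S := by
      rw [IsLocalRing.isField_iff_maximalIdeal_eq, ← h, Ideal.ofList_nil]
    let := hS.toField
    exact Module.Free.of_divisionRing S M
  | succ n ih =>
    obtain _ | ⟨x, rs⟩ := rs
    · simp at hn
    have hx : x ∈ maximalIdeal S := by
      rw [← h, Ideal.ofList_cons]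
      exact Ideal.mem_sup_left (Ideal.mem_span_singleton_self x)
    rw [isWeaklyRegular_cons_iff'] at hM
    have : Nontrivial (S ⧸ Ideal.span {x}) := Ideal.Quotient.nontrivial_iff.mpr
      (fun e => (maximalIdeal.isMaximal S).ne_top (top_unique
        (e ▸ (Ideal.span_singleton_le_iff_mem _).mpr hx)))
    have : IsLocalRing (S ⧸ Ideal.span {x}) :=
      .of_surjective' (Ideal.Quotient.mk _) Ideal.Quotient.mk_surjective
    have hmap : Ideal.ofList (rs.map (Ideal.Quotient.mk (Ideal.span {x}))) =
        maximalIdeal (S ⧸ Ideal.span {x}) := by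
      rw [← Ideal.map_ofList, ← IsLocalRing.map_maximalIdeal_of_surjective
        (Ideal.Quotient.mk (Ideal.span {x})) Ideal.Quotient.mk_surjective, ← h, Ideal.ofList_cons,
        Ideal.map_sup, Ideal.map_quotient_self, bot_sup_eq]
    have := Module.Finite.of_restrictScalars_finite S (S ⧸ Ideal.span {x}) (QuotSMulTop x M)
    have := Module.finitePresentation_of_finite S M
    refine (Module.free_quotSMulTop_iff_free S M (x := x) ?_ hM.1).mp (ih _ hmap hM.2 (by simpa using hn))
    rwa [IsLocalRing.jacobson_eq_maximalIdeal _ bot_ne_top]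

/-- Weak regularity unfolds to statements of ideal membership, which can be tested at the maximal
ideals of `C`. -/
lemma isWeaklyRegular_of_localization_maximal {S : Type*} [CommRing S] {C : Type*} [CommRing C]
    [Algebra S C] (rs : List S)
    (h : ∀ (q : Ideal C) [q.IsMaximal], IsWeaklyRegular (Localization.AtPrime q)
      (rs.map (algebraMap S (Localization.AtPrime q)))) : IsWeaklyRegular C rs := by
  have key (T : Type _) [CommRing T] (ts : List T) : IsWeaklyRegular T ts ↔
      ∀ i (hi : i < ts.length), ∀ a : T,
        ts[i] * a ∈ Ideal.ofList (ts.take i) → a ∈ Ideal.ofList (ts.take i) := by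
    simp only [isWeaklyRegular_iff, isSMulRegular_quotient_iff_mem_of_smul_mem, smul_eq_mul,
      Ideal.mul_top]
  rw [← isWeaklyRegular_map_algebraMap_iff C, key]
  intro i hi a ha
  refine Ideal.mem_of_localization_maximal fun q hq => ?_
  have := (key _ _).mp (h q) i (by simpa using hi) (algebraMap C _ a)
  have e : Ideal.ofList ((rs.map (algebraMap S (Localization.AtPrime q))).take i) =
      (Ideal.ofList ((rs.map (algebraMap S C)).take i)).map (algebraMap C _) := by
    rw [Ideal.map_ofList, ← List.map_take, ← List.map_take, List.map_map,
      IsScalarTower.algebraMap_eq S C (Localization.AtPrime q)]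
    rfl
  rw [e] at this
  refine this ?_
  convert Ideal.mem_map_of_mem (algebraMap C (Localization.AtPrime q)) ha using 1
  simp [IsScalarTower.algebraMap_apply S C (Localization.AtPrime q)]

/-- Miracle flatness over a local ring. -/
theorem free_of_depthGE {S C : Type u} [CommRing S] [IsLocalRing S] [IsNoetherianRing S]
    [CommRing C] [Algebra S C] [Module.Finite S C] (rs : List S)
    (h : Ideal.ofList rs = maximalIdeal S)
    (hC : ∀ (q : Ideal C) [q.IsMaximal],
      DepthGE (R := Localization.AtPrime q) rs.length (Localization.AtPrime q)) :
    Module.Free S C := by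
  refine free_of_isWeaklyRegular rs h (isWeaklyRegular_of_localization_maximal rs fun q hq => ?_)
  have : IsNoetherianRing C := IsNoetherianRing.of_finite S C
  -- By integrality the only primes of `C` containing the image of `rs` are maximal. Hence `rs`
  -- becomes a system of parameters in each `C_q`, and the depth bound makes it regular.
  have hover {p : Ideal C} (hp : p.IsPrime) (hle : ∀ r ∈ rs, algebraMap S C r ∈ p) :
      p.IsMaximal := by
    have h₁ : maximalIdeal S ≤ p.comap (algebraMap S C) := by
      rw [← h]
      exact Ideal.span_le.mpr hle
    have h₂ : p.comap (algebraMap S C) = maximalIdeal S :=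
      ((maximalIdeal.isMaximal S).eq_of_le (hp.comap _).ne_top h₁).symm
    exact Ideal.isMaximal_of_isIntegral_of_isMaximal_comap p (h₂ ▸ maximalIdeal.isMaximal S)
  refine DepthGE.isWeaklyRegular (by simpa using hC q) ?_ ?_
  · simp only [List.mem_map, forall_exists_index, and_imp, forall_apply_eq_imp_iff₂]
    intro r hr
    have hq' : q.comap (algebraMap S C) = maximalIdeal S :=
      IsLocalRing.eq_maximalIdeal (Ideal.isMaximal_comap_of_isIntegral_of_isMaximal q)
    have hr' : r ∈ q.comap (algebraMap S C) := by
      rw [hq', ← h]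
      exact Ideal.subset_span hr
    rw [IsScalarTower.algebraMap_apply S C, IsLocalization.AtPrime.to_map_mem_maximal_iff _ q]
    exact hr'
  · intro p _ hp
    have hmax : (p.asIdeal.comap (algebraMap C _)).IsMaximal := hover inferInstance fun r hr => by
      rw [Ideal.mem_comap, ← IsScalarTower.algebraMap_apply S C]
      exact hp _ (List.mem_map_of_mem hr)
    have hle : p.asIdeal.comap (algebraMap C (Localization.AtPrime q)) ≤ q := by
      exact (Ideal.comap_mono (IsLocalRing.le_maximalIdeal p.isPrime.ne_top)).trans
        (IsLocalization.AtPrime.under_maximalIdeal (Localization.AtPrime q) q).le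
    have heq := hmax.eq_of_le hq.ne_top hle
    rw [← IsLocalization.map_under q.primeCompl (Localization.AtPrime q) p.asIdeal, Ideal.under, heq,
      Localization.AtPrime.map_eq_maximalIdeal]

/-- Miracle flatness for a finite algebra over a regular ring of dimension at most `d`. -/
theorem flat_of_depthGE {P B : Type u} [CommRing P] [IsRegularRing P] [CommRing B] [Algebra P B]
    [Module.Finite P B] {d : ℕ} (hd : ringKrullDim P ≤ d)
    (hB : ∀ (q : Ideal B) [q.IsMaximal],
      DepthGE (R := Localization.AtPrime q) d (Localization.AtPrime q)) :
    Module.Flat P B := by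
  refine Module.flat_of_isLocalized_maximal P B
    (fun (p : Ideal P) _ => Localization (Algebra.algebraMapSubmonoid B p.primeCompl))
    (fun (p : Ideal P) _ => (IsScalarTower.toAlgHom P B
      (Localization (Algebra.algebraMapSubmonoid B p.primeCompl))).toLinearMap) fun p hp => ?_
  let S := Localization.AtPrime p
  let C := Localization (Algebra.algebraMapSubmonoid B p.primeCompl)
  have hS : IsRegularLocalRing S := inferInstance
  have : Module.Finite S C := .of_isLocalization P B p.primeCompl
  have hbij : ∀ (q : Ideal C) [q.IsMaximal],
      DepthGE (R := Localization.AtPrime q) d (Localization.AtPrime q) := fun q hq => by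
    have h₁ : (q.comap (algebraMap S C)).IsMaximal :=
      Ideal.isMaximal_comap_of_isIntegral_of_isMaximal q
    have h₂ : (q.comap (algebraMap B C)).comap (algebraMap P B) = p := by
      rw [Ideal.comap_comap, ← IsScalarTower.algebraMap_eq, IsScalarTower.algebraMap_eq P S C,
        ← Ideal.comap_comap, IsLocalRing.eq_maximalIdeal h₁,
        ← Ideal.under, IsLocalization.AtPrime.under_maximalIdeal S p]
    have h₃ : (q.comap (algebraMap B C)).IsMaximal :=
      Ideal.isMaximal_of_isIntegral_of_isMaximal_comap _ (h₂ ▸ hp)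
    have : IsLocalization.AtPrime (Localization.AtPrime q) (q.comap (algebraMap B C)) :=
      IsLocalization.isLocalization_isLocalization_atPrime_isLocalization
        (Algebra.algebraMapSubmonoid B p.primeCompl) _ q
    exact (hB (q.comap (algebraMap B C))).ringEquiv (IsLocalization.algEquiv
      (q.comap (algebraMap B C)).primeCompl _ _).toRingEquiv
  -- Regularity of `P` enters here: the maximal ideal of `S` is generated by `dim S ≤ d` elements.
  have hgen : (maximalIdeal S).spanFinrank ≤ d := by
    have h₁ := hS.spanFinrank_maximalIdeal
    have h₂ : ringKrullDim S ≤ ringKrullDim P := by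
      rw [IsLocalization.AtPrime.ringKrullDim_eq_height p S]
      exact Ideal.height_le_ringKrullDim_of_ne_top hp.ne_top
    rw [← Nat.cast_le (α := WithBot ℕ∞)]
    exact (h₁.le.trans h₂).trans hd
  obtain ⟨rs, hlen, hrs⟩ : ∃ rs : List S, rs.length ≤ d ∧ Ideal.ofList rs = maximalIdeal S := by
    have hfg := (maximalIdeal S).fg_of_isNoetherianRing
    have hfin := Submodule.FG.finite_generators hfg
    refine ⟨hfin.toFinset.toList, ?_, ?_⟩
    · rw [Finset.length_toList, ← Set.ncard_eq_toFinset_card _ hfin, Submodule.FG.generators_ncard hfg]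
      exact hgen
    · conv_rhs => rw [← Submodule.span_generators (maximalIdeal S)]
      simp [Ideal.ofList, Ideal.span]
  have : Module.Free S C := free_of_depthGE rs hrs fun q hq => (hbij q).mono hlen
  exact Module.Flat.trans P S C

end MiracleFlatness

end EffacementTheorem

namespace EffacementTheorem

/-! ### Depth and differentials of smooth algebras. -/

section SmoothAlgebras

open RingTheory.Sequence IsLocalRing

/-- A maximal ideal of a polynomial ring in `n` variables over a field contains a regular sequence
of length `n`. -/
lemma exists_isWeaklyRegular_mvPolynomial (k : Type u) [Field k] (n : ℕ)
    (p : Ideal (MvPolynomial (Fin n) k)) [hp : p.IsMaximal] :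
    ∃ rs : List (MvPolynomial (Fin n) k), rs.length = n ∧ (∀ r ∈ rs, r ∈ p) ∧
      IsWeaklyRegular (MvPolynomial (Fin n) k) rs := by
  induction n with
  | zero => exact ⟨[], rfl, by simp, .nil _ _⟩
  | succ n ih =>
    let e := MvPolynomial.finSuccEquiv k n
    let R := MvPolynomial (Fin n) k
    let q : Ideal (Polynomial R) := p.comap e.symm
    have hq : q.IsMaximal := Ideal.comap_isMaximal_of_surjective e.symm e.symm.surjective
    have : (q.comap (Polynomial.C : R →+* _)).IsMaximal :=
      Polynomial.isMaximal_comap_C_of_isJacobsonRing q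
    obtain ⟨rs, h₁, h₂, h₃⟩ := ih (q.comap (Polynomial.C : R →+* _))
    let := Ideal.Quotient.field q
    have : Module.Finite k (Polynomial R ⧸ q) := finite_of_finite_type_of_isJacobsonRing _ _
    -- By the Nullstellensatz the residue field is finite over `k`, so the last variable satisfies a
    -- monic equation over `k`. A monic polynomial is regular modulo any ideal extended from `R`.
    obtain ⟨g, hg, hgX⟩ := Algebra.IsIntegral.isIntegral (R := k)
      (Ideal.Quotient.mk q Polynomial.X)
    let g' : Polynomial R := g.map (algebraMap k R)
    have hg' : g'.Monic := hg.map _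
    have hgq : g' ∈ q := by
      rw [← Ideal.Quotient.eq_zero_iff_mem, ← hgX]
      simp only [g', Polynomial.eval₂_eq_sum_range]
      conv_lhs => rw [Polynomial.as_sum_range_C_mul_X_pow (g.map (algebraMap k R))]
      simp only [hg.natDegree_map, Polynomial.coeff_map, map_sum, map_mul, map_pow]
      rfl
    have hreg : IsWeaklyRegular (Polynomial R) (rs.map Polynomial.C ++ [g']) := by
      rw [isWeaklyRegular_append_iff]
      refine ⟨h₃.of_flat (S := Polynomial R), ?_⟩
      rw [isWeaklyRegular_singleton_iff, isSMulRegular_quotient_iff_mem_of_smul_mem]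
      intro a ha
      rw [smul_eq_mul, Ideal.mul_top, ← Ideal.map_ofList] at *
      have hred (b : Polynomial R) : b ∈ (Ideal.ofList rs).map Polynomial.C ↔
          b.map (Ideal.Quotient.mk (Ideal.ofList rs)) = 0 := by
        rw [Ideal.mem_map_C_iff]
        simp [Polynomial.ext_iff, Ideal.Quotient.eq_zero_iff_mem]
      rw [smul_eq_mul, hred, Polynomial.map_mul, (hg'.map _).mul_right_eq_zero_iff] at ha
      rwa [hred]
    refine ⟨(rs.map Polynomial.C ++ [g']).map e.symm.toRingEquiv, by simp [h₁], ?_,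
      isWeaklyRegular_ringEquiv _ hreg⟩
    simp only [List.map_append, List.map_map, List.mem_append, List.mem_map]
    rintro _ (⟨a, ha, rfl⟩ | ⟨a, ha, rfl⟩)
    · exact h₂ a ha
    · rw [List.mem_singleton] at ha
      exact ha ▸ hgq

/-- The extension of fraction fields is unramified and essentially of finite type, hence finite.
This pins the number of étale coordinates to the transcendence degree. -/
lemma isAlgebraic_of_etale (P C : Type u) [CommRing P] [IsDomain P] [CommRing C] [IsDomain C]
    [Algebra P C] [FaithfulSMul P C] [Algebra.Etale P C] : Algebra.IsAlgebraic P C := by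
  let F := FractionRing P
  let K := FractionRing C
  let : Algebra F K := FractionRing.liftAlgebra P K
  have : Algebra.FormallyUnramified C K := .of_isLocalization (nonZeroDivisors C)
  have : Algebra.FormallyUnramified P K := .comp P C K
  have : Algebra.FormallyUnramified F K := .of_restrictScalars P F K
  have : Algebra.EssFiniteType C K := .of_isLocalization K (nonZeroDivisors C)
  have : Algebra.EssFiniteType P K := .comp P C K
  have : Algebra.EssFiniteType F K := .of_comp P F K
  have : Module.Finite F K := Algebra.FormallyUnramified.finite_of_free F K
  have : Algebra.IsAlgebraic F K := inferInstance
  have : Algebra.IsAlgebraic P K := (IsFractionRing.comap_isAlgebraic_iff (A := P) (K := F)).mpr this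
  exact Algebra.IsAlgebraic.tower_bot_of_injective (S := C) (A := K)
    (FaithfulSMul.algebraMap_injective C K)

lemma isMaximal_under_of_finiteType (k : Type*) {P C : Type*} [Field k] [CommRing P] [CommRing C]
    [Algebra k P] [Algebra k C] [Algebra P C] [IsScalarTower k P C] [Algebra.FiniteType k C]
    (q : Ideal C) [hq : q.IsMaximal] : (q.under P).IsMaximal := by
  let := Ideal.Quotient.field q
  have : Module.Finite k (C ⧸ q) := finite_of_finite_type_of_isJacobsonRing _ _
  have hint : Algebra.IsIntegral k (P ⧸ q.under P) := .of_injective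
    (Ideal.quotientMapₐ q (IsScalarTower.toAlgHom k P C) le_rfl)
    (Ideal.quotientMap_injective (I := q) (f := algebraMap P C))
  exact Ideal.Quotient.maximal_of_isField _
    (isField_of_isIntegral_of_isField' (R := k) (Field.toIsField k))

/-- Étale algebras are flat, so a regular sequence in the maximal ideal of the polynomial ring below
`q` remains regular in the local ring at `q`. -/
lemma depthGE_localization_of_etale {k : Type u} [Field k] {n : ℕ} {C : Type u} [CommRing C]
    [Algebra k C] [Algebra (MvPolynomial (Fin n) k) C] [IsScalarTower k (MvPolynomial (Fin n) k) C]
    [Algebra.Etale (MvPolynomial (Fin n) k) C] (q : Ideal C) [q.IsMaximal] :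
    DepthGE (R := Localization.AtPrime q) n (Localization.AtPrime q) := by
  have : Algebra.FiniteType k C := .trans (S := MvPolynomial (Fin n) k) inferInstance inferInstance
  have := isMaximal_under_of_finiteType k (P := MvPolynomial (Fin n) k) q
  obtain ⟨rs, h₁, h₂, h₃⟩ := exists_isWeaklyRegular_mvPolynomial k n
    (q.under (MvPolynomial (Fin n) k))
  have : Module.Flat (MvPolynomial (Fin n) k) C := Algebra.Smooth.flat _ _
  have : Module.Flat C (Localization.AtPrime q) := IsLocalization.flat _ q.primeCompl
  have : Module.Flat (MvPolynomial (Fin n) k) (Localization.AtPrime q) := .trans _ C _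
  refine ⟨_, ?_, ?_, h₃.of_flat⟩
  · simpa
  · simp only [List.mem_map, forall_exists_index, and_imp, forall_apply_eq_imp_iff₂]
    intro r hr
    rw [IsScalarTower.algebraMap_apply _ C]
    exact (IsLocalization.AtPrime.to_map_mem_maximal_iff _ q _).mpr (h₂ r hr)

/-- Étale coordinates near a maximal ideal of a smooth algebra which is a domain. -/
lemma exists_etale_coordinates (k : Type u) [Field k] {B : Type u} [CommRing B] [IsDomain B]
    [Algebra k B] [Algebra.Smooth k B] {d : ℕ} (hd : Algebra.trdeg k B = d) (q : Ideal B)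
    [q.IsMaximal] :
    ∃ f ∉ q, ∃ (_ : Algebra (MvPolynomial (Fin d) k) (Localization.Away f)),
      IsScalarTower k (MvPolynomial (Fin d) k) (Localization.Away f) ∧
      Algebra.Etale (MvPolynomial (Fin d) k) (Localization.Away f) := by
  obtain ⟨f, hf, n, _, _, _⟩ :=
    Algebra.IsSmoothAt.exists_isStandardEtale_mvPolynomial (R := k) (p := q)
  have hf0 : f ≠ 0 := fun h => hf (h ▸ q.zero_mem)
  have hle : Submonoid.powers f ≤ nonZeroDivisors B :=
    powers_le_nonZeroDivisors_of_noZeroDivisors hf0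
  have : IsDomain (Localization.Away f) := IsLocalization.isDomain_localization hle
  have : Algebra.Etale (MvPolynomial (Fin n) k) (Localization.Away f) := inferInstance
  have : Module.Flat (MvPolynomial (Fin n) k) (Localization.Away f) := Algebra.Smooth.flat _ _
  have : FaithfulSMul (MvPolynomial (Fin n) k) (Localization.Away f) := by
    have : Module.IsTorsionFree (MvPolynomial (Fin n) k) (Localization.Away f) := inferInstance
    exact Module.IsTorsionFree.to_faithfulSMul
  have := isAlgebraic_of_etale (MvPolynomial (Fin n) k) (Localization.Away f)
  have h₁ := (IsTranscendenceBasis.mvPolynomial (Fin n) k).algebraMap_comp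
    (A := Localization.Away f)
  have h₂ : Algebra.trdeg k (Localization.Away f) = Algebra.trdeg k B := by
    obtain ⟨s, hs⟩ := exists_isTranscendenceBasis k B
    have : FaithfulSMul B (Localization.Away f) := by
      rw [faithfulSMul_iff_algebraMap_injective]
      exact IsLocalization.injective _ hle
    have : Algebra.IsAlgebraic B (Localization.Away f) :=
      IsLocalization.isAlgebraic _ (Submonoid.powers f)
    rw [← hs.cardinalMk_eq_trdeg, ← (hs.algebraMap_comp (A := Localization.Away f)).cardinalMk_eq_trdeg]
  have h₃ := h₁.lift_cardinalMk_eq_trdeg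
  rw [h₂, hd] at h₃
  obtain rfl : n = d := by simpa using h₃
  exact ⟨f, hf, inferInstance, inferInstance, inferInstance⟩

/-- The local ring at `q` can be computed in a localization `B_f` with étale coordinates, in which
`q` stays maximal because `B` is Jacobson. -/
theorem depthGE_of_smooth (k : Type u) [Field k] {B : Type u} [CommRing B] [IsDomain B]
    [Algebra k B] [Algebra.Smooth k B] {d : ℕ} (hd : Algebra.trdeg k B = d) (q : Ideal B)
    [q.IsMaximal] : DepthGE (R := Localization.AtPrime q) d (Localization.AtPrime q) := by
  obtain ⟨f, hf, _, _, _⟩ := exists_etale_coordinates k hd q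
  let C := Localization.Away f
  have : IsJacobsonRing B := isJacobsonRing_of_finiteType (A := k)
  have hq : (q.map (algebraMap B C)).IsMaximal :=
    IsLocalization.isMaximal_of_isMaximal_disjoint f q inferInstance hf
  have h := depthGE_localization_of_etale (k := k) (n := d) (q.map (algebraMap B C))
  have hc : (q.map (algebraMap B C)).under B = q :=
    (Ideal.IsMaximal.eq_of_le ‹_› (Ideal.IsPrime.under B _).ne_top Ideal.le_comap_map).symm
  have := IsLocalization.isLocalization_isLocalization_atPrime_isLocalization
    (Submonoid.powers f) (Localization.AtPrime (q.map (algebraMap B C))) (q.map (algebraMap B C))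
  have : IsLocalization q.primeCompl (Localization.AtPrime (q.map (algebraMap B C))) := by
    have e : (Ideal.comap (algebraMap B C) (q.map (algebraMap B C))).primeCompl = q.primeCompl := by
      ext x
      exact not_congr (by rw [← hc]; simp [hc])
    rwa [IsLocalization.AtPrime, e] at this
  exact h.ringEquiv (IsLocalization.algEquiv q.primeCompl _ _ :
    Localization.AtPrime (q.map (algebraMap B C)) ≃ₐ[B] Localization.AtPrime q).toRingEquiv

/-- A finite algebra over a polynomial ring in `d` variables is flat if it is a smooth domain of
dimension `d`. -/
theorem flat_of_finite_of_smooth (k : Type u) [Field k] {B P : Type u} [CommRing B] [IsDomain B]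
    [Algebra k B] [Algebra.Smooth k B] {d : ℕ} (hd : Algebra.trdeg k B = d)
    [CommRing P] [IsRegularRing P] [Algebra P B] [Module.Finite P B] (hP : ringKrullDim P ≤ d) :
    Module.Flat P B :=
  flat_of_depthGE hP fun q _ => depthGE_of_smooth k hd q

-- Étale coordinates near `q` show that the fibre of `Ω` at `q` has dimension `d`. It is spanned by
-- differentials of elements of `B`, so `d` of these form a basis. Taking the `b i` in `B` itself,
-- not in a localization, allows them to be interpolated at several points.
open TensorProduct in
theorem exists_span_D_sup_eq_top (k : Type u) [Field k] {B : Type u} [CommRing B] [IsDomain B]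
    [Algebra k B] [Algebra.Smooth k B] {d : ℕ} (hd : Algebra.trdeg k B = d) (q : Ideal B)
    [q.IsMaximal] : ∃ b : Fin d → B,
      Submodule.span B (Set.range fun i => KaehlerDifferential.D k B (b i)) ⊔
        q • (⊤ : Submodule B Ω[B⁄k]) = ⊤ := by
  obtain ⟨f, hf, _, _, _⟩ := exists_etale_coordinates k hd q
  let C := Localization.Away f
  let P := MvPolynomial (Fin d) k
  let M := Ω[B⁄k]
  let := Ideal.Quotient.field q
  have hu (y : Submonoid.powers f) : IsUnit (algebraMap B (B ⧸ q) y) := by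
    obtain ⟨_, m, rfl⟩ := y
    have : algebraMap B (B ⧸ q) f ≠ 0 := by
      rwa [Ne, Ideal.Quotient.algebraMap_eq, Ideal.Quotient.eq_zero_iff_mem]
    simpa using this.isUnit.pow m
  let : Algebra C (B ⧸ q) := (IsLocalization.lift hu : C →+* B ⧸ q).toAlgebra
  have : IsScalarTower B C (B ⧸ q) := .of_algebraMap_eq' (IsLocalization.lift_comp hu).symm
  have : Algebra.FormallyEtale B C := .of_isLocalization (Submonoid.powers f)
  let e₁ : C ⊗[P] Ω[P⁄k] ≃ₗ[C] Ω[C⁄k] := KaehlerDifferential.tensorKaehlerEquivOfFormallyEtale k P C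
  let e₂ : C ⊗[B] M ≃ₗ[C] Ω[C⁄k] := KaehlerDifferential.tensorKaehlerEquivOfFormallyEtale k B C
  let bC : Module.Basis (Fin d) C (C ⊗[B] M) :=
    ((KaehlerDifferential.mvPolynomialBasis k (Fin d)).baseChange C).map (e₁.trans e₂.symm)
  let e₃ := AlgebraTensorModule.cancelBaseChange B C (B ⧸ q) (B ⧸ q) M
  let bκ : Module.Basis (Fin d) (B ⧸ q) ((B ⧸ q) ⊗[B] M) := (bC.baseChange (B ⧸ q)).map e₃
  have hrank : Module.finrank (B ⧸ q) ((B ⧸ q) ⊗[B] M) = d := by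
    simpa using Module.finrank_eq_card_basis bκ
  let S : Set ((B ⧸ q) ⊗[B] M) := Set.range fun b => 1 ⊗ₜ KaehlerDifferential.D k B b
  have hS : Submodule.span (B ⧸ q) S = ⊤ := by
    rw [← Submodule.baseChange_top, ← KaehlerDifferential.span_range_derivation,
      Submodule.baseChange_span, ← Set.range_comp]
    rfl
  have : Module.Finite (B ⧸ q) ((B ⧸ q) ⊗[B] M) := .of_basis bκ
  have hd' : Module.finrank (B ⧸ q) (Submodule.span (B ⧸ q) S) = d := by
    rw [hS, finrank_top, hrank]
  have hex := Submodule.exists_fun_fin_finrank_span_eq (B ⧸ q) S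
  rw [hd', hS] at hex
  obtain ⟨g, hg, hspan, -⟩ := hex
  choose b hb using hg
  refine ⟨b, ?_⟩
  let e₄ := quotTensorEquivQuotSMul M q
  have h₁ : Submodule.span B (Set.range g) = ⊤ := by
    rw [← Submodule.restrictScalars_span B (B ⧸ q) Ideal.Quotient.mk_surjective, hspan,
      Submodule.restrictScalars_top]
  have h₂ : Submodule.span B (Set.range fun i =>
      (q • (⊤ : Submodule B M)).mkQ (KaehlerDifferential.D k B (b i))) = ⊤ := by
    rw [← Submodule.map_top e₄.toLinearMap |>.trans (LinearEquiv.range e₄), ← h₁,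
      Submodule.map_span, ← Set.range_comp]
    congr 2
    ext i
    simp only [Function.comp_apply, ← hb]
    simp [e₄]
  have h₃ := congrArg (Submodule.comap (q • (⊤ : Submodule B M)).mkQ) h₂
  rw [Submodule.comap_top, Set.range_comp' (g := (q • (⊤ : Submodule B M)).mkQ), ← Submodule.map_span, Submodule.comap_map_eq,
    Submodule.ker_mkQ] at h₃
  exact h₃

end SmoothAlgebras

end EffacementTheorem

namespace EffacementTheorem

/-! ### Noether normalization with prescribed differentials. -/

section Coordinates

lemma isIntegral_adjoin_trans {k C : Type*} [CommRing k] [CommRing C] [Algebra k C] {s s' : Set C}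
    (h : Algebra.IsIntegral (Algebra.adjoin k s) C)
    (hs : ∀ a ∈ s, IsIntegral (Algebra.adjoin k s') a) :
    Algebra.IsIntegral (Algebra.adjoin k s') C := by
  let T := integralClosure (Algebra.adjoin k s') C
  have hle : Algebra.adjoin k s ≤ T.restrictScalars k := Algebra.adjoin_le hs
  refine ⟨fun c => ?_⟩
  have : IsIntegral T c := by
    obtain ⟨p, hp, hpc⟩ := h.isIntegral c
    refine ⟨p.map ((algebraMap _ C).codRestrict T fun a => hle a.2), hp.map _, ?_⟩
    rw [Polynomial.eval₂_map]
    exact hpc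
  exact isIntegral_trans (A := T) c this

/-- Integrality over the generated subalgebra is the form of finiteness that is convenient under
changes of coordinates. -/
lemma finite_aeval_iff {k C ι : Type*} [Field k] [CommRing C] [Algebra k C]
    [Algebra.FiniteType k C] (t : ι → C) :
    (MvPolynomial.aeval t : MvPolynomial ι k →ₐ[k] C).Finite ↔
      Algebra.IsIntegral (Algebra.adjoin k (Set.range t)) C := by
  have hr := Algebra.adjoin_range_eq_range_aeval k t
  constructor
  · intro h
    refine ⟨fun c => ?_⟩
    obtain ⟨p, hp, hpc⟩ := h.to_isIntegral c
    refine ⟨p.map ((Subalgebra.inclusion hr.ge).comp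
      (MvPolynomial.aeval t : MvPolynomial ι k →ₐ[k] C).rangeRestrict).toRingHom, hp.map _, ?_⟩
    rw [Polynomial.eval₂_map]
    exact hpc
  · intro h
    refine RingHom.IsIntegral.to_finite (fun c => ?_) ?_
    · obtain ⟨p, hp, hpc⟩ := h.isIntegral c
      let φ := ((Subalgebra.inclusion hr.ge).comp
        (MvPolynomial.aeval t : MvPolynomial ι k →ₐ[k] C).rangeRestrict).toRingHom
      have hφ : Function.Surjective φ := by
        rintro ⟨a, ha⟩
        obtain ⟨b, rfl⟩ := hr.le ha
        exact ⟨b, rfl⟩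
      obtain ⟨q, rfl, -, hq⟩ := Polynomial.lifts_and_natDegree_eq_and_monic
        (f := φ) (p := p) (Polynomial.map_surjective φ hφ p) hp
      refine ⟨q, hq, ?_⟩
      rw [Polynomial.eval₂_map] at hpc
      exact hpc
    · have : (algebraMap k C).FiniteType := RingHom.finiteType_algebraMap.mpr inferInstance
      rw [← (MvPolynomial.aeval t : MvPolynomial ι k →ₐ[k] C).comp_algebraMap] at this
      exact this.of_comp_finiteType

/-- If `C` is finite over `k[t]`, it remains so over `k[g(t) + f]` for all monic `g` of large
degree. -/
lemma exists_isIntegral_adjoin_aeval_add {k C ι : Type*} [Field k] [CommRing C] [Algebra k C]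
    [Algebra.FiniteType k C] [Finite ι] {t : ι → C}
    (h : Algebra.IsIntegral (Algebra.adjoin k (Set.range t)) C) (f : ι → C) :
    ∃ N₀ : ℕ, ∀ g : ι → Polynomial k, (∀ i, (g i).Monic) → (∀ i, N₀ ≤ (g i).natDegree) →
      Algebra.IsIntegral (Algebra.adjoin k (Set.range fun i => (g i).aeval (t i) + f i)) C := by
  classical
  cases nonempty_fintype ι
  rw [← finite_aeval_iff] at h
  let : Algebra (MvPolynomial ι k) C := (MvPolynomial.aeval t).toAlgebra
  have hfin : Module.Finite (MvPolynomial ι k) C := h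
  obtain ⟨r, e, he⟩ := Module.Finite.exists_fin (R := MvPolynomial ι k) (M := C)
  have key (c : C) : ∃ P : Fin r → MvPolynomial ι k, c = ∑ j, MvPolynomial.aeval t (P j) * e j := by
    obtain ⟨P, hP⟩ := (Submodule.mem_span_range_iff_exists_fun _).mp (he ▸ Submodule.mem_top : c ∈ _)
    exact ⟨P, hP.symm⟩
  choose P hP using fun i j => key (f i * e j)
  -- The degree of `g i` must exceed the degrees of all coefficients `P i j l` that express `f i * e
  -- j` in the generators.
  refine ⟨(∑ i, ∑ j, ∑ l, (P i j l).totalDegree) + 1, fun g hg hN => ?_⟩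
  have hdeg (i j l) : (P i j l).totalDegree < (g i).natDegree := by
    refine lt_of_le_of_lt ?_ (Nat.lt_of_succ_le (hN i))
    refine le_trans ?_ (Finset.single_le_sum (fun _ _ => Nat.zero_le _) (Finset.mem_univ i))
    refine le_trans ?_ (Finset.single_le_sum (fun _ _ => Nat.zero_le _) (Finset.mem_univ j))
    exact Finset.single_le_sum (f := fun l => (P i j l).totalDegree) (fun _ _ => Nat.zero_le _)
      (Finset.mem_univ l)
  set u : ι → C := fun i => (g i).aeval (t i) + f i with hu
  let S := Algebra.adjoin k (Set.range u)
  -- A monomial of degree above `D₀` contains some `t i` to a power at least `deg (g i)`, so it can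
  -- be rewritten.
  let D₀ := ∑ i, (g i).natDegree
  let G : Set C := (fun x : (ι →₀ ℕ) × Fin r =>
    MvPolynomial.aeval t (MvPolynomial.monomial x.1 (1 : k)) * e x.2) ''
      ({α | α.degree ≤ D₀} ×ˢ Set.univ)
  have hG : G.Finite := by
    exact ((Finsupp.finite_of_degree_le D₀).prod Set.finite_univ).image _
  have main : ∀ (D : ℕ) (p : MvPolynomial ι k), p.totalDegree ≤ D → ∀ j,
      MvPolynomial.aeval t p * e j ∈ Submodule.span S G := by
    intro D
    induction D using Nat.strong_induction_on with
    | _ D ih =>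
    intro p hp j
    rw [p.as_sum, map_sum, Finset.sum_mul]
    refine Submodule.sum_mem _ fun α hα => ?_
    have hαD : α.degree ≤ D := (MvPolynomial.le_totalDegree hα).trans hp
    suffices MvPolynomial.aeval t (MvPolynomial.monomial α (1 : k)) * e j ∈ Submodule.span S G by
      have := Submodule.smul_mem _ (algebraMap k S (p.coeff α)) this
      rw [algebraMap_smul, ← smul_mul_assoc, ← map_smul] at this
      simpa [MvPolynomial.smul_monomial] using this
    by_cases hα₀ : α.degree ≤ D₀
    · exact Submodule.subset_span ⟨(α, j), ⟨hα₀, trivial⟩, rfl⟩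
    obtain ⟨i, hi⟩ : ∃ i, (g i).natDegree ≤ α i := by
      by_contra! H
      refine hα₀ ?_
      rw [Finsupp.degree_eq_sum]
      exact Finset.sum_le_sum fun i _ => (H i).le
    obtain ⟨β, rfl⟩ : ∃ β, α = β + Finsupp.single i (g i).natDegree :=
      ⟨α - Finsupp.single i (g i).natDegree, (tsub_add_cancel_of_le (by simpa using hi)).symm⟩
    rw [map_add, Finsupp.degree_single] at hαD
    have hpos : 0 < (g i).natDegree := by have := hN i; omega
    -- After this substitution `u i` is a scalar of `S`, while the terms from `f i` and from the
    -- lower part of `g i` have smaller degree in `t`. This drives the induction on the degree.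
    have hg' : t i ^ (g i).natDegree = u i - f i - (g i).eraseLead.aeval (t i) := by
      have := congrArg (Polynomial.aeval (t i)) (g i).eraseLead_add_C_mul_X_pow
      rw [(hg i).leadingCoeff, map_one, one_mul, map_add, map_pow, Polynomial.aeval_X] at this
      rw [hu]
      linear_combination this
    have h₁ : MvPolynomial.aeval t (MvPolynomial.monomial (β + Finsupp.single i (g i).natDegree)
        (1 : k)) = MvPolynomial.aeval t (MvPolynomial.monomial β (1 : k)) * t i ^ (g i).natDegree := by
      rw [← one_mul (1 : k), ← MvPolynomial.monomial_mul, map_mul]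
      simp [MvPolynomial.aeval_monomial]
    have h₂ : MvPolynomial.aeval t (MvPolynomial.monomial β (1 : k)) * t i ^ (g i).natDegree * e j =
        u i * (MvPolynomial.aeval t (MvPolynomial.monomial β (1 : k)) * e j) -
        ∑ l, MvPolynomial.aeval t (MvPolynomial.monomial β (1 : k) * P i j l) * e l -
        MvPolynomial.aeval t (MvPolynomial.monomial β (1 : k) *
          (g i).eraseLead.aeval (MvPolynomial.X i)) * e j := by
      simp only [map_mul, mul_assoc]
      rw [← Finset.mul_sum, ← hP, hg', ← Polynomial.aeval_algHom_apply, MvPolynomial.aeval_X]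
      ring
    have hβ : (MvPolynomial.monomial β (1 : k)).totalDegree = β.degree := by
      rw [MvPolynomial.totalDegree_monomial _ one_ne_zero]
      rfl
    rw [h₁, h₂]
    refine Submodule.sub_mem _ (Submodule.sub_mem _ ?_ (Submodule.sum_mem _ fun l _ => ?_)) ?_
    · exact Submodule.smul_mem _ (⟨u i, Algebra.subset_adjoin ⟨i, rfl⟩⟩ : S)
        (ih β.degree (by omega) _ hβ.le j)
    · refine ih (D - 1) (by omega) _ ((MvPolynomial.totalDegree_mul _ _).trans ?_) l
      have := hdeg i j l
      omega
    · refine ih (D - 1) (by omega) _ ((MvPolynomial.totalDegree_mul _ _).trans ?_) j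
      have h₃ : ((g i).eraseLead.aeval (MvPolynomial.X i : MvPolynomial ι k)).totalDegree ≤
          (g i).natDegree - 1 := by
        rw [Polynomial.aeval_eq_sum_range]
        refine MvPolynomial.totalDegree_finsetSum_le fun m hm => ?_
        refine (MvPolynomial.totalDegree_smul_le _ _).trans ?_
        refine (MvPolynomial.totalDegree_pow _ _).trans ?_
        have := (g i).eraseLead_natDegree_le
        have := Finset.mem_range.mp hm
        rw [MvPolynomial.totalDegree_X]
        omega
      omega
  have : Module.Finite S C := by
    refine ⟨⟨hG.toFinset, ?_⟩⟩
    rw [hG.coe_toFinset, eq_top_iff]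
    rintro c -
    obtain ⟨p, rfl⟩ := key c
    exact Submodule.sum_mem _ fun j _ => main _ _ le_rfl _
  exact inferInstanceAs (Algebra.IsIntegral S C)

/-- Substituting `c X + y` for the variables, the coefficient of `X ^ D` for `D` at least the total
degree is the value at `c` of the component of degree `D`. -/
lemma natDegree_aeval_linear_le {k S ι : Type*} [Field k] [CommRing S] [Algebra k S] [Fintype ι]
    (c : ι → k) (y : ι → S) (h : MvPolynomial ι k) :
    (MvPolynomial.aeval (fun i => Polynomial.C (algebraMap k S (c i)) * Polynomial.X +
      Polynomial.C (y i)) h).natDegree ≤ h.totalDegree ∧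
    (MvPolynomial.aeval (fun i => Polynomial.C (algebraMap k S (c i)) * Polynomial.X +
      Polynomial.C (y i)) h).coeff h.totalDegree =
      algebraMap k S (MvPolynomial.eval c (MvPolynomial.homogeneousComponent h.totalDegree h)) := by
  classical
  set L : ι → Polynomial S := fun i => Polynomial.C (algebraMap k S (c i)) * Polynomial.X +
      Polynomial.C (y i)
  have hL (i) : (L i).natDegree ≤ 1 := Polynomial.natDegree_linear_le
  have hL1 (i) : (L i).coeff 1 = algebraMap k S (c i) := by simp [L, Polynomial.coeff_C]
  have hpow (i) (m : ℕ) : (L i ^ m).natDegree ≤ m := by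
    simpa using Polynomial.natDegree_pow_le_of_le m (hL i)
  have hmon (α : ι →₀ ℕ) : (∏ i, L i ^ α i).natDegree ≤ α.degree := by
    rw [Finsupp.degree_eq_sum]
    exact (Polynomial.natDegree_prod_le _ _).trans (Finset.sum_le_sum fun i _ => hpow i _)
  have hmonc (α : ι →₀ ℕ) : (∏ i, L i ^ α i).coeff α.degree =
      algebraMap k S (∏ i, c i ^ α i) := by
    rw [Finsupp.degree_eq_sum]
    suffices ∀ s : Finset ι, (∏ i ∈ s, L i ^ α i).natDegree ≤ ∑ i ∈ s, α i ∧
        (∏ i ∈ s, L i ^ α i).coeff (∑ i ∈ s, α i) = algebraMap k S (∏ i ∈ s, c i ^ α i) from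
      (this Finset.univ).2
    intro s
    induction s using Finset.induction_on with
    | empty => simp
    | insert i s hi ih =>
      rw [Finset.prod_insert hi, Finset.sum_insert hi, Finset.prod_insert hi]
      refine ⟨Polynomial.natDegree_mul_le_of_le (hpow i _) ih.1, ?_⟩
      rw [Polynomial.coeff_mul_add_eq_of_natDegree_le (hpow i _) ih.1, ih.2, map_mul, map_pow, ← hL1]
      congr 1
      simpa using Polynomial.coeff_pow_of_natDegree_le (m := α i) (hL i)
  have hexp : MvPolynomial.aeval L h = ∑ α ∈ h.support, h.coeff α • ∏ i, L i ^ α i := by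
    rw [MvPolynomial.aeval_def, MvPolynomial.eval₂_eq']
    simp [Algebra.smul_def]
  constructor
  · rw [hexp]
    refine Polynomial.natDegree_sum_le_of_forall_le _ _ fun α hα => ?_
    exact (Polynomial.natDegree_smul_le _ _).trans ((hmon α).trans (MvPolynomial.le_totalDegree hα))
  · rw [hexp, Polynomial.finsetSum_coeff, MvPolynomial.homogeneousComponent_apply, map_sum, map_sum,
      Finset.sum_filter]
    refine Finset.sum_congr rfl fun α hα => ?_
    have hle : α.degree ≤ h.totalDegree := MvPolynomial.le_totalDegree hα
    split_ifs with hdeg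
    · rw [← hdeg, Polynomial.coeff_smul, hmonc, MvPolynomial.eval_monomial, Finsupp.prod_fintype _ _ (by simp),
        map_mul, Algebra.smul_def]
    · rw [Polynomial.coeff_smul, Polynomial.coeff_eq_zero_of_natDegree_lt, smul_zero]
      exact (hmon α).trans_lt (lt_of_le_of_ne hle hdeg)

/-- Noether normalization adapted to a proper nonzero ideal `I` of a domain `B`. -/
lemma exists_isIntegral_adjoin_and_quotient (k : Type u) [Field k] [Infinite k] {B : Type u}
    [CommRing B] [IsDomain B] [Algebra k B] [Algebra.FiniteType k B] (I : Ideal B) (h₀ : I ≠ ⊥)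
    (h₁ : I ≠ ⊤) :
    ∃ (n : ℕ) (t : Fin (n + 1) → B), Algebra.trdeg k B = (n + 1 : ℕ) ∧
      Algebra.IsIntegral (Algebra.adjoin k (Set.range t)) B ∧
      Algebra.IsIntegral (Algebra.adjoin k (Set.range fun i => Ideal.Quotient.mk I (t (Fin.succ i))))
        (B ⧸ I) := by
  classical
  obtain ⟨s, φ, hφ, hfin⟩ := exists_finite_inj_algHom_of_fg k B
  let T : Fin s → B := fun i => φ (MvPolynomial.X i)
  have hφT : φ = MvPolynomial.aeval T := MvPolynomial.algHom_ext fun i => by simp [T]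
  have hT : Algebra.IsIntegral (Algebra.adjoin k (Set.range T)) B := by
    rwa [← finite_aeval_iff, ← hφT]
  have htr : Algebra.trdeg k B = s := by
    let := φ.toAlgebra
    have : IsScalarTower k (MvPolynomial (Fin s) k) B := .of_algebraMap_eq' φ.comp_algebraMap.symm
    have : FaithfulSMul (MvPolynomial (Fin s) k) B :=
      (faithfulSMul_iff_algebraMap_injective _ _).mpr hφ
    have : Module.Finite (MvPolynomial (Fin s) k) B := hfin
    have := ((IsTranscendenceBasis.mvPolynomial (Fin s) k).algebraMap_comp
      (A := B)).lift_cardinalMk_eq_trdeg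
    simpa using this.symm
  -- A nonzero ideal of a domain meets a subring over which the domain is integral nontrivially.
  obtain ⟨h, hI, hne⟩ : ∃ h, φ h ∈ I ∧ h ≠ 0 := by
    let := φ.toAlgebra
    have : Module.Finite (MvPolynomial (Fin s) k) B := hfin
    obtain ⟨b, hb, hb0⟩ := Submodule.exists_mem_ne_zero_of_ne_bot h₀
    have := Ideal.comap_ne_bot_of_integral_mem (R := MvPolynomial (Fin s) k) (I := I)
      hb0 hb (Algebra.IsIntegral.isIntegral b)
    obtain ⟨h, hh, hh0⟩ := Submodule.exists_mem_ne_zero_of_ne_bot this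
    exact ⟨h, hh, hh0⟩
  let D := h.totalDegree
  have hD : D ≠ 0 := by
    intro hD
    have hc := MvPolynomial.totalDegree_eq_zero_iff_eq_C.mp hD
    have hc0 : h.coeff 0 ≠ 0 := fun h0 => hne (by rw [hc, h0, map_zero])
    refine h₁ (Ideal.eq_top_of_isUnit_mem _ hI ?_)
    rw [hc]
    exact ((hc0.isUnit.map MvPolynomial.C).map φ)
  have hhom : MvPolynomial.homogeneousComponent D h ≠ 0 := by
    intro h0
    obtain ⟨α, hα, hmax⟩ := h.support.exists_mem_eq_sup (MvPolynomial.support_nonempty.mpr hne)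
      fun m => m.degree
    have hαD : α.degree = D := hmax.symm
    have := congrArg (MvPolynomial.coeff α) h0
    rw [MvPolynomial.coeff_homogeneousComponent, if_pos hαD, MvPolynomial.coeff_zero] at this
    exact MvPolynomial.mem_support_iff.mp hα this
  -- The leading form of `h` is nonzero, so over an infinite field it has a nonzero value; this
  -- value becomes the leading coefficient in the direction `c`.
  obtain ⟨c, hc⟩ : ∃ c, MvPolynomial.eval c (MvPolynomial.homogeneousComponent D h) ≠ 0 := by
    by_contra! H
    exact hhom (MvPolynomial.funext fun c => by simpa using H c)
  obtain ⟨i₀, hi₀⟩ : ∃ i₀, c i₀ ≠ 0 := by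
    by_contra! H
    obtain rfl : c = 0 := funext H
    refine hc ?_
    rw [MvPolynomial.eval_zero, MvPolynomial.constantCoeff_eq, MvPolynomial.coeff_homogeneousComponent,
      if_neg (by simpa using hD.symm)]
  obtain ⟨n, rfl⟩ : ∃ n, s = n + 1 := ⟨s - 1, by have := i₀.pos; omega⟩
  -- A linear change of variables with `T i = c i * X + y i` and `y i₀ = 0`: only `n` of the `y i`
  -- are left as coordinates.
  let X : B := algebraMap k B (c i₀)⁻¹ * T i₀
  let y : Fin (n + 1) → B := fun i => T i - algebraMap k B (c i) * X
  have hy₀ : y i₀ = 0 := by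
    simp only [y, X, ← mul_assoc, ← map_mul, mul_inv_cancel₀ hi₀, map_one, one_mul, sub_self]
  let t : Fin (n + 1) → B := Fin.cons X fun j => y (i₀.succAbove j)
  have hyt (i) (hi : i ≠ i₀) : ∃ j, t (Fin.succ j) = y i := by
    obtain ⟨j, rfl⟩ := Fin.exists_succAbove_eq hi
    exact ⟨j, by simp [t]⟩
  refine ⟨n, t, htr, isIntegral_adjoin_trans hT ?_, ?_⟩
  · rintro _ ⟨i, rfl⟩
    have hmem : T i ∈ Algebra.adjoin k (Set.range t) := by
      have : T i = y i + c i • X := by simp [y, Algebra.smul_def]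
      rw [this]
      refine add_mem ?_ (Subalgebra.smul_mem _ (Algebra.subset_adjoin (show X ∈ Set.range t from ⟨0, by simp [t]⟩)) _)
      by_cases hi : i = i₀
      · rw [hi, hy₀]
        exact zero_mem _
      · obtain ⟨j, hj⟩ := hyt i hi
        exact Algebra.subset_adjoin ⟨_, hj⟩
    exact isIntegral_algebraMap (R := Algebra.adjoin k (Set.range t)) (x := ⟨_, hmem⟩)
  · have hT' : Algebra.IsIntegral
        (Algebra.adjoin k (Set.range fun i => Ideal.Quotient.mk I (T i))) (B ⧸ I) := by
      rw [← finite_aeval_iff]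
      have : (Ideal.Quotient.mkₐ k I).Finite :=
        RingHom.Finite.of_surjective _ Ideal.Quotient.mk_surjective
      have := this.comp hfin
      have e : MvPolynomial.aeval (fun i => Ideal.Quotient.mk I (T i)) =
          (Ideal.Quotient.mkₐ k I).comp φ := MvPolynomial.algHom_ext fun i => by simp [T]
      rwa [e]
    set Y : Set (B ⧸ I) := Set.range fun i => Ideal.Quotient.mk I (t (Fin.succ i)) with hY
    have hymem (i) : Ideal.Quotient.mk I (y i) ∈ Algebra.adjoin k Y := by
      by_cases hi : i = i₀
      · rw [hi, hy₀, map_zero]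
        exact zero_mem _
      · obtain ⟨j, hj⟩ := hyt i hi
        exact Algebra.subset_adjoin ⟨_, congrArg _ hj⟩
    have hTi (i) : Ideal.Quotient.mk I (T i) =
        Ideal.Quotient.mk I (y i) + algebraMap k _ (c i) * Ideal.Quotient.mk I X := by
      simp only [y, map_sub, map_mul]
      exact (sub_add_cancel _ _).symm
    -- Modulo `I`, the relation `h(c X + y) = 0` is, up to a nonzero constant, a monic equation for
    -- `X` over `k[y]`.
    have hXint : IsIntegral (Algebra.adjoin k Y) (Ideal.Quotient.mk I X) := by
      let y' : Fin (n + 1) → Algebra.adjoin k Y := fun i => ⟨_, hymem i⟩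
      obtain ⟨hp₁, hp₂⟩ := natDegree_aeval_linear_le c y' h
      set p := MvPolynomial.aeval (fun i => Polynomial.C (algebraMap k (Algebra.adjoin k Y) (c i)) *
        Polynomial.X + Polynomial.C (y' i)) h with hp
      refine ⟨Polynomial.C (algebraMap k _ (MvPolynomial.eval c
        (MvPolynomial.homogeneousComponent D h))⁻¹) * p,
        Polynomial.monic_of_natDegree_le_of_coeff_eq_one D ?_ ?_, ?_⟩
      · exact (Polynomial.natDegree_C_mul_le _ _).trans hp₁
      · rw [Polynomial.coeff_C_mul, hp₂, ← map_mul, inv_mul_cancel₀ hc, map_one]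
      · have hz : Polynomial.aeval (Ideal.Quotient.mk I X) p = 0 := by
          rw [← Ideal.Quotient.eq_zero_iff_mem] at hI
          rw [← hI, hφT]
          have e : ((Polynomial.aeval (R := Algebra.adjoin k Y)
              (Ideal.Quotient.mk I X)).restrictScalars k).comp (MvPolynomial.aeval
              (fun i => Polynomial.C (algebraMap k (Algebra.adjoin k Y) (c i)) *
                Polynomial.X + Polynomial.C (y' i))) =
              (Ideal.Quotient.mkₐ k I).comp (MvPolynomial.aeval T) := by
            refine MvPolynomial.algHom_ext fun i => ?_
            simp only [AlgHom.comp_apply, MvPolynomial.aeval_X, AlgHom.restrictScalars_apply, map_add, map_mul,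
              Polynomial.aeval_C, Polynomial.aeval_X]
            exact (add_comm _ _).trans (hTi i).symm
          exact DFunLike.congr_fun e h
        rw [Polynomial.eval₂_mul, ← Polynomial.aeval_def (p := p), hz, mul_zero]
    refine isIntegral_adjoin_trans hT' ?_
    rintro _ ⟨i, rfl⟩
    change IsIntegral _ (Ideal.Quotient.mk I (T i))
    have : Ideal.Quotient.mk I (T i) = algebraMap (Algebra.adjoin k Y) _ ⟨_, hymem i⟩ +
        algebraMap (Algebra.adjoin k Y) _ (algebraMap k _ (c i)) * Ideal.Quotient.mk I X := hTi i
    rw [this]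
    exact isIntegral_algebraMap.add (isIntegral_algebraMap.mul hXint)

lemma derivation_mem_smul_top {k B M : Type*} [CommRing k] [CommRing B] [Algebra k B]
    [AddCommGroup M] [Module k M] [Module B M] (D : Derivation k B M) (q : Ideal B) {b : B}
    (hb : b ∈ q ^ 2) : D b ∈ q • (⊤ : Submodule B M) := by
  rw [pow_two] at hb
  refine Submodule.mul_induction_on hb (fun x hx y hy => ?_) fun x y hx hy => ?_
  · rw [Derivation.leibniz]
    exact add_mem (Submodule.smul_mem_smul hx trivial) (Submodule.smul_mem_smul hy trivial)
  · rw [map_add]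
    exact add_mem hx hy

/-- By the Leibniz rule a change in `q²` alters differentials only by elements of `q • M`. Nakayama
then gives an element `r ≡ 1` modulo `q` that carries `M` into the span. -/
lemma exists_smul_mem_span_derivation {k B M ι : Type*} [CommRing k] [CommRing B] [Algebra k B]
    [AddCommGroup M] [Module k M] [Module B M] [Module.Finite B M] (D : Derivation k B M)
    (q : Ideal B) {b : ι → B}
    (hb : Submodule.span B (Set.range fun i => D (b i)) ⊔ q • (⊤ : Submodule B M) = ⊤)
    {t : ι → B} (ht : ∀ i, t i - b i ∈ q ^ 2) :
    ∃ r, r - 1 ∈ q ∧ ∀ ω : M, r • ω ∈ Submodule.span B (Set.range fun i => D (t i)) := by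
  set N := Submodule.span B (Set.range fun i => D (t i))
  have hle : (⊤ : Submodule B M) ≤ N ⊔ q • ⊤ := by
    refine hb.ge.trans (sup_le (Submodule.span_le.mpr ?_) le_sup_right)
    rintro _ ⟨i, rfl⟩
    have h₂ : D (b i) = D (t i) + - D (t i - b i) := by
      rw [map_sub]
      abel
    change D (b i) ∈ N ⊔ q • ⊤
    rw [h₂]
    exact Submodule.add_mem_sup (Submodule.subset_span ⟨i, rfl⟩)
      (neg_mem (derivation_mem_smul_top D _ (ht i)))
  obtain ⟨r, hr, hrM⟩ := Submodule.exists_sub_one_mem_and_smul_le_of_fg_of_le_sup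
    Module.Finite.fg_top le_top hle
  exact ⟨r, hr, fun ω => hrM (Submodule.smul_mem_pointwise_smul _ _ _ trivial)⟩

/-- Coordinates on a smooth affine variety: they are finite, finite on a given proper closed
subset after forgetting one of them, and étale at finitely many given points. -/
theorem exists_coordinates (k : Type u) [Field k] [Infinite k] {B : Type u} [CommRing B]
    [IsDomain B] [Algebra k B] [Algebra.Smooth k B] (I : Ideal B) (h₀ : I ≠ ⊥) (h₁ : I ≠ ⊤)
    (s : Set (Ideal B)) (hs : s.Finite) (hprime : ∀ p ∈ s, p ≠ ⊤) :
    ∃ (n : ℕ) (t : Fin (n + 1) → B), Algebra.trdeg k B = (n + 1 : ℕ) ∧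
      (MvPolynomial.aeval t : MvPolynomial (Fin (n + 1)) k →ₐ[k] B).Finite ∧
      (MvPolynomial.aeval (fun i => Ideal.Quotient.mk I (t (Fin.succ i))) :
        MvPolynomial (Fin n) k →ₐ[k] B ⧸ I).Finite ∧
      ∀ p ∈ s, ∃ g ∉ p, ∀ ω : Ω[B⁄k], g • ω ∈
        Submodule.span B (Set.range fun i => KaehlerDifferential.D k B (t i)) := by
  classical
  obtain ⟨n, t, htr, hB, hI⟩ := exists_isIntegral_adjoin_and_quotient k I h₀ h₁
  -- It suffices to treat a maximal ideal above each given ideal, since an element outside the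
  -- former is outside the latter.
  choose! m hm using fun p (hp : p ∈ s) => Ideal.exists_le_maximal p (hprime p hp)
  let ι := (hs.toFinset.image m : Finset (Ideal B))
  have hmax (q : ι) : q.1.IsMaximal := by
    obtain ⟨p, hp, h⟩ := Finset.mem_image.mp q.2
    exact h ▸ (hm p (hs.mem_toFinset.mp hp)).1
  choose b hb using fun q : ι => exists_span_D_sup_eq_top k htr q.1
  have hcop : Pairwise fun p q : ι => IsCoprime (p.1 ^ 2) (q.1 ^ 2) := fun p q hpq =>
    (Ideal.isCoprime_of_isMaximal (fun h => hpq (Subtype.ext h))).pow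
  -- The Chinese remainder theorem produces functions with prescribed first-order behaviour at all
  -- the points at once.
  choose f hf using fun i : Fin (n + 1) => Ideal.exists_forall_sub_mem_ideal
    (I := fun q : ι => q.1 ^ 2) hcop (fun q => b q i)
  have hpoly (i : Fin (n + 1)) (q : ι) : ∃ g : Polynomial k, g.Monic ∧ g.aeval (t i) ∈ q.1 := by
    let := Ideal.Quotient.field q.1
    have : Module.Finite k (B ⧸ q.1) := finite_of_finite_type_of_isJacobsonRing _ _
    obtain ⟨g, hg, hgX⟩ := Algebra.IsIntegral.isIntegral (R := k) (Ideal.Quotient.mk q.1 (t i))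
    refine ⟨g, hg, ?_⟩
    rw [← Ideal.Quotient.eq_zero_iff_mem, ← hgX, ← Polynomial.aeval_def]
    exact (Polynomial.aeval_algHom_apply (Ideal.Quotient.mkₐ k q.1) _ _).symm
  choose g hg hgq using hpoly
  obtain ⟨N₁, hN₁⟩ := exists_isIntegral_adjoin_aeval_add hB f
  obtain ⟨N₂, hN₂⟩ := exists_isIntegral_adjoin_aeval_add hI fun i => Ideal.Quotient.mk I (f i.succ)
  -- The factor `X` and the exponent make the degree large enough for both integrality bounds. The
  -- product makes the value lie in every `q`, and the exponent, being at least `2`, puts it in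
  -- `q²`. So only `f` contributes to the differentials modulo `q`.
  let G : Fin (n + 1) → Polynomial k := fun i =>
    (Polynomial.X * ∏ q : ι, g i q) ^ (N₁ + N₂ + 2)
  have hprod (i) : (∏ q : ι, g i q).Monic := Polynomial.monic_prod_of_monic _ _ fun q _ => hg i q
  have hG (i) : (G i).Monic := (Polynomial.monic_X.mul (hprod i)).pow _
  have hGdeg (i) : N₁ + N₂ ≤ (G i).natDegree := by
    rw [(Polynomial.monic_X.mul (hprod i)).natDegree_pow, Polynomial.monic_X.natDegree_mul (hprod i),
      Polynomial.natDegree_X]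
    nlinarith [Nat.zero_le (∏ q : ι, g i q).natDegree]
  have hGq (i) (q : ι) : (G i).aeval (t i) ∈ q.1 ^ 2 := by
    rw [map_pow]
    refine Ideal.pow_le_pow_right (by omega : 2 ≤ N₁ + N₂ + 2) (Ideal.pow_mem_pow ?_ _)
    rw [map_mul, map_prod]
    exact Ideal.mul_mem_left _ _ (Ideal.mem_of_dvd _ (Finset.dvd_prod_of_mem _ (Finset.mem_univ q))
      (hgq i q))
  refine ⟨n, fun i => (G i).aeval (t i) + f i, htr, ?_, ?_, fun p hp => ?_⟩
  · exact (finite_aeval_iff _).mpr (hN₁ G hG fun i => (Nat.le_add_right _ _).trans (hGdeg i))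
  · have e : (fun i : Fin n => Ideal.Quotient.mk I ((G i.succ).aeval (t i.succ) + f i.succ)) =
        fun i => (G i.succ).aeval (Ideal.Quotient.mk I (t i.succ)) +
          Ideal.Quotient.mk I (f i.succ) := by
      ext i
      rw [map_add]
      congr 1
      exact (Polynomial.aeval_algHom_apply (Ideal.Quotient.mkₐ k I) _ _).symm
    rw [e]
    exact (finite_aeval_iff _).mpr (hN₂ (fun i => G i.succ) (fun i => hG i.succ)
      fun i => (Nat.le_add_left _ _).trans (hGdeg i.succ))
  · let q : ι := ⟨m p, Finset.mem_image_of_mem _ (hs.mem_toFinset.mpr hp)⟩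
    obtain ⟨r, hr, hrM⟩ := exists_smul_mem_span_derivation (KaehlerDifferential.D k B) q.1 (hb q)
      (t := fun i => (G i).aeval (t i) + f i) fun i => by
        rw [add_sub_assoc]
        exact add_mem (hGq i q) (hf i q)
    refine ⟨r, fun hrp => (hmax q).ne_top ((Ideal.eq_top_iff_one _).mpr ?_), hrM⟩
    have := sub_mem ((hm p hp).2 hrp) hr
    rwa [sub_sub_cancel] at this

end Coordinates

end EffacementTheorem

namespace EffacementTheorem

/-! ### Finite flatness over the line under a monic change of coordinate. -/

section MonicOperators

open Polynomial

variable {R : Type*} [CommRing R] {r : ℕ}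

/-- A vector of polynomials all of whose entries have degree `< d`. -/
def DegLT (v : Fin r → R[X]) (d : ℕ) : Prop := ∀ j, (v j).degree < d

lemma DegLT.mono {v : Fin r → R[X]} {d e : ℕ} (h : DegLT v d) (hde : d ≤ e) : DegLT v e :=
  fun j => (h j).trans_le (by exact_mod_cast hde)

lemma DegLT.coeff_eq_zero {v : Fin r → R[X]} {d e : ℕ} (h : DegLT v d) (hde : d ≤ e) (j : Fin r) :
    (v j).coeff e = 0 :=
  coeff_eq_zero_of_degree_lt ((h j).trans_le (by exact_mod_cast hde))

lemma degLT_iff {v : Fin r → R[X]} {d : ℕ} : DegLT v d ↔ ∀ j e, d ≤ e → (v j).coeff e = 0 :=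
  forall_congr' fun _ => degree_lt_iff_coeff_zero _ _

lemma DegLT.natDegree_le {v : Fin r → R[X]} {d : ℕ} (h : DegLT v (d + 1)) (j : Fin r) :
    (v j).natDegree ≤ d :=
  natDegree_le_iff_coeff_eq_zero.mpr fun _ he => h.coeff_eq_zero he j

lemma exists_degLT (v : Fin r → R[X]) : ∃ d, DegLT v d := by
  refine ⟨(∑ j, (v j).natDegree) + 1, fun j => ?_⟩
  refine degree_le_natDegree.trans_lt ?_
  exact_mod_cast Nat.lt_succ_of_le
    (Finset.single_le_sum (f := fun j => (v j).natDegree) (fun _ _ => Nat.zero_le _)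
      (Finset.mem_univ j))

lemma DegLT.smul {v : Fin r → R[X]} {d e : ℕ} (h : DegLT v (d + 1)) {p : R[X]}
    (hp : p.natDegree ≤ e) : DegLT (p • v) (d + e + 1) := by
  intro j
  refine (degree_mul_le _ _).trans_lt ?_
  have h₁ : p.degree ≤ e := degree_le_of_natDegree_le hp
  have h₂ : (v j).degree ≤ d := degree_le_of_natDegree_le (h.natDegree_le j)
  refine (add_le_add h₁ h₂).trans_lt ?_
  exact_mod_cast (by omega : e + d < d + e + 1)

/-- An operator on `R[X]ʳ` of the form `p + φ` with `p` monic and `φ` of degree `< deg p` makes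
`R[X]ʳ` a finite free module over `R[Y]`. -/
theorem free_finite_aeval {S : Module.End R (Fin r → R[X])} {p : R[X]} (hp : p.Monic)
    (hm0 : p.natDegree ≠ 0) {φ : (Fin r → R[X]) → (Fin r → R[X])} (hS : ∀ v, S v = p • v + φ v)
    (hφ : ∀ v d, DegLT v (d + 1) → DegLT (φ v) (d + p.natDegree)) :
    Module.Free R[X] (Module.AEval' S) ∧ Module.Finite R[X] (Module.AEval' S) := by
  classical
  set m := p.natDegree with hm
  -- The operator raises degrees by `m` and preserves the coefficients in top degree, as
  -- multiplication by the monic `p` does. Division with remainder therefore works for `S`, and the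
  -- monomials of degree `< m` form a basis.
  have hcoeff (v : Fin r → R[X]) (d : ℕ) (hv : DegLT v (d + 1)) (j) :
      (S v j).coeff (d + m) = (v j).coeff d := by
    rw [hS]
    have h₁ : (φ v j).coeff (d + m) = 0 := (hφ v d hv).coeff_eq_zero le_rfl j
    have h₂ : (v j).natDegree ≤ d := hv.natDegree_le j
    simp only [Pi.add_apply, Pi.smul_apply, smul_eq_mul, coeff_add, h₁, add_zero]
    rw [add_comm, coeff_mul_add_eq_of_natDegree_le hm.ge h₂, hm, hp.coeff_natDegree, one_mul]
  have hdeg (v : Fin r → R[X]) (d : ℕ) (hv : DegLT v (d + 1)) : DegLT (S v) (d + m + 1) := by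
    rw [hS]
    intro j
    exact (degree_add_le _ _).trans_lt (max_lt (hv.smul hm.ge j)
      (((hφ v d hv).mono (Nat.le_succ _)) j))
  have hinj (v : Fin r → R[X]) (hv : DegLT (S v) m) : v = 0 := by
    obtain ⟨d, hd⟩ := exists_degLT v
    induction d with
    | zero => exact funext fun j => by simpa using! hd j
    | succ d ih =>
      refine ih (degLT_iff.mpr fun j e hde => ?_)
      rcases hde.eq_or_lt with rfl | hlt
      · rw [← hcoeff v d hd j]
        exact hv.coeff_eq_zero (Nat.le_add_left _ _) j
      · exact hd.coeff_eq_zero hlt j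
  let low (c : Fin r × Fin m → R) : Fin r → R[X] := fun j => ∑ a : Fin m, monomial a (c (j, a))
  have hlow (c) : DegLT (low c) m := fun j => by
    refine (degree_sum_le _ _).trans_lt ((Finset.sup_lt_iff (by simp)).mpr fun a _ => ?_)
    exact (degree_monomial_le _ _).trans_lt (by exact_mod_cast a.2)
  have hlowc (c) (j) (a : Fin m) : (low c j).coeff a = c (j, a) := by
    simp [low, coeff_monomial, Fin.val_inj]
  let b : Fin r × Fin m → Module.AEval' S := fun x =>
    Module.AEval'.of S (Pi.single x.1 (monomial x.2 1))
  have hb (c : Fin r × Fin m → R) : ∑ x, C (c x) • b x = Module.AEval'.of S (low c) := by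
    simp only [b, Module.AEval.C_smul, ← map_smul, ← map_sum]
    congr 1
    ext1 j
    simp [low, Fintype.sum_prod_type, Pi.single_apply, smul_monomial]
  have hli : LinearIndependent R[X] b := by
    rw [Fintype.linearIndependent_iff]
    intro c hc
    suffices ∀ n (c : Fin r × Fin m → R[X]), (∀ x e, n ≤ e → (c x).coeff e = 0) →
        ∑ x, c x • b x = 0 → c = 0 by
      refine fun x => congrFun (this ((∑ x, (c x).natDegree) + 1) c (fun x e he => ?_) hc) x
      refine coeff_eq_zero_of_natDegree_lt (lt_of_lt_of_le (Nat.lt_succ_of_le ?_) he)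
      exact Finset.single_le_sum (f := fun x => (c x).natDegree) (fun _ _ => Nat.zero_le _)
        (Finset.mem_univ x)
    intro n
    induction n with
    | zero =>
      intro c hc _
      exact funext fun x => Polynomial.ext fun e => hc x e (Nat.zero_le _)
    | succ n ih =>
      intro c hc hsum
      have hdec (x : Fin r × Fin m) : c x • b x = (X : R[X]) • ((c x).divX • b x) + C ((c x).coeff 0) • b x := by
        conv_lhs => rw [← divX_mul_X_add (c x)]
        rw [add_smul, mul_comm, mul_smul]
      obtain ⟨u, hu⟩ := (Module.AEval'.of S).surjective (∑ x, (c x).divX • b x)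
      let c₀ : Fin r × Fin m → R := fun x => (c x).coeff 0
      have hsum' : Module.AEval'.of S (S u + low c₀) = 0 := by
        rw [map_add, ← hb c₀, ← Module.AEval'.X_smul_of, hu, Finset.smul_sum,
          ← Finset.sum_add_distrib, ← hsum]
        exact Finset.sum_congr rfl fun x _ => (hdec x).symm
      replace hsum : S u + low c₀ = 0 := (LinearEquiv.map_eq_zero_iff _).mp hsum'
      have hu0 : u = 0 := hinj u (by
        rw [eq_neg_of_add_eq_zero_left hsum]
        intro j
        rw [Pi.neg_apply, degree_neg]
        exact hlow c₀ j)
      rw [hu0, map_zero, zero_add] at hsum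
      rw [hu0, map_zero] at hu
      have hdiv : (fun x => (c x).divX) = 0 := ih _ (fun x e he => by
        rw [coeff_divX]
        exact hc x _ (Nat.succ_le_succ he)) hu.symm
      funext x
      have h₀ : c₀ x = 0 := by
        rw [← hlowc c₀ x.1 x.2, hsum]
        exact coeff_zero _
      have h₁ : (c x).divX = 0 := congrFun hdiv x
      rw [Pi.zero_apply, ← divX_mul_X_add (c x), h₁, zero_mul, zero_add]
      exact (congrArg C h₀).trans C_0
  have hspan : ⊤ ≤ Submodule.span R[X] (Set.range b) := by
    suffices ∀ d (v : Fin r → R[X]), DegLT v d →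
        Module.AEval'.of S v ∈ Submodule.span R[X] (Set.range b) by
      rintro x -
      obtain ⟨v, rfl⟩ := (Module.AEval'.of S).surjective x
      obtain ⟨d, hd⟩ := exists_degLT v
      exact this d v hd
    intro d
    induction d using Nat.strong_induction_on with
    | _ d ih =>
    intro v hv
    by_cases hdm : d ≤ m
    · let c : Fin r × Fin m → R := fun x => (v x.1).coeff x.2
      have hv' : v = low c := by
        ext j e
        by_cases he : e < m
        · exact (hlowc c j ⟨e, he⟩).symm
        · rw [hv.coeff_eq_zero (by omega), (hlow c).coeff_eq_zero (by omega)]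
      rw [hv', ← hb]
      exact Submodule.sum_mem _ fun x _ =>
        Submodule.smul_mem _ _ (Submodule.subset_span (Set.mem_range_self _))
    -- Division step: subtracting `S w` removes the coefficients of degree `e + m`. Here `w` has
    -- degree `e`, smaller than that of `v` because `m ≠ 0`.
    · obtain ⟨e, rfl⟩ : ∃ e, d = e + m + 1 := ⟨d - m - 1, by omega⟩
      let w : Fin r → R[X] := fun j => monomial e ((v j).coeff (e + m))
      have hw : DegLT w (e + 1) := fun j =>
        (degree_monomial_le _ _).trans_lt (by exact_mod_cast Nat.lt_succ_self e)
      have hlt : DegLT (v - S w) (e + m) := degLT_iff.mpr fun j a ha => by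
        rw [Pi.sub_apply, coeff_sub]
        rcases ha.eq_or_lt with rfl | ha
        · rw [hcoeff w e hw]
          simp [w]
        · rw [hv.coeff_eq_zero ha, (hdeg w e hw).coeff_eq_zero ha, sub_zero]
      have h₁ := ih (e + m) (by omega) _ hlt
      have h₂ := Submodule.smul_mem _ (X : R[X]) (ih (e + 1) (by omega) _ hw)
      rw [Module.AEval'.X_smul_of] at h₂
      simpa using add_mem h₁ h₂
  let basis := Module.Basis.mk hli hspan
  exact ⟨.of_basis basis, .of_basis basis⟩

/-- The maps `i` and `π` intertwine multiplication by `s` with `S`, so `A`, with `X` acting by `s`,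
is a direct summand of `Module.AEval' S` over `R[X]`. Finiteness and flatness pass to summands. -/
lemma finite_flat_of_retract {A N : Type*} [CommRing A] [Algebra R A] [AddCommGroup N] [Module R N]
    {S : Module.End R N} {s : A} (i : A →ₗ[R] N) (π : N →ₗ[R] A) (hπi : ∀ a, π (i a) = a)
    (hi : ∀ a, i (s * a) = S (i a)) (hπ : ∀ n, π (S n) = s * π n)
    [Module.Flat R[X] (Module.AEval' S)] [Module.Finite R[X] (Module.AEval' S)] :
    (aeval s : R[X] →ₐ[R] A).toRingHom.Finite ∧ (aeval s : R[X] →ₐ[R] A).toRingHom.Flat := by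
  let : Algebra R[X] A := (aeval s : R[X] →ₐ[R] A).toRingHom.toAlgebra
  have hsmul (p : R[X]) (a : A) : p • a = aeval s p * a := rfl
  have hi' (p : R[X]) (a : A) : i (p • a) = aeval S p (i a) := by
    rw [hsmul]
    induction p using Polynomial.induction_on' with
    | add p q hp hq => rw [map_add, add_mul, map_add, hp, hq, map_add, LinearMap.add_apply]
    | monomial n c =>
      rw [aeval_monomial, aeval_monomial, mul_assoc, ← Algebra.smul_def, map_smul,
        Module.End.mul_apply, Module.algebraMap_end_apply]
      congr 1
      induction n with
      | zero => simp
      | succ n ih => rw [pow_succ', mul_assoc, hi, ih, pow_succ', Module.End.mul_apply]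
  have hπ' (p : R[X]) (n : N) : π (aeval S p n) = p • π n := by
    rw [hsmul]
    induction p using Polynomial.induction_on' with
    | add p q hp hq => rw [map_add, LinearMap.add_apply, map_add, hp, hq, map_add, add_mul]
    | monomial m c =>
      rw [aeval_monomial, aeval_monomial, mul_assoc, ← Algebra.smul_def (A := A),
        Module.End.mul_apply, Module.algebraMap_end_apply, map_smul]
      congr 1
      induction m with
      | zero => simp
      | succ m ih => rw [pow_succ' S, Module.End.mul_apply, hπ, ih, pow_succ', mul_assoc]
  let I : A →ₗ[R[X]] Module.AEval' S :=
    { toFun a := Module.AEval'.of S (i a)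
      map_add' a b := by simp
      map_smul' p a := by
        rw [hi', RingHom.id_apply, ← Module.AEval.of_aeval_smul]
        rfl }
  let P : Module.AEval' S →ₗ[R[X]] A :=
    { toFun n := π ((Module.AEval'.of S).symm n)
      map_add' a b := by simp
      map_smul' p n := by
        rw [RingHom.id_apply, ← hπ', Module.AEval.of_symm_smul]
        rfl }
  have hPI : P ∘ₗ I = LinearMap.id := LinearMap.ext fun a => by simp [P, I, hπi]
  exact ⟨Module.Finite.of_surjective P fun a => ⟨I a, LinearMap.congr_fun hPI a⟩,
    Module.Flat.of_retract I P hPI⟩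

/-- If `A` is finite flat over `R[X]` by means of `t`, it is so by means of `p(t) + s` for all
monic `p` of large degree. -/
theorem exists_finite_flat_aeval_add [IsNoetherianRing R] {A : Type*} [CommRing A] [Algebra R A]
    (t s : A) (hfin : (aeval t : R[X] →ₐ[R] A).toRingHom.Finite)
    (hflat : (aeval t : R[X] →ₐ[R] A).toRingHom.Flat) :
    ∃ D : ℕ, ∀ p : R[X], p.Monic → D < p.natDegree →
      (aeval (aeval t p + s) : R[X] →ₐ[R] A).toRingHom.Finite ∧
      (aeval (aeval t p + s) : R[X] →ₐ[R] A).toRingHom.Flat := by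
  let : Algebra R[X] A := (aeval t : R[X] →ₐ[R] A).toRingHom.toAlgebra
  have : IsScalarTower R R[X] A := .of_algebraMap_eq' (aeval t : R[X] →ₐ[R] A).comp_algebraMap.symm
  have : Module.Finite R[X] A := hfin
  have : Module.Flat R[X] A := hflat
  have : Module.FinitePresentation R[X] A := Module.finitePresentation_of_finite _ _
  have : Module.Projective R[X] A :=
    Module.Flat.projective_of_finitePresentation
  obtain ⟨r, π, i, -, -, hπi⟩ := Module.Finite.exists_comp_eq_id_of_projective R[X] A
  -- `A` is a summand of a free module, and multiplication by `s` extends to an `R[X]`-linear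
  -- operator there. Its matrix has entries of bounded degree, which gives `D`.
  let φ : (Fin r → R[X]) →ₗ[R[X]] (Fin r → R[X]) := i ∘ₗ LinearMap.mulLeft R[X] s ∘ₗ π
  obtain ⟨D, hD⟩ : ∃ D, ∀ j l, (φ (Pi.single j 1) l).natDegree ≤ D := by
    refine ⟨∑ j, ∑ l, (φ (Pi.single j 1) l).natDegree, fun j l => ?_⟩
    exact (Finset.single_le_sum (f := fun l => (φ (Pi.single j 1) l).natDegree)
      (fun _ _ => Nat.zero_le _) (Finset.mem_univ l)).trans
      (Finset.single_le_sum (f := fun j => ∑ l, (φ (Pi.single j 1) l).natDegree)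
        (fun _ _ => Nat.zero_le _) (Finset.mem_univ j))
  refine ⟨D, fun p hp hpD => ?_⟩
  have hφ (v : Fin r → R[X]) (d : ℕ) (hv : DegLT v (d + 1)) : DegLT (φ v) (d + p.natDegree) := by
    have hexp : φ v = ∑ j, v j • φ (Pi.single j 1) := by
      conv_lhs => rw [pi_eq_sum_univ' v]
      simp only [map_sum, map_smul]
    intro l
    rw [hexp, Finset.sum_apply]
    refine (degree_sum_le _ _).trans_lt ((Finset.sup_lt_iff (by simp)).mpr fun j _ => ?_)
    refine (degree_mul_le _ _).trans_lt ?_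
    refine (add_le_add (degree_le_of_natDegree_le (hv.natDegree_le j))
      (degree_le_of_natDegree_le (hD j l))).trans_lt ?_
    exact_mod_cast (by omega : d + D < d + p.natDegree)
  let S : Module.End R (Fin r → R[X]) :=
    ((LinearMap.lsmul R[X] (Fin r → R[X]) p) + φ).restrictScalars R
  obtain ⟨_, _⟩ := free_finite_aeval (S := S) hp (by omega) (fun v => rfl) hφ
  have hpt : aeval t p = algebraMap R[X] A p := rfl
  refine finite_flat_of_retract (S := S) (i.restrictScalars R) (π.restrictScalars R)
    (fun a => LinearMap.congr_fun hπi a) (fun a => ?_) fun n => ?_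
  · have : π (i a) = a := LinearMap.congr_fun hπi a
    simp only [S, φ, LinearMap.restrictScalars_apply, LinearMap.add_apply, LinearMap.lsmul_apply,
      LinearMap.comp_apply, LinearMap.mulLeft_apply, this]
    rw [hpt, add_mul, ← Algebra.smul_def, map_add, map_smul]
  · have (b : A) : π (i b) = b := LinearMap.congr_fun hπi b
    simp only [S, φ, LinearMap.restrictScalars_apply, LinearMap.add_apply, LinearMap.lsmul_apply,
      LinearMap.comp_apply, LinearMap.mulLeft_apply, map_add, this, map_smul]
    rw [hpt, add_mul, ← Algebra.smul_def]

end MonicOperators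

/-! ### The rectified coordinate. -/

section AdjustCoordinate

open Polynomial

/-- Since `t` satisfies a monic equation modulo `J`, the ring `A/J` is finite over the semi-local
ring `R`, hence has finitely many maximal ideals. -/
lemma finite_setOf_isMaximal_of_monic {R A : Type*} [CommRing R]
    (hmax : {m : Ideal R | m.IsMaximal}.Finite) [CommRing A] [Algebra R A] {t : A}
    (hfin : (aeval t : R[X] →ₐ[R] A).toRingHom.Finite) {J : Ideal A} {h : R[X]} (hh : h.Monic)
    (hJ : aeval t h ∈ J) : {n : Ideal A | n.IsMaximal ∧ J ≤ n}.Finite := by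
  have h₀ : eval₂ (algebraMap R (A ⧸ J)) (Ideal.Quotient.mk J t) h = 0 := by
    rw [← Ideal.Quotient.eq_zero_iff_mem] at hJ
    rw [← hJ]
    exact aeval_algHom_apply (Ideal.Quotient.mkₐ R J) t h
  have h₁ : Module.Finite R (AdjoinRoot h) := hh.finite_adjoinRoot
  let φ : AdjoinRoot h →+* A ⧸ J := AdjoinRoot.lift (algebraMap R (A ⧸ J)) (Ideal.Quotient.mk J t) h₀
  have h₂ : φ.Finite := by
    have := (RingHom.Finite.of_surjective _ (Ideal.Quotient.mk_surjective (I := J))).comp hfin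
    refine RingHom.Finite.of_comp_finite (f := AdjoinRoot.mk h) ?_
    convert this
    refine Polynomial.ringHom_ext (fun a => ?_) ?_
    · simp [φ]
    · simp [φ]
  have h₃ : Module.Finite R (A ⧸ J) := by
    have h₄ := h₂.comp (RingHom.finite_algebraMap.mpr h₁)
    rw [← RingHom.finite_algebraMap]
    convert h₄
    exact RingHom.ext fun a => (AdjoinRoot.lift_of h₀).symm
  have hfin' : {P : PrimeSpectrum R | P.asIdeal.IsMaximal}.Finite :=
    Set.Finite.of_injOn (f := PrimeSpectrum.asIdeal) (fun P hP => hP)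
      (fun P _ Q _ h => PrimeSpectrum.ext h) hmax
  have h₅ := Algebra.QuasiFinite.finite_comap_preimage (R := R) (S := A ⧸ J) hfin'
  refine (h₅.image fun P => P.asIdeal.comap (Ideal.Quotient.mk J)).subset ?_
  rintro n ⟨hn, hJn⟩
  have hc : (n.map (Ideal.Quotient.mk J)).comap (Ideal.Quotient.mk J) = n := by
    rw [Ideal.comap_map_of_surjective _ Ideal.Quotient.mk_surjective, ← RingHom.ker_eq_comap_bot,
      Ideal.mk_ker, sup_eq_left]
    exact hJn
  have hm : (n.map (Ideal.Quotient.mk J)).IsMaximal :=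
    (Ideal.map_eq_top_or_isMaximal_of_surjective _ Ideal.Quotient.mk_surjective hn).resolve_left
      fun h => hn.ne_top (by rw [← hc, h, Ideal.comap_top])
  exact ⟨⟨_, hm.isPrime⟩, Ideal.isMaximal_comap_of_isIntegral_of_isMaximal _, hc⟩

/-- The rectified coordinate vanishes to first order along the section `σ`, and
on `V(J)` its values `0` and `1` are taken only on the section, resp. nowhere. -/
theorem exists_rectified_coordinate {k R A : Type*} [Field k] [Infinite k] [CommRing R]
    [Nontrivial R] [IsNoetherianRing R] [Algebra k R] (hmax : {m : Ideal R | m.IsMaximal}.Finite)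
    [CommRing A] [Algebra R A] (t : A)
    (hfin : (aeval t : R[X] →ₐ[R] A).toRingHom.Finite)
    (hflat : (aeval t : R[X] →ₐ[R] A).toRingHom.Flat) (σ : A →ₐ[R] R)
    (hσ : RingHom.ker σ ≤ Ideal.span {t - algebraMap R A (σ t)} ⊔ RingHom.ker σ ^ 2)
    (J : Ideal A) {h : R[X]} (hh : h.Monic) (hJ : aeval t h ∈ J) :
    ∃ s ∈ RingHom.ker σ, (aeval s : R[X] →ₐ[R] A).toRingHom.Finite ∧
      (aeval s : R[X] →ₐ[R] A).toRingHom.Flat ∧ Ideal.span {s - 1} ⊔ J = ⊤ ∧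
      ∃ I' : Ideal A, RingHom.ker σ ⊓ I' = Ideal.span {s} ∧ RingHom.ker σ ⊔ I' = ⊤ ∧
        I' ⊔ J = ⊤ := by
  classical
  set I := RingHom.ker σ with hI
  have hA : IsNoetherianRing A := by
    let := (aeval t : R[X] →ₐ[R] A).toRingHom.toAlgebra
    have : Module.Finite R[X] A := hfin
    exact IsNoetherianRing.of_finite R[X] A
  have hker (a : A) : a - algebraMap R A (σ a) ∈ I := by simp [hI, RingHom.mem_ker]
  have hfinJ := finite_setOf_isMaximal_of_monic hmax hfin hh hJ
  -- An approximate idempotent: it is `1` to first order along the section and `0` at the closed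
  -- points of `V(J)` off the section. These points are finite in number, so the Chinese remainder
  -- theorem applies.
  obtain ⟨e, he, heL⟩ : ∃ e : A, e - 1 ∈ I ^ 2 ∧
      ∀ n : Ideal A, n.IsMaximal → J ≤ n → ¬ I ≤ n → e ∈ n := by
    set T : Finset (Ideal A) := hfinJ.toFinset.filter fun n => ¬ I ≤ n with hT
    have hcop : I ^ 2 ⊔ T.inf id = ⊤ := by
      by_contra hne
      obtain ⟨m, hm, hle⟩ := Ideal.exists_le_maximal _ hne
      obtain ⟨n, hnT, hn⟩ := (Ideal.IsPrime.inf_le' hm.isPrime).mp (le_sup_right.trans hle)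
      simp only [hT, Finset.mem_filter, Set.Finite.mem_toFinset, Set.mem_ofPred_eq] at hnT
      have hmn : n = m := hnT.1.1.eq_of_le hm.ne_top hn
      exact hnT.2 (hmn ▸ hm.isPrime.le_of_pow_le (le_sup_left.trans hle))
    obtain ⟨a, ha, b, hb, hab⟩ := Submodule.mem_sup.mp (hcop ▸ Submodule.mem_top : (1 : A) ∈ _)
    refine ⟨b, ?_, fun n h₁ h₂ h₃ => ?_⟩
    · rw [← hab]
      simpa using ha
    · exact (Finset.inf_le (f := id) (by simp [hT, h₁, h₂, h₃]) : T.inf id ≤ n) hb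
  -- The value `c` will be taken at the closed points of `V(J)` off the section, so it must differ
  -- from `0` and `1`.
  obtain ⟨c, hc⟩ := Set.Infinite.nonempty (s := ({0, 1} : Set k)ᶜ)
    (Set.Finite.infinite_compl (by simp))
  simp only [Set.mem_compl_iff, Set.mem_insert_iff, Set.mem_singleton_iff, not_or] at hc
  let ck : A := algebraMap R A (algebraMap k R c)
  have hcu : IsUnit ck := (((isUnit_iff_ne_zero.mpr hc.1).map (algebraMap k R)).map (algebraMap R A))
  have hcu1 : IsUnit (ck - 1) := by
    have := ((isUnit_iff_ne_zero.mpr (sub_ne_zero.mpr hc.2)).map (algebraMap k R)).map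
      (algebraMap R A)
    simpa [ck] using this
  let s₁ : A := (t - algebraMap R A (σ t)) * e + ck * (1 - e)
  obtain ⟨D, hD⟩ := exists_finite_flat_aeval_add t s₁ hfin hflat
  -- The monic correction `p(t)` needed for finite flatness must not disturb `s₁`. The factor `h`
  -- makes it vanish on `V(J)`, and the square makes it vanish to second order along the section.
  let h₁ : R[X] := h * (X - C (σ t)) ^ 2
  have hh₁ : h₁.Monic := hh.mul ((monic_X_sub_C _).pow 2)
  have hh₁J : aeval t h₁ ∈ J := by
    rw [map_mul]
    exact J.mul_mem_right _ hJ
  have hh₁I : aeval t h₁ ∈ I ^ 2 := by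
    rw [map_mul, map_pow]
    exact Ideal.mul_mem_left _ _ (Ideal.pow_mem_pow (by simpa using hker t) 2)
  let p : R[X] := h₁ ^ (D + 1)
  have hp : p.Monic := hh₁.pow _
  have hpJ : aeval t p ∈ J := by
    rw [map_pow]
    exact J.pow_mem_of_mem hh₁J _ (Nat.succ_pos _)
  have hpI : aeval t p ∈ I ^ 2 := by
    rw [map_pow]
    exact (I ^ 2).pow_mem_of_mem hh₁I _ (Nat.succ_pos _)
  have hpD : D < p.natDegree := by
    rw [hh₁.natDegree_pow, hh.natDegree_mul ((monic_X_sub_C _).pow 2),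
      (monic_X_sub_C _).natDegree_pow, natDegree_X_sub_C]
    nlinarith [Nat.zero_le (D * h.natDegree), Nat.zero_le h.natDegree]
  set s : A := aeval t p + s₁ with hs
  have hsq : I ^ 2 ≤ I := Ideal.pow_le_self two_ne_zero
  have hst : s - (t - algebraMap R A (σ t)) ∈ I ^ 2 := by
    have e₁ : s - (t - algebraMap R A (σ t)) =
        aeval t p + (t - algebraMap R A (σ t) - ck) * (e - 1) := by
      simp only [hs, s₁]
      ring
    rw [e₁]
    exact add_mem hpI (Ideal.mul_mem_left _ _ he)
  have hsI : s ∈ I := by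
    rw [← sub_add_cancel s (t - algebraMap R A (σ t))]
    exact add_mem (hsq hst) (hker t)
  have hle : I ≤ Ideal.span {s} ⊔ I • I := by
    rw [smul_eq_mul, ← pow_two]
    refine hσ.trans (sup_le (Ideal.span_le.mpr (Set.singleton_subset_iff.mpr ?_)) le_sup_right)
    rw [SetLike.mem_coe, ← sub_sub_cancel s (t - algebraMap R A (σ t))]
    exact Ideal.sub_mem _ (Ideal.mem_sup_left (Ideal.mem_span_singleton_self s))
      (Ideal.mem_sup_right hst)
  -- Since `I = (s) + I²`, Nakayama makes `I` and `(s)` agree where `r` is invertible, a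
  -- neighbourhood of the section. The rest of the fibre `s = 0` is cut out by `(s, r)`.
  obtain ⟨r, hr, hrI⟩ := Submodule.exists_sub_one_mem_and_smul_le_of_fg_of_le_sup
    (IsNoetherian.noetherian I) le_rfl hle
  have hrI' {x : A} (hx : x ∈ I) : r * x ∈ Ideal.span {s} :=
    hrI (Submodule.smul_mem_pointwise_smul _ r _ hx)
  have key (n : Ideal A) (hn : n.IsMaximal) (hJn : J ≤ n) : s - 1 ∉ n ∧ (s ∉ n ∨ r ∉ n) := by
    have h1 : (1 : A) ∉ n := fun h => hn.ne_top ((Ideal.eq_top_iff_one n).mpr h)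
    by_cases hIn : I ≤ n
    · refine ⟨fun h => h1 ?_, .inr fun h => h1 ?_⟩
      · simpa using sub_mem (hIn hsI) h
      · simpa using sub_mem h (hIn hr)
    · have hen := heL n hn hJn hIn
      have hsc : s - ck ∈ n := by
        have e₁ : s - ck = aeval t p + (t - algebraMap R A (σ t) - ck) * e := by
          simp only [hs, s₁]
          ring
        rw [e₁]
        exact add_mem (hJn hpJ) (Ideal.mul_mem_left _ _ hen)
      refine ⟨fun h => hn.ne_top (Ideal.eq_top_of_isUnit_mem _ ?_ hcu1),
        .inl fun h => hn.ne_top (Ideal.eq_top_of_isUnit_mem _ ?_ hcu)⟩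
      · simpa using sub_mem h hsc
      · simpa using sub_mem h hsc
  obtain ⟨hf₁, hf₂⟩ := hD p hp hpD
  refine ⟨s, hsI, hf₁, hf₂, ?_, Ideal.span {s, r}, ?_, ?_, ?_⟩
  · by_contra hne
    obtain ⟨n, hn, hle⟩ := Ideal.exists_le_maximal _ hne
    exact (key n hn (le_sup_right.trans hle)).1
      (hle (Ideal.mem_sup_left (Ideal.mem_span_singleton_self _)))
  · refine le_antisymm (fun x hx => ?_) (Ideal.span_le.mpr (Set.singleton_subset_iff.mpr
      ⟨hsI, Ideal.subset_span (by simp)⟩))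
    obtain ⟨a, b, hab⟩ := Ideal.mem_span_pair.mp hx.2
    have e₁ : x = r * x - (a * (r - 1)) * s - b * (r * (r - 1)) := by
      rw [← hab]
      ring
    rw [e₁]
    exact sub_mem (sub_mem (hrI' hx.1) (Ideal.mul_mem_left _ _ (Ideal.mem_span_singleton_self s)))
      (Ideal.mul_mem_left _ _ (hrI' hr))
  · refine (Ideal.eq_top_iff_one _).mpr ?_
    rw [← sub_sub_cancel r 1]
    exact sub_mem (Ideal.mem_sup_right (Ideal.subset_span (by simp))) (Ideal.mem_sup_left hr)
  · by_contra hne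
    obtain ⟨n, hn, hle⟩ := Ideal.exists_le_maximal _ hne
    have hsr := le_sup_left.trans hle
    exact (key n hn (le_sup_right.trans hle)).2.elim (fun h => h (hsr (Ideal.subset_span (by simp))))
      fun h => h (hsr (Ideal.subset_span (by simp)))

end AdjustCoordinate

end EffacementTheorem

namespace EffacementTheorem

/-! ### Heights and the loss of one in codimension. -/

section Heights

open Polynomial

-- After localizing at `p = P ∩ R`, enlarge `P` to a maximal ideal. It still lies over the maximal
-- ideal of the localization, and for such an ideal the height is known to be exactly one more.
attribute [local instance] Polynomial.algebra Polynomial.isLocalization in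
lemma height_le_height_under_add_one {R : Type*} [CommRing R] [IsNoetherianRing R] (P : Ideal R[X])
    [hP : P.IsPrime] : P.height ≤ (P.under R).height + 1 := by
  set p := P.under R with hp
  have : P.LiesOver p := ⟨rfl⟩
  let Rₚ := Localization.AtPrime p
  set p' : Ideal Rₚ := p.map (algebraMap R Rₚ) with p'_def
  have : p'.IsMaximal := by
    rw [p'_def, Localization.AtPrime.map_eq_maximalIdeal]
    infer_instance
  set P' : Ideal Rₚ[X] := P.map (algebraMap R[X] Rₚ[X]) with P'_def
  have disj : Disjoint (p.primeCompl.map C : Set R[X]) P := by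
    refine Set.disjoint_left.mpr fun a ⟨b, hb⟩ ha ↦ hb.1 ?_
    rwa [SetLike.mem_coe, Ideal.LiesOver.over (P := P) (p := p), Ideal.mem_comap, algebraMap_eq,
      hb.2]
  have hP' : P'.IsPrime := IsLocalization.isPrime_of_isPrime_disjoint (p.primeCompl.map C) _ _ hP disj
  have : P'.LiesOver p' := IsLocalization.liesOver_of_isPrime_of_disjoint p.primeCompl _ _ disj
  obtain ⟨M, hM, hle⟩ := Ideal.exists_le_maximal P' hP'.ne_top
  have : M.LiesOver p' := ⟨Ideal.IsMaximal.eq_of_le ‹_› (Ideal.IsPrime.under _ M).ne_top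
    (by rw [Ideal.LiesOver.over (P := P') (p := p')]; exact Ideal.comap_mono hle)⟩
  have eq1 : p.height = p'.height := by
    rw [IsLocalization.height_map_of_disjoint p.primeCompl]
    exact Disjoint.symm <| Set.disjoint_left.mpr fun _ a b ↦ b a
  have eq2 : P.height = P'.height := by
    rw [IsLocalization.height_map_of_disjoint (Submonoid.map C <| p.primeCompl) _ disj]
  rw [eq1, eq2, ← Polynomial.height_eq_height_add_one p' M]
  exact Ideal.height_mono hle

/-- The height of `P` is at most that of `P ∩ R` plus that of `P` in the fibre ring, and the latter
is zero because integrality leaves no inclusions between primes of a fibre. -/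
lemma height_le_height_under_of_isIntegral {R S : Type*} [CommRing R] [CommRing S] [Algebra R S]
    [Algebra.IsIntegral R S] [IsNoetherianRing R] [IsNoetherianRing S] (P : Ideal S)
    [hP : P.IsPrime] : P.height ≤ (P.under R).height := by
  set p := P.under R with hp
  have : P.LiesOver p := ⟨rfl⟩
  have h := Ideal.height_le_height_add_of_liesOver p P
  have hm := Ideal.IsIntegral.mem_minimalPrimes_map_under (R := R) P
  set mk := Ideal.Quotient.mk (p.map (algebraMap R S))
  have hc : (P.map mk).comap mk = P := by
    rw [Ideal.comap_map_of_surjective _ Ideal.Quotient.mk_surjective, ← RingHom.ker_eq_comap_bot,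
      Ideal.mk_ker, sup_eq_left]
    exact hm.1.2
  have hP' : (P.map mk).IsPrime := Ideal.map_isPrime_of_surjective Ideal.Quotient.mk_surjective
    (Ideal.mk_ker.trans_le hm.1.2)
  have h₀ : (P.map mk).height = 0 := by
    rw [Ideal.height_eq_zero_iff]
    refine ⟨⟨hP', bot_le⟩, fun N hN hle => ?_⟩
    rw [Ideal.map_le_iff_le_comap]
    refine hm.2 ⟨hN.1.comap mk, ?_⟩ (hc ▸ Ideal.comap_mono hle)
    exact Ideal.mk_ker.ge.trans (Ideal.ker_le_comap mk)
  rwa [h₀, add_zero] at h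

lemma height_under_le_of_flat {R S : Type*} [CommRing R] [CommRing S] [Algebra R S]
    [Module.Flat R S] [IsNoetherianRing R] [IsNoetherianRing S] (P : Ideal S)
    [hP : P.IsPrime] : (P.under R).height ≤ P.height := by
  have : P.LiesOver (P.under R) := ⟨rfl⟩
  rw [Ideal.height_eq_height_add_of_liesOver_of_hasGoingDown (P.under R) P]
  exact le_self_add

/-- If `B` is finite over `Q[X]` and `B ⧸ I` is finite over `Q`, every prime ideal containing
`I ∩ Q` in a flat `Q`-algebra has at least the height, minus one, of some prime containing `I`. -/
lemma exists_height_le_height_add_one {Q B R : Type*} [CommRing Q] [CommRing B] [CommRing R]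
    [Algebra Q B] [Algebra Q R] [Module.Flat Q R] [IsNoetherianRing Q] [IsNoetherianRing R] (z : B)
    (hz : (aeval z : Q[X] →ₐ[Q] B).toRingHom.Finite) (I : Ideal B) [Module.Finite Q (B ⧸ I)]
    (p : Ideal R) [p.IsPrime] (hp : (I.under Q).map (algebraMap Q R) ≤ p) :
    ∃ q : Ideal B, q.IsPrime ∧ I ≤ q ∧ q.height ≤ p.height + 1 := by
  let : Algebra Q[X] B := (aeval z : Q[X] →ₐ[Q] B).toRingHom.toAlgebra
  have : IsScalarTower Q Q[X] B := .of_algebraMap_eq' (aeval z : Q[X] →ₐ[Q] B).comp_algebraMap.symm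
  have : Module.Finite Q[X] B := hz
  have : IsNoetherianRing B := IsNoetherianRing.of_finite Q[X] B
  obtain ⟨q', -, hq', hq⟩ := Ideal.exists_ideal_over_prime_of_isIntegral (S := B ⧸ I) (p.under Q)
    ⊥ (by
      refine le_trans (fun a ha => ?_) (Ideal.map_le_iff_le_comap.mp hp)
      rw [Ideal.mem_comap, Ideal.mem_bot, IsScalarTower.algebraMap_apply Q B (B ⧸ I)] at ha
      exact (Ideal.Quotient.eq_zero_iff_mem (I := I) (a := algebraMap Q B a)).mp ha)
  let q := q'.comap (Ideal.Quotient.mk I)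
  refine ⟨q, inferInstance, ?_, ?_⟩
  · rw [← Ideal.mk_ker (I := I)]
    exact Ideal.ker_le_comap _
  · have h₁ : (q.under Q[X]).under Q = p.under Q := by
      rw [Ideal.under_under, ← hq]
      rfl
    calc q.height ≤ (q.under Q[X]).height := height_le_height_under_of_isIntegral q
      _ ≤ ((q.under Q[X]).under Q).height + 1 := height_le_height_under_add_one _
      _ ≤ p.height + 1 := by
        rw [h₁]
        gcongr
        exact height_under_le_of_flat p

end Heights

/-! ### First-order behaviour along the section. -/

section Derivations

/-- First-order triviality of the kernel of a retraction `σ : A → R` from that along a set of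
coordinates. -/
theorem ker_le_of_formallyUnramified {k R B A₀ A ι : Type*} [CommRing k] [CommRing R] [CommRing B]
    [CommRing A₀] [CommRing A] [Algebra k R] [Algebra k B] [Algebra k A] [Algebra R A] [Algebra B A]
    [Algebra A₀ A] [IsScalarTower k R A] [IsScalarTower k B A] [Algebra.FormallyUnramified A₀ A]
    (hgen : ∀ a : A₀, algebraMap A₀ A a ∈
      Subring.closure (Set.range (algebraMap R A) ∪ Set.range (algebraMap B A)))
    (σ : A →ₐ[R] R) (𝔧 : Ideal A) (hsq : RingHom.ker σ ^ 2 ≤ 𝔧)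
    (T : ι → B) (hT : ∀ i, algebraMap B A (T i) - algebraMap R A (σ (algebraMap B A (T i))) ∈ 𝔧)
    (hΩ : ∀ m : Ideal R, m.IsMaximal → ∃ g : B, σ (algebraMap B A g) ∉ m ∧ ∀ ω : Ω[B⁄k],
      g • ω ∈ Submodule.span B (Set.range fun i => KaehlerDifferential.D k B (T i))) :
    RingHom.ker σ ≤ 𝔧 := by
  -- Because the square of the kernel lies in `𝔧`, the map `a ↦ a - σ(a)` is a derivation modulo
  -- `𝔧`, with `A` acting through `σ`. On the kernel of `σ` it is the quotient map, so the claim is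
  -- that `δ = 0`.
  let δ : A → A ⧸ 𝔧 := fun a => Ideal.Quotient.mk 𝔧 (a - algebraMap R A (σ a))
  have hker (a : A) : a - algebraMap R A (σ a) ∈ RingHom.ker σ := by simp [RingHom.mem_ker]
  have hadd (a b) : δ (a + b) = δ a + δ b := by
    simp only [δ, ← map_add]
    congr 1
    simp only [map_add]
    ring
  have hmul (a b) : δ (a * b) = a • δ b + b • δ a := by
    simp only [δ]
    rw [← Ideal.Quotient.mk_eq_mk, ← Ideal.Quotient.mk_eq_mk, ← Ideal.Quotient.mk_eq_mk,
      ← Submodule.Quotient.mk_smul, ← Submodule.Quotient.mk_smul, ← Submodule.Quotient.mk_add,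
      Submodule.Quotient.eq]
    have := neg_mem (hsq (pow_two (RingHom.ker σ) ▸ Ideal.mul_mem_mul (hker a) (hker b)))
    convert this using 1
    simp only [map_mul, smul_eq_mul]
    ring
  have hR (r : R) : δ (algebraMap R A r) = 0 := by simp [δ]
  have hann (a : A) (b : A) : a • δ b = σ a • δ b := by
    rw [← sub_eq_zero, ← algebraMap_smul A (σ a) (δ b), ← sub_smul]
    simp only [δ]
    rw [← Ideal.Quotient.mk_eq_mk, ← Submodule.Quotient.mk_smul, Submodule.Quotient.mk_eq_zero]
    exact hsq (pow_two (RingHom.ker σ) ▸ Ideal.mul_mem_mul (hker a) (hker b))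
  have hB (b : B) : δ (algebraMap B A b) = 0 := by
    let D : Derivation k B (A ⧸ 𝔧) := Derivation.mk'
      { toFun b := δ (algebraMap B A b)
        map_add' a b := by rw [map_add, hadd]
        map_smul' c b := by
          rw [Algebra.smul_def, map_mul, ← IsScalarTower.algebraMap_apply k B A,
            IsScalarTower.algebraMap_apply k R A, hmul, hR, smul_zero, add_zero, algebraMap_smul,
            algebraMap_smul, RingHom.id_apply] } (fun a b => by
        change δ (algebraMap B A (a * b)) = _
        rw [map_mul, hmul, algebraMap_smul, algebraMap_smul]
        rfl)
    have hDT (i) : D (T i) = 0 := Ideal.Quotient.eq_zero_iff_mem.mpr (hT i)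
    -- `δ` kills the coordinates, hence kills `b` after multiplication by the elements `g` of `hΩ`.
    -- These lie in no common maximal ideal of `R`, so `δ` kills `b` itself.
    let K : Ideal R := LinearMap.ker (LinearMap.toSpanSingleton R (A ⧸ 𝔧) (D b))
    have hK : K = ⊤ := by
      by_contra hne
      obtain ⟨m, hm, hle⟩ := Ideal.exists_le_maximal _ hne
      obtain ⟨g, hgm, hg⟩ := hΩ m hm
      refine hgm (hle ?_)
      have h₁ : D.liftKaehlerDifferential (g • KaehlerDifferential.D k B b) = 0 := by
        have : Submodule.span B (Set.range fun i => KaehlerDifferential.D k B (T i)) ≤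
            LinearMap.ker D.liftKaehlerDifferential := by
          rw [Submodule.span_le]
          rintro _ ⟨i, rfl⟩
          simpa using hDT i
        exact this (hg _)
      rw [map_smul, Derivation.liftKaehlerDifferential_comp_D] at h₁
      rw [LinearMap.mem_ker, LinearMap.toSpanSingleton_apply]
      change _ • δ _ = 0
      rw [← hann, algebraMap_smul]
      exact h₁
    have : (1 : R) ∈ K := hK ▸ Submodule.mem_top
    rw [LinearMap.mem_ker, LinearMap.toSpanSingleton_apply, one_smul] at this
    exact this
  have hA₀ (a : A₀) : δ (algebraMap A₀ A a) = 0 := by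
    refine Subring.closure_induction (p := fun a _ => δ a = 0) ?_ ?_ ?_ ?_ ?_ ?_ (hgen a)
    · rintro _ (⟨r, rfl⟩ | ⟨b, rfl⟩)
      · exact hR r
      · exact hB b
    · simpa using hR 0
    · simpa using hR 1
    · intro a b _ _ ha hb
      rw [hadd, ha, hb, add_zero]
    · intro a _ ha
      have := hadd a (-a)
      rw [ha, zero_add, add_neg_cancel] at this
      rw [← this]
      simpa using hR 0
    · intro a b _ _ ha hb
      rw [hmul, ha, hb, smul_zero, smul_zero, add_zero]
  let D : Derivation A₀ A (A ⧸ 𝔧) := Derivation.mk'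
    { toFun := δ
      map_add' := hadd
      map_smul' c a := by
        rw [Algebra.smul_def, hmul, hA₀, smul_zero, add_zero, algebraMap_smul, RingHom.id_apply] } hmul
  intro a ha
  -- Now `δ` is linear over `A₀`, and an unramified extension has no nonzero derivations.
  have h₀ : D = 0 := by
    rw [← D.liftKaehlerDifferential_comp]
    ext b
    simp [Subsingleton.elim (KaehlerDifferential.D A₀ A b) 0]
  have h₁ : δ a = 0 := congrArg (fun D : Derivation A₀ A (A ⧸ 𝔧) => D a) h₀
  rw [Ideal.Quotient.eq_zero_iff_mem, RingHom.mem_ker.mp ha, map_zero, sub_zero] at h₁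
  exact h₁

end Derivations

end EffacementTheorem

namespace EffacementTheorem

/-! ### The relative curve over the semi-local ring. -/

section Rectification

open Polynomial TensorProduct

attribute [local instance] Algebra.TensorProduct.rightAlgebra in
lemma finite_lTensor {R A B D : Type*} [CommRing R] [CommRing A] [CommRing B] [CommRing D]
    [Algebra R A] [Algebra R B] [Algebra R D] {f : B →ₐ[R] D} (hf : f.Finite) :
    (Algebra.TensorProduct.lTensor (S := A) A f).Finite := by
  algebraize [f.toRingHom, (Algebra.TensorProduct.lTensor (S := A) A f).toRingHom]
  let e : A ⊗[R] D ≃ₐ[A ⊗[R] B] (A ⊗[R] B) ⊗[B] D :=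
    { __ := (Algebra.IsPushout.cancelBaseChangeAlg _ _ _ _ _).symm,
      commutes' x := congr($(Algebra.IsPushout.cancelBaseChange_symm_comp_lTensor R B D A) x) }
  have : Module.Finite B D := hf
  exact Module.Finite.equiv e.symm.toLinearEquiv

/-- The fibre product of an `R`-point of `Spec Q` with `Spec B → Spec Q`. -/
lemma exists_tensorProduct_coordinate {Q B R : Type u} [CommRing Q] [CommRing B] [CommRing R]
    [Algebra Q B] [Algebra Q R] (z : B) (hfin : (aeval z : Q[X] →ₐ[Q] B).toRingHom.Finite)
    (hflat : (aeval z : Q[X] →ₐ[Q] B).toRingHom.Flat) (ρ : B →ₐ[Q] R) :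
    ∃ (A : Type u) (_ : CommRing A) (_ : Algebra R A) (β : B →+* A) (σ : A →ₐ[R] R),
      (∀ q, β (algebraMap Q B q) = algebraMap R A (algebraMap Q R q)) ∧
      (aeval (β z) : R[X] →ₐ[R] A).toRingHom.Finite ∧
      (aeval (β z) : R[X] →ₐ[R] A).toRingHom.Flat ∧ (∀ b, σ (β b) = ρ b) ∧
      Subring.closure (Set.range (algebraMap R A) ∪ Set.range β) = ⊤ := by
  let β : B →ₐ[Q] R ⊗[Q] B := Algebra.TensorProduct.includeRight
  have h : (aeval (β z) : R[X] →ₐ[R] R ⊗[Q] B) =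
      (Algebra.TensorProduct.lTensor (S := R) R (aeval z : Q[X] →ₐ[Q] B)).comp
        (polyEquivTensor' Q R).toAlgHom := by
    refine Polynomial.algHom_ext ?_
    simp [β]
  refine ⟨R ⊗[Q] B, inferInstance, inferInstance, β,
    Algebra.TensorProduct.lift (AlgHom.id R R) ρ fun _ _ => mul_comm _ _, fun q => ?_, ?_, ?_,
    fun b => ?_, ?_⟩
  · exact (β.commutes q).trans (Algebra.TensorProduct.algebraMap_apply q)
  · change (aeval (β z) : R[X] →ₐ[R] R ⊗[Q] B).toRingHom.Finite
    rw [h]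
    exact (finite_lTensor hfin).comp (RingHom.Finite.of_surjective _ (polyEquivTensor' Q R).surjective)
  · change (aeval (β z) : R[X] →ₐ[R] R ⊗[Q] B).toRingHom.Flat
    rw [h]
    exact RingHom.Flat.comp (.of_bijective (polyEquivTensor' Q R).bijective)
      (RingHom.Flat.lTensor _ hflat)
  · exact (Algebra.TensorProduct.lift_tmul _ _ _ _ _).trans (by simp)
  · rw [eq_top_iff]
    rintro x -
    induction x using TensorProduct.induction_on with
    | zero => exact zero_mem _
    | add x y hx hy => exact add_mem hx hy
    | tmul r b =>
      have : r ⊗ₜ[Q] b = algebraMap R (R ⊗[Q] B) r * β b := by simp [β]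
      rw [this]
      exact mul_mem (Subring.subset_closure (.inl ⟨r, rfl⟩)) (Subring.subset_closure (.inr ⟨b, rfl⟩))

/-- The pullback of a finite étale algebra. -/
lemma exists_etale_pullback {T E A₀ R : Type u} [CommRing T] [CommRing E] [CommRing A₀] [CommRing R]
    [Algebra T E] [Algebra.Etale T E] [Module.Finite T E] (φ : T →+* A₀) (σ₀ : A₀ →+* R)
    (η : E →+* R) (h : σ₀.comp φ = η.comp (algebraMap T E)) :
    ∃ (A : Type u) (_ : CommRing A) (_ : Algebra A₀ A) (α : E →+* A) (σ : A →+* R),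
      Module.Finite A₀ A ∧ Module.Flat A₀ A ∧ Algebra.FormallyUnramified A₀ A ∧
      α.comp (algebraMap T E) = (algebraMap A₀ A).comp φ ∧ σ.comp (algebraMap A₀ A) = σ₀ ∧
      σ.comp α = η := by
  algebraize [φ, σ₀.comp φ]
  let σ₀' : A₀ →ₐ[T] R := ⟨σ₀, fun _ => rfl⟩
  let η' : E →ₐ[T] R := ⟨η, fun t => (RingHom.congr_fun h t).symm⟩
  have : Module.Flat T E := Algebra.Smooth.flat T E
  refine ⟨A₀ ⊗[T] E, inferInstance, inferInstance, Algebra.TensorProduct.includeRight.toRingHom,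
    (Algebra.TensorProduct.productMap σ₀' η').toRingHom, inferInstance, inferInstance,
    inferInstance, ?_, ?_, ?_⟩
  · exact (Algebra.TensorProduct.includeRight : E →ₐ[T] A₀ ⊗[T] E).comp_algebraMap
  · ext a
    simp [σ₀']
  · ext e
    simp [η']

/-- A smooth affine variety is finite and flat over the affine line over an affine space, such that
a given proper closed subset is finite over the affine space, and the coordinates generate the
differentials at given points. -/
lemma exists_polynomial_coordinate (k : Type u) [Field k] [Infinite k] {B : Type u} [CommRing B]
    [IsDomain B] [Algebra k B] [Algebra.Smooth k B] (I : Ideal B) (h₀ : I ≠ ⊥) (h₁ : I ≠ ⊤)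
    (s : Set (Ideal B)) (hs : s.Finite) (hprime : ∀ p ∈ s, p ≠ ⊤) :
    ∃ (Q : Type u) (_ : CommRing Q) (_ : IsNoetherianRing Q) (_ : Algebra k Q) (_ : Algebra Q B)
      (_ : IsScalarTower k Q B) (z : B), Module.Finite Q (B ⧸ I) ∧
      (aeval z : Q[X] →ₐ[Q] B).toRingHom.Finite ∧ (aeval z : Q[X] →ₐ[Q] B).toRingHom.Flat ∧
      ∀ p ∈ s, ∃ g ∉ p, ∀ ω : Ω[B⁄k], g • ω ∈ Submodule.span B
        (Set.range fun i : Option Q => KaehlerDifferential.D k B (i.elim z (algebraMap Q B))) := by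
  obtain ⟨n, t, hd, hfin, hfinI, hΩ⟩ := exists_coordinates k I h₀ h₁ s hs hprime
  let f : MvPolynomial (Fin n) k →ₐ[k] B := MvPolynomial.aeval fun i => t i.succ
  let := f.toAlgebra
  have : IsScalarTower k (MvPolynomial (Fin n) k) B := .of_algHom f
  have e : ((aeval (t 0) : (MvPolynomial (Fin n) k)[X] →ₐ[MvPolynomial (Fin n) k] B).restrictScalars
      k).comp (MvPolynomial.finSuccEquiv k n).toAlgHom = MvPolynomial.aeval t := by
    refine MvPolynomial.algHom_ext fun i => ?_
    refine Fin.cases ?_ (fun i => ?_) i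
    · simp [MvPolynomial.finSuccEquiv_apply]
    · change aeval (t 0) (MvPolynomial.finSuccEquiv k n (.X i.succ)) = _
      rw [MvPolynomial.finSuccEquiv_X_succ, aeval_C, MvPolynomial.aeval_X]
      exact MvPolynomial.aeval_X (R := k) (fun i : Fin n => t i.succ) i
  have hz : (aeval (t 0) :
      (MvPolynomial (Fin n) k)[X] →ₐ[MvPolynomial (Fin n) k] B).toRingHom.Finite := by
    refine RingHom.Finite.of_comp_finite
      (f := ((MvPolynomial.finSuccEquiv k n).toAlgHom.toRingHom)) ?_
    have : (MvPolynomial.aeval t : _ →ₐ[k] B).toRingHom.Finite := hfin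
    rwa [← e] at this
  refine ⟨MvPolynomial (Fin n) k, inferInstance, inferInstance, inferInstance, inferInstance,
    inferInstance, t 0, ?_, hz, ?_, fun p hp => ?_⟩
  · have h : algebraMap (MvPolynomial (Fin n) k) (B ⧸ I) = (MvPolynomial.aeval (fun i =>
        Ideal.Quotient.mk I (t i.succ)) : MvPolynomial (Fin n) k →ₐ[k] B ⧸ I).toRingHom := by
      rw [IsScalarTower.algebraMap_eq _ B]
      have : (Ideal.Quotient.mkₐ k I).comp f = MvPolynomial.aeval (fun i =>
        Ideal.Quotient.mk I (t i.succ)) := MvPolynomial.algHom_ext fun i => by simp [f]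
      exact congrArg AlgHom.toRingHom this
    rw [← RingHom.finite_algebraMap, h]
    exact hfinI
  · algebraize [(aeval (t 0) : (MvPolynomial (Fin n) k)[X] →ₐ[MvPolynomial (Fin n) k] B).toRingHom]
    refine flat_of_finite_of_smooth k hd ?_
    rw [Polynomial.ringKrullDim_of_isNoetherianRing, MvPolynomial.ringKrullDim_of_isNoetherianRing,
      ringKrullDim_eq_zero_of_field]
    simp
  · obtain ⟨g, hg, h⟩ := hΩ p hp
    refine ⟨g, hg, fun ω => Submodule.span_mono ?_ (h ω)⟩
    rintro _ ⟨i, rfl⟩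
    refine Fin.cases ⟨none, rfl⟩ (fun i => ⟨some (.X i), ?_⟩) i
    exact congrArg (KaehlerDifferential.D k B)
      (MvPolynomial.aeval_X (R := k) (fun i : Fin n => t i.succ) i)

open Algebra.TensorProduct in
/-- Given a finite étale algebra `E` over `B ⊗ B` split over the diagonal and a proper nonzero ideal
`I` of the smooth domain `B`, there is an algebra `A` over a semilocal localization `R` of `B`, with
a retraction `σ` lying over the diagonal and finite flat over `R[X]` by means of `s`, such that
`s = 0` is the disjoint union of `σ` and a closed subset which does not meet the preimage `J` of
`I`, and neither does `s = 1`. Moreover `J` lies over an ideal `𝔟` of `R` the height of which is at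
least that of `I` minus one. -/
theorem exists_rectification {k : Type u} [Field k] [Infinite k] {B R E : Type u} [CommRing B]
    [IsDomain B] [Algebra k B] [Algebra.Smooth k B] [CommRing R] [Nontrivial R] [Algebra B R]
    (M : Submonoid B) [IsLocalization M R] (hmax : {m : Ideal R | m.IsMaximal}.Finite)
    [CommRing E] [Algebra (B ⊗[k] B) E] [Algebra.Etale (B ⊗[k] B) E] [Module.Finite (B ⊗[k] B) E]
    (ε : E →+* B) (hε : ε.comp (algebraMap (B ⊗[k] B) E) = (lmul' k (S := B)).toRingHom)
    (I : Ideal B) (h₀ : I ≠ ⊥) (h₁ : I ≠ ⊤) :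
    ∃ (A : Type u) (_ : CommRing A) (_ : Algebra R A) (α : E →+* A) (σ : A →ₐ[R] R) (s : A)
      (J I' : Ideal A) (𝔟 : Ideal R),
      α.EssFiniteType ∧
      (∀ b, α (algebraMap (B ⊗[k] B) E (b ⊗ₜ 1)) = algebraMap R A (algebraMap B R b)) ∧
      (∀ e, σ (α e) = algebraMap B R (ε e)) ∧
      J = I.map (α.comp ((algebraMap (B ⊗[k] B) E).comp includeRight.toRingHom)) ∧
      (aeval s : R[X] →ₐ[R] A).toRingHom.Finite ∧
      (aeval s : R[X] →ₐ[R] A).toRingHom.Flat ∧ Ideal.span {s - 1} ⊔ J = ⊤ ∧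
      RingHom.ker σ ⊓ I' = Ideal.span {s} ∧ RingHom.ker σ ⊔ I' = ⊤ ∧ I' ⊔ J = ⊤ ∧
      𝔟.map (algebraMap R A) ≤ J ∧ 𝔟 ≤ I.map (algebraMap B R) ∧
      ∀ p : Ideal R, p.IsPrime → 𝔟 ≤ p →
        ∃ q : Ideal B, q.IsPrime ∧ I ≤ q ∧ q.height ≤ p.height + 1 := by
  obtain ⟨Q, _, _, _, _, _, z, hQI, hzfin, hzflat, hΩ⟩ := exists_polynomial_coordinate k I h₀ h₁
    ((fun m : Ideal R => m.under B) '' {m | m.IsMaximal}) (hmax.image _) (by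
      rintro _ ⟨m, hm, rfl⟩
      have : m.IsMaximal := hm
      exact (inferInstance : (m.under B).IsPrime).ne_top)
  -- Making `Q` act on `R` through `B` turns `A₀` into the ring of `U ×_{Spec Q} X`, and the map `B
  -- ⟶ R` gives its diagonal section.
  let : Algebra Q R := ((algebraMap B R).comp (algebraMap Q B)).toAlgebra
  have : IsScalarTower Q B R := .of_algebraMap_eq' rfl
  let : Algebra k R := ((algebraMap B R).comp (algebraMap k B)).toAlgebra
  have : IsScalarTower k B R := .of_algebraMap_eq' rfl
  have : IsNoetherianRing B := Algebra.FiniteType.isNoetherianRing k B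
  have : IsNoetherianRing R := IsLocalization.isNoetherianRing M R inferInstance
  obtain ⟨A₀, _, _, β, σ₀, hβQ, hβfin, hβflat, hσβ, hgen⟩ :=
    exists_tensorProduct_coordinate z hzfin hzflat (IsScalarTower.toAlgHom Q B R)
  have hkQ (c : k) : β (algebraMap k B c) = algebraMap R A₀ (algebraMap k R c) := by
    rw [IsScalarTower.algebraMap_apply k Q B, hβQ, IsScalarTower.algebraMap_apply k B R,
      IsScalarTower.algebraMap_apply k Q B, IsScalarTower.algebraMap_apply Q B R]
  let : Algebra k A₀ := ((algebraMap R A₀).comp (algebraMap k R)).toAlgebra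
  have : IsScalarTower k R A₀ := .of_algebraMap_eq' rfl
  let βk : B →ₐ[k] A₀ := ⟨β, hkQ⟩
  let φ : B ⊗[k] B →ₐ[k] A₀ :=
    productMap ((IsScalarTower.toAlgHom k R A₀).comp (IsScalarTower.toAlgHom k B R)) βk
  obtain ⟨A, _, _, α, σ₁, hAfin, hAflat, _, hα, hσ₁, hσα⟩ := exists_etale_pullback
    (φ : B ⊗[k] B →+* A₀) (σ₀ : A₀ →+* R) ((algebraMap B R).comp ε) (by
      rw [RingHom.comp_assoc, hε]
      let σk : A₀ →ₐ[k] R := σ₀.restrictScalars k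
      have : σk.comp φ = (IsScalarTower.toAlgHom k B R).comp (lmul' k) := by
        ext b
        · simp [φ, σk]
        · simp [φ, σk, βk, hσβ]
      exact congrArg AlgHom.toRingHom this)
  let : Algebra R A := ((algebraMap A₀ A).comp (algebraMap R A₀)).toAlgebra
  have : IsScalarTower R A₀ A := .of_algebraMap_eq' rfl
  let : Algebra k A := ((algebraMap R A).comp (algebraMap k R)).toAlgebra
  have : IsScalarTower k R A := .of_algebraMap_eq' rfl
  let : Algebra B A := ((algebraMap A₀ A).comp β).toAlgebra
  have : IsScalarTower k B A := .of_algebraMap_eq fun c => by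
    change _ = algebraMap A₀ A (β _)
    rw [hkQ]
    rfl
  let σ : A →ₐ[R] R := ⟨σ₁, fun r => by
    refine (RingHom.congr_fun hσ₁ (algebraMap R A₀ r)).trans (σ₀.commutes r)⟩
  have hσB (b : B) : σ (algebraMap B A b) = algebraMap B R b :=
    (RingHom.congr_fun hσ₁ (β b)).trans (hσβ b)
  have hQA (q : Q) : algebraMap B A (algebraMap Q B q) = algebraMap R A (algebraMap Q R q) :=
    congrArg (algebraMap A₀ A) (hβQ q)
  have haeval : (aeval (algebraMap B A z) : R[X] →ₐ[R] A).toRingHom =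
      (algebraMap A₀ A).comp (aeval (β z) : R[X] →ₐ[R] A₀).toRingHom := by
    have : (aeval (algebraMap B A z) : R[X] →ₐ[R] A) =
        (IsScalarTower.toAlgHom R A₀ A).comp (aeval (β z) : R[X] →ₐ[R] A₀) :=
      Polynomial.algHom_ext (by simp; rfl)
    exact congrArg AlgHom.toRingHom this
  have hJ : (algebraMap B A) = α.comp ((algebraMap (B ⊗[k] B) E).comp includeRight.toRingHom) := by
    rw [← RingHom.comp_assoc, hα]
    ext b
    change algebraMap A₀ A (β b) = algebraMap A₀ A (φ (1 ⊗ₜ b))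
    simp [φ, βk]
  -- Besides `z` the coordinates come from `Q`, and these agree on both factors of the fibre
  -- product. So modulo `𝔧` all coordinates are constant along the section.
  let 𝔧 : Ideal A := Ideal.span {algebraMap B A z - algebraMap R A (σ (algebraMap B A z))} ⊔
    RingHom.ker σ ^ 2
  have hker : RingHom.ker σ ≤ 𝔧 := by
    refine ker_le_of_formallyUnramified (k := k) (A₀ := A₀) (fun a => ?_) σ 𝔧 le_sup_right
      (fun i : Option Q => i.elim z (algebraMap Q B)) (fun i => ?_) fun m hm => ?_
    · have : a ∈ Subring.closure (Set.range (algebraMap R A₀) ∪ Set.range β) := hgen ▸ trivial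
      have := (Subring.mem_map (f := algebraMap A₀ A)).mpr ⟨a, this, rfl⟩
      rw [RingHom.map_closure, Set.image_union, ← Set.range_comp, ← Set.range_comp] at this
      exact this
    · cases i with
      | none => exact Ideal.mem_sup_left (Ideal.mem_span_singleton_self _)
      | some q => simp [hQA]
    · obtain ⟨g, hg, h⟩ := hΩ _ ⟨m, hm, rfl⟩
      exact ⟨g, by rw [hσB]; exact hg, h⟩
  let J := I.map (algebraMap B A)
  have hfinQ : (algebraMap Q (B ⧸ I)).Finite := RingHom.finite_algebraMap.mpr hQI
  -- Finiteness of `B/I` over `Q` gives a monic equation for `z` modulo `I`, which pulls back to one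
  -- over `R` modulo `J`.
  obtain ⟨h, hmonic, hh⟩ := hfinQ.to_isIntegral (Ideal.Quotient.mk I z)
  have hhz : aeval z h ∈ I := by
    rw [← Ideal.Quotient.eq_zero_iff_mem, ← hh, ← aeval_def]
    exact (Polynomial.aeval_algebraMap_apply (B ⧸ I) z h).symm
  have hJh : aeval (algebraMap B A z) (h.map (algebraMap Q R)) ∈ J := by
    have : aeval (algebraMap B A z) (h.map (algebraMap Q R)) = algebraMap B A (aeval z h) := by
      rw [aeval_def, eval₂_map, aeval_def, hom_eval₂]
      congr 1
      ext q
      exact (hQA q).symm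
    rw [this]
    exact Ideal.mem_map_of_mem _ hhz
  obtain ⟨s, -, hsfin, hsflat, hs1, I', hI₁, hI₂, hI₃⟩ := exists_rectified_coordinate (k := k) hmax
    (algebraMap B A z)
    (haeval ▸ (RingHom.finite_algebraMap.mpr hAfin).comp hβfin)
    (haeval ▸ RingHom.Flat.comp hβflat (RingHom.flat_algebraMap_iff.mpr hAflat)) σ hker J
    (hmonic.map (algebraMap Q R)) hJh
  have hflatQB : Module.Flat Q B := by
    rw [← RingHom.flat_algebraMap_iff]
    have e : algebraMap Q B = (aeval z : Q[X] →ₐ[Q] B).toRingHom.comp (algebraMap Q Q[X]) :=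
      (aeval z : Q[X] →ₐ[Q] B).comp_algebraMap.symm
    rw [e]
    exact RingHom.Flat.comp (RingHom.flat_algebraMap_iff.mpr inferInstance) hzflat
  have : Module.Flat B R := IsLocalization.flat R M
  have hflatQR : Module.Flat Q R := Module.Flat.trans Q B R
  refine ⟨A, inferInstance, inferInstance, α, σ, s, J, I', (I.under Q).map (algebraMap Q R), ?_,
    fun b => ?_, RingHom.congr_fun hσα, by rw [← hJ], hsfin, hsflat, hs1, hI₁, hI₂, hI₃, ?_, ?_,
    fun p _ hp => exists_height_le_height_add_one z hzfin I p hp⟩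
  · have h₁ : (algebraMap k R).EssFiniteType :=
      have : Algebra.EssFiniteType B R := .of_isLocalization R M
      RingHom.essFiniteType_algebraMap.mpr (Algebra.EssFiniteType.comp k B R)
    have h₂ : (algebraMap R A₀).FiniteType := by
      have e := (aeval (β z) : R[X] →ₐ[R] A₀).comp_algebraMap
      rw [← e]
      exact hβfin.to_finiteType.comp (RingHom.finiteType_algebraMap.mpr inferInstance)
    have h₃ : (algebraMap k A).EssFiniteType :=
      (h₁.comp h₂.essFiniteType).comp
        (RingHom.finite_algebraMap.mpr hAfin).to_finiteType.essFiniteType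
    -- `A` is essentially of finite type over `k`, hence over the intermediate ring `E`.
    refine RingHom.EssFiniteType.of_comp
      ((algebraMap (B ⊗[k] B) E).comp (algebraMap k (B ⊗[k] B))) ?_
    have : α.comp ((algebraMap (B ⊗[k] B) E).comp (algebraMap k (B ⊗[k] B))) = algebraMap k A := by
      rw [← RingHom.comp_assoc, hα, RingHom.comp_assoc]
      exact congrArg _ φ.comp_algebraMap
    rwa [this]
  · refine (RingHom.congr_fun hα (b ⊗ₜ 1)).trans (congrArg (algebraMap A₀ A) ?_)
    simp [φ]
  · rw [Ideal.map_map]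
    have : (algebraMap R A).comp (algebraMap Q R) = (algebraMap B A).comp (algebraMap Q B) :=
      RingHom.ext fun q => (hQA q).symm
    rw [this, ← Ideal.map_map]
    exact Ideal.map_mono Ideal.map_comap_le
  · rw [IsScalarTower.algebraMap_eq Q B R, ← Ideal.map_map]
    exact Ideal.map_mono Ideal.map_comap_le

end Rectification

end EffacementTheorem

namespace EffacementTheorem

/-! ### Transfers, homotopy invariance and vanishing. -/

section Chase

variable {X : Scheme.{u}}

namespace Couple

lemma hom_ext_left {P Q : Couple X} {f g : P ⟶ Q} (h : Hom.left f = Hom.left g) : f = g :=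
  Hom.ext (Over.OverMorphism.ext h)

/-- A couple given by a scheme over the underlying scheme of a couple, with the preimage of the
support. -/
def preimage (P : Couple X) {T : Scheme.{u}} (f : T ⟶ P.obj.left) (hT : T.IsSeparated)
    (hf : IsEssFiniteType f) : Couple X where
  obj := Over.mk (f ≫ P.obj.hom)
  separated := hT
  essFiniteType := hf.comp P.essFiniteType
  supp := P.supp.preimage f.continuous

/-- The strict morphism from the preimage of a couple. -/
def preimageHom (P : Couple X) {T : Scheme.{u}} (f : T ⟶ P.obj.left) (hT : T.IsSeparated)
    (hf : IsEssFiniteType f) : P.preimage f hT hf ⟶ P :=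
  ⟨Over.homMk f rfl, le_rfl⟩

lemma _root_.AlgebraicGeometry.Scheme.IsSeparated.of_hom {S T : Scheme.{u}} (hS : S.IsSeparated)
    (f : T ⟶ S) [IsSeparated f] : T.IsSeparated := by
  have h : IsSeparated (f ≫ terminal.from S) := inferInstance
  rw [Subsingleton.elim (f ≫ terminal.from S) (terminal.from T)] at h
  exact ⟨h⟩

end Couple

namespace CoupleFunctor

variable {F : CoupleFunctor.{v} X}

/-- Such a morphism factors through the couple with the same scheme and empty support. -/
lemma HasVanishing.map_eq_zero (hF : F.HasVanishing) {P Q : Couple X} (f : P ⟶ Q)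
    (h : Couple.preimageSupp (Couple.Hom.hom f) = ⊥) : F.map f.op = 0 := by
  let P' : Couple X := ⟨P.obj, P.separated, P.essFiniteType, ⊥⟩
  let g : P ⟶ P' := ⟨𝟙 _, fun _ ht => ht.elim⟩
  let g' : P' ⟶ Q := ⟨Couple.Hom.hom (P := P) f, h.le⟩
  have e : f = g ≫ g' := Couple.hom_ext_left (Category.id_comp (Couple.Hom.left f)).symm
  rw [e, op_comp, F.map_comp, (hF P' rfl).eq_of_tgt (F.map g'.op) 0, zero_comp]

/-- Both maps are inverse to the isomorphism induced by the projection. -/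
lemma IsHomotopyInvariant.map_section_eq {S : Scheme.{u}} {q : X ⟶ S}
    (hF : F.IsHomotopyInvariant q) {P : Couple X} (hP : IsEssSmooth (P.obj.hom ≫ q))
    {i j : P ⟶ P.affineLine} (hi : i ≫ P.affineLineHom = 𝟙 P) (hj : j ≫ P.affineLineHom = 𝟙 P) :
    F.map i.op = F.map j.op := by
  have := hF P hP
  rw [← cancel_epi (F.map P.affineLineHom.op), ← F.map_comp, ← F.map_comp, ← op_comp, ← op_comp,
    hi, hj]

/-- A finite flat morphism to the affine line, the fibre of which over one rational point contains
a section as a connected component, while the support does not meet the other components nor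
the fibre over some other rational point, forces the restriction to the section to vanish. -/
theorem Transfers.map_eq_zero (tr : F.Transfers) (hvan : F.HasVanishing) {S : Scheme.{u}}
    {q : X ⟶ S} (hinv : F.IsHomotopyInvariant q) {P Q : Couple X}
    (hP : IsEssSmooth (P.obj.hom ≫ q)) (τ : P ⟶ Q)
    (s : Q.obj.left ⟶ AffineLine P.obj.left) (hfin : IsFinite s) (hflat : Flat s)
    (hs : s ≫ affineLineProj _ ≫ P.obj.hom = Q.obj.hom)
    (hsupp : Q.supp ≤ P.supp.preimage (s ≫ affineLineProj _).continuous)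
    {z₀ z₁ : P.obj.left ⟶ AffineLine P.obj.left} (hz₀ : z₀ ≫ affineLineProj _ = 𝟙 _)
    (hz₁ : z₁ ≫ affineLineProj _ = 𝟙 _) {W₀ W₁ W' : Scheme.{u}}
    {i₀ : W₀ ⟶ Q.obj.left} {π₀ : W₀ ⟶ P.obj.left} (h₀ : IsPullback i₀ π₀ s z₀)
    {i₁ : W₁ ⟶ Q.obj.left} {π₁ : W₁ ⟶ P.obj.left} (h₁ : IsPullback i₁ π₁ s z₁)
    (l : P.obj.left ⟶ W₀) (r : W' ⟶ W₀) (hlr : Nonempty (IsColimit (BinaryCofan.mk l r)))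
    (hrflat : Flat r) (hrfin : IsFinite r) (hl : l ≫ i₀ = Couple.Hom.left τ) (hl' : l ≫ π₀ = 𝟙 _)
    (hr : Q.supp.preimage (r ≫ i₀).continuous = ⊥) (hi₁ : Q.supp.preimage i₁.continuous = ⊥) :
    F.map τ.op = 0 := by
  have : IsFinite π₀ := MorphismProperty.of_isPullback h₀ inferInstance
  have : Flat π₀ := MorphismProperty.of_isPullback h₀ inferInstance
  have : IsFinite π₁ := MorphismProperty.of_isPullback h₁ inferInstance
  have : Flat π₁ := MorphismProperty.of_isPullback h₁ inferInstance
  have hsep : (AffineLine P.obj.left).IsSeparated := P.affineLine.separated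
  -- Transfers require the full preimage of the support downstairs, which may be larger than the
  -- support of `Q`. Hence the class is first moved to `Q'` by `ρ`.
  let Q' : Couple X := P.affineLine.preimage s (hsep.of_hom s)
    (isEssFiniteType_of_locallyOfFiniteType s)
  let ρ : Q' ⟶ Q := ⟨Over.homMk (𝟙 _) (by simp [Q', Couple.preimage, ← hs, Couple.affineLine]),
    hsupp⟩
  let sc : Q' ⟶ P.affineLine := Couple.preimageHom _ _ _ _
  have hsc : Couple.Hom.IsFiniteFlat sc := ⟨‹IsFinite s›, ‹Flat s›, rfl⟩
  have hpre {z : P.obj.left ⟶ AffineLine P.obj.left} (hz : z ≫ affineLineProj _ = 𝟙 _) :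
      P.supp = (P.supp.preimage (affineLineProj P.obj.left).continuous).preimage z.continuous := by
    ext t
    change t ∈ P.supp ↔ (z ≫ affineLineProj _) t ∈ P.supp
    rw [hz]
    rfl
  let zc {z : P.obj.left ⟶ AffineLine P.obj.left} (hz : z ≫ affineLineProj _ = 𝟙 _) :
    P ⟶ P.affineLine := ⟨Over.homMk z (by simp [Couple.affineLine, reassoc_of% hz]), (hpre hz).ge⟩
  have hzc {z : P.obj.left ⟶ AffineLine P.obj.left} (hz : z ≫ affineLineProj _ = 𝟙 _) :
      zc hz ≫ P.affineLineHom = 𝟙 P := Couple.hom_ext_left hz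
  let fib {z : P.obj.left ⟶ AffineLine P.obj.left} (hz : z ≫ affineLineProj _ = 𝟙 _)
    {W : Scheme.{u}} {i : W ⟶ Q.obj.left} {π : W ⟶ P.obj.left} (h : IsPullback i π s z)
    [IsFinite π] : P.preimage π (P.separated.of_hom π)
      (isEssFiniteType_of_locallyOfFiniteType π) ⟶ Q' :=
    ⟨Over.homMk i (by
      change i ≫ s ≫ affineLineProj _ ≫ P.obj.hom = π ≫ P.obj.hom
      rw [h.w_assoc, reassoc_of% hz]), by
      intro t ht
      change π t ∈ P.supp
      replace ht : (i ≫ s ≫ affineLineProj _) t ∈ P.supp := ht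
      rwa [h.w_assoc, hz, Category.comp_id] at ht⟩
  let πc {W : Scheme.{u}} (π : W ⟶ P.obj.left) [IsFinite π] := P.preimageHom π
    (P.separated.of_hom π) (isEssFiniteType_of_locallyOfFiniteType π)
  have hπc {W : Scheme.{u}} (π : W ⟶ P.obj.left) [hf : IsFinite π] [hfl : Flat π] :
    Couple.Hom.IsFiniteFlat (πc π) := ⟨hf, hfl, rfl⟩
  have e₁ : F.map ρ.op ≫ tr.tr sc hsc ≫ F.map (zc hz₁).op = 0 := by
    rw [tr.base_change (fib hz₁ h₁) (πc π₁) sc (zc hz₁) hsc (hπc π₁) (hpre hz₁) h₁,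
      ← Category.assoc, ← F.map_comp, ← op_comp, hvan.map_eq_zero _ ?_, zero_comp]
    exact hi₁
  have e₀ : F.map ρ.op ≫ tr.tr sc hsc ≫ F.map (zc hz₀).op = 0 := by
    rw [hinv.map_section_eq hP (hzc hz₀) (hzc hz₁), e₁]
  let lc : P ⟶ P.preimage π₀ (P.separated.of_hom π₀)
      (isEssFiniteType_of_locallyOfFiniteType π₀) :=
    ⟨Over.homMk l (by
      change l ≫ π₀ ≫ P.obj.hom = P.obj.hom
      rw [reassoc_of% hl']), by
      intro t ht
      replace ht : (l ≫ π₀) t ∈ P.supp := ht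
      rwa [hl'] at ht⟩
  have hlc : lc ≫ πc π₀ = 𝟙 P := Couple.hom_ext_left hl'
  let rc := Couple.preimageHom (P.preimage π₀ (P.separated.of_hom π₀)
      (isEssFiniteType_of_locallyOfFiniteType π₀)) r ((P.separated.of_hom π₀).of_hom r)
      (isEssFiniteType_of_locallyOfFiniteType r)
  have hrc : Couple.Hom.IsFiniteFlat (rc ≫ πc π₀) :=
    ⟨(inferInstance : IsFinite (r ≫ π₀)), (inferInstance : Flat (r ≫ π₀)), rfl⟩
  have hid : Couple.Hom.IsFiniteFlat (lc ≫ πc π₀) := by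
    rw [hlc]
    exact ⟨(inferInstance : IsFinite (𝟙 P.obj.left)), (inferInstance : Flat (𝟙 P.obj.left)), rfl⟩
  -- On the component of the section the transfer is that of an isomorphism, so normalization lets
  -- it be cancelled at the end.
  have : IsIso (lc ≫ πc π₀) := by
    rw [hlc]
    infer_instance
  rw [tr.base_change (fib hz₀ h₀) (πc π₀) sc (zc hz₀) hsc (hπc π₀) (hpre hz₀) h₀,
    tr.additive lc rc (πc π₀) (hπc π₀) hid hrc hlr, Preadditive.comp_add, Preadditive.comp_add,
    ← F.map_comp_assoc, ← F.map_comp_assoc, ← F.map_comp_assoc, ← F.map_comp_assoc, ← op_comp,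
    ← op_comp, ← op_comp,
    hvan.map_eq_zero (rc ≫ fib hz₀ h₀ ≫ ρ) hr, zero_comp,
    add_zero] at e₀
  have e : lc ≫ fib hz₀ h₀ ≫ ρ = τ := Couple.hom_ext_left hl
  rw [e] at e₀
  have := congrArg (· ≫ F.map (lc ≫ πc π₀).op) e₀
  simpa only [Category.assoc, tr.tr_comp_map, Category.comp_id, zero_comp] using this

end CoupleFunctor

end Chase

end EffacementTheorem

namespace EffacementTheorem

/-! ### Translation to rings. -/

section Spec

open Polynomial

/-- The fibre of a function `s` over a rational point `c` of the affine line. -/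
lemma isPushout_quotient_span {R A : Type u} [CommRing R] [CommRing A] [Algebra R A] (s : A)
    (c : R) :
    IsPushout (CommRingCat.ofHom (MvPolynomial.aeval fun _ : PUnit.{u + 1} => s :
        MvPolynomial PUnit R →ₐ[R] A).toRingHom)
      (CommRingCat.ofHom (MvPolynomial.aeval fun _ : PUnit.{u + 1} => c :
        MvPolynomial PUnit R →ₐ[R] R).toRingHom)
      (CommRingCat.ofHom (algebraMap A (A ⧸ Ideal.span {s - algebraMap R A c})))
      (CommRingCat.ofHom (algebraMap R (A ⧸ Ideal.span {s - algebraMap R A c}))) := by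
  have hc : algebraMap A (A ⧸ Ideal.span {s - algebraMap R A c}) s = algebraMap R _ c := by
    rw [IsScalarTower.algebraMap_apply R A (A ⧸ _) c, ← sub_eq_zero, ← map_sub]
    exact Ideal.Quotient.eq_zero_iff_mem.mpr (Ideal.mem_span_singleton_self _)
  refine .of_isColimit' ⟨?_⟩ (PushoutCocone.IsColimit.mk _
    (fun t => CommRingCat.ofHom (Ideal.Quotient.lift _ t.inl.hom ?_)) (fun t => ?_) (fun t => ?_)
    fun t m hm _ => ?_)
  · refine CommRingCat.hom_ext (MvPolynomial.ringHom_ext (fun r => ?_) fun _ => ?_)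
    · change algebraMap A _ (MvPolynomial.aeval _ (.C r)) = algebraMap R _ (MvPolynomial.aeval _ (.C r))
      rw [MvPolynomial.aeval_C, MvPolynomial.aeval_C]
      rfl
    · simpa using hc
  · have h (p) : t.inl.hom (MvPolynomial.aeval (fun _ => s) p) =
        t.inr.hom (MvPolynomial.aeval (fun _ => c) p) :=
      congrArg (fun f => f.hom p) t.condition
    have h₁ := h (.X PUnit.unit)
    have h₂ := h (.C c)
    simp only [MvPolynomial.aeval_X, MvPolynomial.aeval_C] at h₁ h₂
    intro a ha
    refine Ideal.span_le (I := RingHom.ker t.inl.hom).mpr ?_ ha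
    rintro _ rfl
    change t.inl.hom _ = 0
    rw [map_sub, h₁, h₂]
    exact sub_self _
  · ext a
    rfl
  · ext r
    have h : t.inl.hom (MvPolynomial.aeval (fun _ => s) (MvPolynomial.C r)) =
        t.inr.hom (MvPolynomial.aeval (fun _ => c) (MvPolynomial.C r)) :=
      congrArg (fun f => f.hom (MvPolynomial.C r)) t.condition
    simp only [MvPolynomial.aeval_C] at h
    exact h
  · refine CommRingCat.hom_ext (Ideal.Quotient.ringHom_ext (RingHom.ext fun a => ?_))
    exact congrArg (fun f => f.hom a) hm

lemma isPullback_spec_quotient_span {R A : Type u} [CommRing R] [CommRing A] [Algebra R A] (s : A)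
    (c : R) :
    IsPullback
      (Spec.map (CommRingCat.ofHom (algebraMap A (A ⧸ Ideal.span {s - algebraMap R A c}))))
      (Spec.map (CommRingCat.ofHom (algebraMap R (A ⧸ Ideal.span {s - algebraMap R A c}))))
      (Spec.map (CommRingCat.ofHom (MvPolynomial.aeval fun _ : PUnit.{u + 1} => s :
        MvPolynomial PUnit R →ₐ[R] A).toRingHom) ≫ (AffineSpace.SpecIso PUnit (.of R)).inv)
      (Spec.map (CommRingCat.ofHom (MvPolynomial.aeval fun _ : PUnit.{u + 1} => c :
        MvPolynomial PUnit R →ₐ[R] R).toRingHom) ≫ (AffineSpace.SpecIso PUnit (.of R)).inv) :=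
  (isPullback_SpecMap_of_isPushout _ _ _ _ (isPushout_quotient_span s c)).of_iso (Iso.refl _)
    (Iso.refl _) (Iso.refl _) (AffineSpace.SpecIso PUnit (.of R)).symm (by simp) (by simp) (by simp)
    (by simp)

lemma specMap_aeval_comp_affineLineProj {R A : Type u} [CommRing R] [CommRing A] [Algebra R A]
    (s : A) :
    (Spec.map (CommRingCat.ofHom (MvPolynomial.aeval fun _ : PUnit.{u + 1} => s :
        MvPolynomial PUnit R →ₐ[R] A).toRingHom) ≫ (AffineSpace.SpecIso PUnit (.of R)).inv) ≫
      affineLineProj (Spec (.of R)) = Spec.map (CommRingCat.ofHom (algebraMap R A)) := by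
  rw [Category.assoc, AffineSpace.SpecIso_inv_over, ← Spec.map_comp, ← CommRingCat.ofHom_comp]
  congr 2
  exact (MvPolynomial.aeval fun _ : PUnit.{u + 1} => s :
        MvPolynomial PUnit R →ₐ[R] A).comp_algebraMap

/-- The affine line is modelled on `MvPolynomial PUnit`, while the algebra above concerns `R[X]`;
this carries finiteness and flatness across. -/
lemma mvPolynomial_aeval_eq_comp {R A : Type u} [CommRing R] [CommRing A] [Algebra R A] (s : A) :
    (MvPolynomial.aeval fun _ : PUnit.{u + 1} => s : MvPolynomial PUnit R →ₐ[R] A).toRingHom =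
      (aeval s : R[X] →ₐ[R] A).toRingHom.comp (MvPolynomial.uniqueAlgEquiv R PUnit).toAlgHom.toRingHom := by
  have : (MvPolynomial.aeval fun _ : PUnit.{u + 1} => s : MvPolynomial PUnit R →ₐ[R] A) =
      (aeval s : R[X] →ₐ[R] A).comp (MvPolynomial.uniqueAlgEquiv R PUnit).toAlgHom :=
    MvPolynomial.algHom_ext fun i => by simp
  exact congrArg AlgHom.toRingHom this

/-- If `S → R₁ × R₂` is bijective, then `Spec S` is the disjoint union of `Spec R₁` and
`Spec R₂`. -/
lemma nonempty_isColimit_binaryCofan_spec {S R₁ R₂ : Type u} [CommRing S] [CommRing R₁]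
    [CommRing R₂] (f : S →+* R₁) (g : S →+* R₂) (h : Function.Bijective (f.prod g)) :
    IsOpenImmersion (Spec.map (CommRingCat.ofHom g)) ∧
    Nonempty (IsColimit (BinaryCofan.mk (Spec.map (CommRingCat.ofHom f))
      (Spec.map (CommRingCat.ofHom g)))) := by
  let e := (RingEquiv.ofBijective (f.prod g) h).toCommRingCatIso
  have hf : Spec.map (CommRingCat.ofHom f) =
      (coprod.inl ≫ coprodSpec R₁ R₂) ≫ Spec.map e.hom := by
    rw [coprodSpec_inl, ← Spec.map_comp]
    rfl
  have hg : Spec.map (CommRingCat.ofHom g) =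
      (coprod.inr ≫ coprodSpec R₁ R₂) ≫ Spec.map e.hom := by
    rw [coprodSpec_inr, ← Spec.map_comp]
    rfl
  let i : Spec (.of R₁) ⨿ Spec (.of R₂) ≅ Spec (.of S) :=
    asIso (coprodSpec R₁ R₂) ≪≫ asIso (Spec.map e.hom)
  refine ⟨hg ▸ inferInstance, ⟨(IsColimit.ofIsoColimit (coprodIsCoprod _ _)
    (BinaryCofan.ext i ?_ ?_))⟩⟩
  · rw [hf, Category.assoc]
    rfl
  · rw [hg, Category.assoc]
    rfl

/-- This is the Chinese remainder theorem with `A / ker σ` identified with `R`. -/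
lemma bijective_prod_of_inf_eq_span {R A : Type u} [CommRing R] [CommRing A] [Algebra R A]
    (σ : A →ₐ[R] R) (I I' : Ideal A) (hinf : RingHom.ker σ ⊓ I' = I)
    (hsup : RingHom.ker σ ⊔ I' = ⊤) (hσ : ∀ a ∈ I, σ.toRingHom a = 0) (hI' : I ≤ I') :
    Function.Bijective ((Ideal.Quotient.lift I σ.toRingHom hσ).prod (Ideal.Quotient.factor hI')) := by
  constructor
  · rw [injective_iff_map_eq_zero]
    intro x hx
    obtain ⟨x, rfl⟩ := Ideal.Quotient.mk_surjective x
    rw [Ideal.Quotient.eq_zero_iff_mem, ← hinf]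
    exact ⟨congrArg Prod.fst hx, Ideal.Quotient.eq_zero_iff_mem.mp (congrArg Prod.snd hx)⟩
  · rintro ⟨a, b⟩
    obtain ⟨b, rfl⟩ := Ideal.Quotient.mk_surjective b
    obtain ⟨x, hx, y, hy, hxy⟩ := Submodule.mem_sup.mp ((Ideal.eq_top_iff_one _).mp hsup)
    have hy' : σ y = 1 := by
      rw [← map_one σ, ← hxy, map_add, (show σ x = 0 from hx), zero_add]
    refine ⟨Ideal.Quotient.mk I (y * algebraMap R A a + x * b), Prod.ext ?_ ?_⟩
    · change σ (y * algebraMap R A a + x * b) = a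
      rw [map_add, map_mul, map_mul, hy', (show σ x = 0 from hx), σ.commutes]
      simp
    · change Ideal.Quotient.mk I' (y * algebraMap R A a + x * b) = Ideal.Quotient.mk I' b
      rw [Ideal.Quotient.eq]
      have : y * algebraMap R A a + x * b - b = y * (algebraMap R A a - b) := by
        rw [eq_sub_of_add_eq hxy]
        ring
      rw [this]
      exact I'.mul_mem_right _ hy

/-- The closed subset of `Spec A` given by an ideal. -/
noncomputable def zeroLocus {A : Type u} [CommRing A] (J : Ideal A) : Closeds (Spec (.of A)) :=
  ⟨PrimeSpectrum.zeroLocus (J : Set A), PrimeSpectrum.isClosed_zeroLocus _⟩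

lemma preimage_zeroLocus {A D : Type u} [CommRing A] [CommRing D] (f : A →+* D) (J : Ideal A) :
    (zeroLocus J).preimage (Spec.map (CommRingCat.ofHom f)).continuous = zeroLocus (J.map f) := by
  ext t
  change J ≤ Ideal.comap f t.asIdeal ↔ J.map f ≤ t.asIdeal
  rw [Ideal.map_le_iff_le_comap]

lemma zeroLocus_eq_bot {A : Type u} [CommRing A] {J : Ideal A} (h : J = ⊤) : zeroLocus J = ⊥ := by
  ext t
  refine ⟨fun ht => t.2.ne_top (top_le_iff.mp (h ▸ ht)), fun ht => ht.elim⟩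

lemma zeroLocus_anti {A : Type u} [CommRing A] {I J : Ideal A} (h : I ≤ J) :
    zeroLocus J ≤ zeroLocus I :=
  fun _ ht => h.trans ht

/-- A spectrum over `U` with a closed subset, as a couple. -/
noncomputable def specCouple {U : Scheme.{u}} {A : Type u} [CommRing A] (f : Spec (.of A) ⟶ U)
    (hf : IsEssFiniteType f) (Z : Closeds (Spec (.of A))) : Couple U :=
  ⟨Over.mk f, inferInstanceAs (Spec (.of A)).IsSeparated, hf, Z⟩

/-- The ideal-theoretic form of `Transfers.map_eq_zero`: comaximality with `J` says that a closed
subscheme misses the support, and the decomposition of `(s)` splits the fibre over `0`. -/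
theorem CoupleFunctor.Transfers.map_eq_zero_of_algebra {X S : Scheme.{u}} {F : CoupleFunctor.{v} X}
    (tr : F.Transfers) (hvan : F.HasVanishing) {q : X ⟶ S} (hinv : F.IsHomotopyInvariant q)
    {R A : Type u} [CommRing R] [CommRing A] [Algebra R A] (f : Spec (.of A) ⟶ X)
    (hf : IsEssFiniteType f) (g : Spec (.of R) ⟶ X) (hg : IsEssFiniteType g)
    (hfg : Spec.map (CommRingCat.ofHom (algebraMap R A)) ≫ g = f) (hsm : IsEssSmooth (g ≫ q))
    (σ : A →ₐ[R] R) (s : A) (J I' : Ideal A) (𝔟 : Ideal R)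
    (hfin : (aeval s : R[X] →ₐ[R] A).toRingHom.Finite)
    (hflat : (aeval s : R[X] →ₐ[R] A).toRingHom.Flat) (h₁ : Ideal.span {s - 1} ⊔ J = ⊤)
    (hinf : RingHom.ker σ ⊓ I' = Ideal.span {s}) (hsup : RingHom.ker σ ⊔ I' = ⊤)
    (hI'J : I' ⊔ J = ⊤) (h𝔟 : 𝔟.map (algebraMap R A) ≤ J)
    (τ : specCouple g hg (zeroLocus 𝔟) ⟶ specCouple f hf (zeroLocus J))
    (hτ : Couple.Hom.left τ = Spec.map (CommRingCat.ofHom σ.toRingHom)) :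
    F.map τ.op = 0 := by
  have hz (c : R) := specMap_aeval_comp_affineLineProj (R := R) (A := R) c
  have hid : Spec.map (CommRingCat.ofHom (algebraMap R R)) = 𝟙 _ := Spec.map_id _
  have hsp : Ideal.span {s - algebraMap R A 0} = Ideal.span {s} := by rw [map_zero, sub_zero]
  have hσ : ∀ a ∈ Ideal.span {s - algebraMap R A 0}, σ.toRingHom a = 0 := by
    intro a ha
    rw [hsp] at ha
    exact (hinf.ge ha).1
  have hI' : Ideal.span {s - algebraMap R A 0} ≤ I' := hsp.trans_le (hinf.ge.trans inf_le_right)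
  obtain ⟨_, hcolim⟩ := nonempty_isColimit_binaryCofan_spec _ _
    (bijective_prod_of_inf_eq_span σ _ I' (hinf.trans hsp.symm) hsup hσ hI')
  have : IsFinite (Spec.map (CommRingCat.ofHom (Ideal.Quotient.factor hI'))) :=
    (IsFinite.SpecMap_iff _).mpr
      (RingHom.Finite.of_surjective _ (Ideal.Quotient.factor_surjective hI'))
  have hF := mvPolynomial_aeval_eq_comp.{u} (R := R) s
  have hfin' : IsFinite (Spec.map (CommRingCat.ofHom (MvPolynomial.aeval fun _ : PUnit.{u + 1} => s :
        MvPolynomial PUnit R →ₐ[R] A).toRingHom)) := by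
    rw [IsFinite.SpecMap_iff, CommRingCat.hom_ofHom, hF]
    exact hfin.comp (RingHom.Finite.of_surjective _ (MvPolynomial.uniqueAlgEquiv R PUnit).surjective)
  have hflat' : Flat (Spec.map (CommRingCat.ofHom (MvPolynomial.aeval fun _ : PUnit.{u + 1} => s :
        MvPolynomial PUnit R →ₐ[R] A).toRingHom)) := by
    rw [Flat.SpecMap_iff, CommRingCat.hom_ofHom, hF]
    exact RingHom.Flat.comp (.of_bijective (MvPolynomial.uniqueAlgEquiv R PUnit).bijective) hflat
  let ψ : Spec (.of A) ⟶ AffineLine (Spec (.of R)) :=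
    Spec.map (CommRingCat.ofHom (MvPolynomial.aeval fun _ : PUnit.{u + 1} => s :
      MvPolynomial PUnit R →ₐ[R] A).toRingHom) ≫ (AffineSpace.SpecIso PUnit (.of R)).inv
  have hψfin : IsFinite ψ := MorphismProperty.comp_mem _ _ _ hfin' inferInstance
  have hψflat : Flat ψ := MorphismProperty.comp_mem _ _ _ hflat' inferInstance
  have hψ : ψ ≫ affineLineProj (Spec (.of R)) = Spec.map (CommRingCat.ofHom (algebraMap R A)) :=
    specMap_aeval_comp_affineLineProj s
  have hψg : ψ ≫ affineLineProj (Spec (.of R)) ≫ g = f := by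
    rw [← Category.assoc, hψ, hfg]
  have hsupp : zeroLocus J ≤
      (zeroLocus 𝔟).preimage (ψ ≫ affineLineProj (Spec (.of R))).continuous := by
    intro t ht
    change (ψ ≫ affineLineProj (Spec (.of R))) t ∈ zeroLocus 𝔟
    rw [hψ]
    change t ∈ (zeroLocus 𝔟).preimage (Spec.map (CommRingCat.ofHom (algebraMap R A))).continuous
    rw [preimage_zeroLocus]
    exact zeroLocus_anti h𝔟 ht
  have hl : Spec.map (CommRingCat.ofHom (Ideal.Quotient.lift _ σ.toRingHom hσ)) ≫
      Spec.map (CommRingCat.ofHom (algebraMap A (A ⧸ Ideal.span {s - algebraMap R A 0}))) =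
      Spec.map (CommRingCat.ofHom σ.toRingHom) := by
    rw [← Spec.map_comp]
    rfl
  have hl' : Spec.map (CommRingCat.ofHom (Ideal.Quotient.lift _ σ.toRingHom hσ)) ≫
      Spec.map (CommRingCat.ofHom (algebraMap R (A ⧸ Ideal.span {s - algebraMap R A 0}))) =
      𝟙 (Spec (.of R)) := by
    rw [← Spec.map_comp, ← CommRingCat.ofHom_comp]
    refine Eq.trans ?_ hid
    congr 2
    exact σ.comp_algebraMap
  have hmap (I : Ideal A) (hI : I ⊔ J = ⊤) : J.map (Ideal.Quotient.mk I) = ⊤ := by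
    rw [← Ideal.comap_injective_of_surjective _ Ideal.Quotient.mk_surjective |>.eq_iff,
      Ideal.comap_map_of_surjective _ Ideal.Quotient.mk_surjective, Ideal.comap_top,
      ← RingHom.ker_eq_comap_bot, Ideal.mk_ker, sup_comm, hI]
  have hr : (zeroLocus J).preimage (Spec.map (CommRingCat.ofHom (Ideal.Quotient.factor hI')) ≫
      Spec.map (CommRingCat.ofHom (algebraMap A (A ⧸ Ideal.span {s - algebraMap R A 0})))).continuous
      = ⊥ := by
    ext t
    refine ⟨fun ht => ?_, fun ht => ht.elim⟩
    replace ht : (Spec.map (CommRingCat.ofHom (Ideal.Quotient.factor hI')) ≫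
      Spec.map (CommRingCat.ofHom (algebraMap A _))) t ∈ zeroLocus J := ht
    rw [← Spec.map_comp, ← CommRingCat.ofHom_comp] at ht
    replace ht : t ∈ (zeroLocus J).preimage
      (Spec.map (CommRingCat.ofHom (Ideal.Quotient.mk I'))).continuous := ht
    rw [preimage_zeroLocus, zeroLocus_eq_bot (hmap I' hI'J)] at ht
    exact ht
  have h₁' : (zeroLocus J).preimage (Spec.map (CommRingCat.ofHom
      (algebraMap A (A ⧸ Ideal.span {s - algebraMap R A 1})))).continuous = ⊥ := by
    rw [preimage_zeroLocus]
    exact zeroLocus_eq_bot (hmap _ (by rw [map_one, h₁]))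
  exact tr.map_eq_zero hvan hinv (P := specCouple g hg (zeroLocus 𝔟))
    (Q := specCouple f hf (zeroLocus J)) hsm τ ψ hψfin hψflat hψg hsupp ((hz 0).trans hid)
    ((hz 1).trans hid) (isPullback_spec_quotient_span s 0) (isPullback_spec_quotient_span s 1)
    (Spec.map (CommRingCat.ofHom (Ideal.Quotient.lift _ σ.toRingHom hσ)))
    (Spec.map (CommRingCat.ofHom (Ideal.Quotient.factor hI'))) hcolim inferInstance inferInstance
    (hl.trans hτ.symm) hl' hr h₁'

end Spec

end EffacementTheorem

namespace EffacementTheorem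

/-! ### The semi-local scheme. -/

section Semilocal

/-- A maximal ideal of the localization contracts into the union of the given primes. Prime
avoidance puts it into one of them, so it is the extension of that prime. -/
lemma finite_isMaximal_of_isLocalization {B R : Type*} [CommRing B] [CommRing R] [Algebra B R]
    (M : Submonoid B) [IsLocalization M R] (S : Set (Ideal B)) (hS : S.Finite)
    (hprime : ∀ p ∈ S, p.IsPrime) (hM : ∀ b, (∀ p ∈ S, b ∉ p) ↔ b ∈ M) :
    {m : Ideal R | m.IsMaximal}.Finite := by
  refine (hS.image fun p => p.map (algebraMap B R)).subset fun m hm => ?_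
  have hm : m.IsMaximal := hm
  have hsub : ((m.under B : Ideal B) : Set B) ⊆ ⋃ p ∈ S, (p : Set B) := by
    intro b hb
    by_contra h
    simp only [Set.mem_iUnion, not_exists] at h
    exact hm.ne_top (Ideal.eq_top_of_isUnit_mem _ hb
      (IsLocalization.map_units R ⟨b, (hM b).mp fun p hp => h p hp⟩))
  obtain ⟨p, hp, hle⟩ := (Ideal.subset_union_prime_finite hS (f := id) ⊥ ⊥
    fun p hp _ _ => hprime p hp).mp hsub
  have := hprime p hp
  have hdisj : Disjoint (M : Set B) (p : Set B) := by
    rw [Set.disjoint_left]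
    exact fun b hb hbp => (hM b).mpr hb p hp hbp
  refine ⟨p, hp, (hm.eq_of_le (IsLocalization.isPrime_of_isPrime_disjoint M R p this
    hdisj).ne_top ?_).symm⟩
  rw [← IsLocalization.map_under M R m]
  exact Ideal.map_mono hle

lemma finite_isMaximal_semilocalRing (X : Scheme.{u}) [IsAffine X] (x : Set X) (hx : x.Finite) :
    {m : Ideal (Localization (nonvanishing X x)) | m.IsMaximal}.Finite := by
  refine finite_isMaximal_of_isLocalization (nonvanishing X x)
    ((fun t => (X.isoSpec.hom t).asIdeal) '' x) (hx.image _) ?_ fun b => ?_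
  · rintro _ ⟨t, -, rfl⟩
    exact (X.isoSpec.hom t).2
  · rw [Set.forall_mem_image]
    refine forall₂_congr fun t _ => ?_
    rw [← X.toSpecΓ_preimage_basicOpen b]
    rfl

lemma RingHomEssSmooth.conj {A B A' B' : Type u} [CommRing A] [CommRing B] [CommRing A']
    [CommRing B'] {φ : A →+* B} (h : RingHomEssSmooth φ) (e : A' ≃+* A) (e' : B ≃+* B') :
    RingHomEssSmooth ((e' : B →+* B').comp (φ.comp (e : A' →+* A))) := by
  obtain ⟨C, _, α, β, M, hα, rfl, hM⟩ := h
  refine ⟨C, _, α.comp e, (e' : B →+* B').comp β, M, ?_, rfl, ?_⟩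
  · exact (RingHom.Smooth.respectsIso).2 α e hα
  · algebraize [β, (e' : B →+* B').comp β]
    exact IsLocalization.isLocalization_of_algEquiv M (AlgEquiv.ofRingEquiv (f := e') fun _ => rfl)

lemma isEssSmooth_specMap {A B : CommRingCat.{u}} (φ : A ⟶ B) (h : RingHomEssSmooth φ.hom) :
    IsEssSmooth (Spec.map φ) := by
  refine fun x => ⟨⟨⊤, isAffineOpen_top _⟩, ⟨⊤, isAffineOpen_top _⟩, le_rfl, trivial, ?_⟩
  have e : (Spec.map φ).appLE ⊤ ⊤ le_rfl =
      (Scheme.ΓSpecIso A).hom ≫ φ ≫ (Scheme.ΓSpecIso B).inv := by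
    rw [← Category.assoc, Iso.eq_comp_inv]
    exact (congrArg (· ≫ _) (Scheme.Hom.appLE_eq_app _)).trans (Scheme.ΓSpecIso_naturality φ)
  change RingHomEssSmooth ((Spec.map φ).appLE ⊤ ⊤ le_rfl).hom
  rw [e]
  exact h.conj (Scheme.ΓSpecIso A).commRingCatIsoToRingEquiv
    (Scheme.ΓSpecIso B).symm.commRingCatIsoToRingEquiv

lemma exists_zeroLocus_eq {A : Type u} [CommRing A] (Z : Closeds (Spec (.of A))) :
    ∃ I : Ideal A, zeroLocus I = Z := by
  obtain ⟨I, hI⟩ := (PrimeSpectrum.isClosed_iff_zeroLocus_ideal Z.1).mp Z.2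
  exact ⟨I, Closeds.ext hI.symm⟩

lemma codim_le_height {X : Scheme.{u}} [IsAffine X] (Z : Closeds X) (I : Ideal Γ(X, ⊤))
    (hI : zeroLocus I = Z.preimage X.isoSpec.inv.continuous) (p : Ideal Γ(X, ⊤)) [hp : p.IsPrime]
    (h : I ≤ p) : codim Z ≤ p.height := by
  let t : Spec Γ(X, ⊤) := ⟨p, hp⟩
  have ht : X.isoSpec.inv t ∈ Z := by
    have : t ∈ zeroLocus I := h
    rw [hI] at this
    exact this
  have e : p.height = Order.coheight (X.isoSpec.inv t) := by
    rw [coheight_eq_of_isOpenImmersion]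
    exact idealHeight_eq_coheight Γ(X, ⊤) t
  rw [e]
  exact iInf₂_le _ ht

lemma restrictSupp_eq_zeroLocus {X : Scheme.{u}} [IsAffine X] (x : Set X) (Z : Closeds X)
    (I : Ideal Γ(X, ⊤)) (hI : zeroLocus I = Z.preimage X.isoSpec.inv.continuous) :
    restrictSupp x Z = zeroLocus (I.map (algebraMap _ (Localization (nonvanishing X x)))) := by
  rw [← preimage_zeroLocus, hI]
  rfl

end Semilocal

/-! ### The monodromy cover in terms of rings. -/

section Monodromy

open TensorProduct

lemma specMap_ΓSpecIso_inv_comp_appTop {Y : Scheme.{u}} [IsAffine Y] {T : CommRingCat.{u}}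
    (f : Y ⟶ Spec T) :
    Spec.map ((Scheme.ΓSpecIso T).inv ≫ f.appTop) = Y.isoSpec.inv ≫ f := by
  rw [Spec.map_comp, ← Scheme.isoSpec_inv_naturality, Scheme.isoSpec_Spec_inv]

/-- `Y` is finite over the affine scheme `X × X`, so the cover, its section over the diagonal and
both projections are given by ring maps, as `exists_rectification` requires. -/
lemma exists_affine_monodromy {k : Type u} [Field k] {X : Scheme.{u}} [IsAffine X]
    (q : X ⟶ Spec (.of k)) [Algebra k Γ(X, ⊤)]
    (hq : Spec.map (CommRingCat.ofHom (algebraMap k Γ(X, ⊤))) = X.isoSpec.inv ≫ q)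
    {Y : Scheme.{u}} (ρ : Y ⟶ pullback q q) [IsFinite ρ] [Etale ρ] (s : X ⟶ Y)
    (hs : s ≫ ρ = pullback.diagonal q) :
    ∃ (_ : IsAffine Y) (_ : Algebra (Γ(X, ⊤) ⊗[k] Γ(X, ⊤)) Γ(Y, ⊤)),
      Algebra.Etale (Γ(X, ⊤) ⊗[k] Γ(X, ⊤)) Γ(Y, ⊤) ∧
      Module.Finite (Γ(X, ⊤) ⊗[k] Γ(X, ⊤)) Γ(Y, ⊤) ∧
      s.appTop.hom.comp (algebraMap (Γ(X, ⊤) ⊗[k] Γ(X, ⊤)) Γ(Y, ⊤)) =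
        (Algebra.TensorProduct.lmul' k (S := Γ(X, ⊤))).toRingHom ∧
      Y.isoSpec.inv ≫ ρ ≫ pullback.fst q q =
        Spec.map (CommRingCat.ofHom ((algebraMap (Γ(X, ⊤) ⊗[k] Γ(X, ⊤)) Γ(Y, ⊤)).comp
          Algebra.TensorProduct.includeLeftRingHom)) ≫ X.isoSpec.inv ∧
      Y.isoSpec.inv ≫ ρ ≫ pullback.snd q q =
        Spec.map (CommRingCat.ofHom ((algebraMap (Γ(X, ⊤) ⊗[k] Γ(X, ⊤)) Γ(Y, ⊤)).comp
          (Algebra.TensorProduct.includeRight (R := k)).toRingHom)) ≫ X.isoSpec.inv := by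
  let B := Γ(X, ⊤)
  let T := CommRingCat.of (B ⊗[k] B)
  let i₁ : B ⟶ T := CommRingCat.ofHom Algebra.TensorProduct.includeLeftRingHom
  let i₂ : B ⟶ T := CommRingCat.ofHom (Algebra.TensorProduct.includeRight (R := k)).toRingHom
  have hpb : IsPullback (Spec.map i₁ ≫ X.isoSpec.inv) (Spec.map i₂ ≫ X.isoSpec.inv) q q :=
    (isPullback_SpecMap_of_isPushout _ _ _ _ (CommRingCat.isPushout_tensorProduct k B B)).of_iso
      (Iso.refl _) X.isoSpec.symm X.isoSpec.symm (Iso.refl _) (Category.id_comp _).symm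
      (Category.id_comp _).symm ((Category.comp_id _).trans hq) ((Category.comp_id _).trans hq)
  let ψ := hpb.isoPullback
  have : IsAffine (pullback q q) := .of_isIso ψ.inv
  have hY : IsAffine Y := isAffine_of_isAffineHom ρ
  let g : T ⟶ Γ(Y, ⊤) := (Scheme.ΓSpecIso T).inv ≫ (ρ ≫ ψ.inv).appTop
  have hg : Spec.map g = Y.isoSpec.inv ≫ ρ ≫ ψ.inv := specMap_ΓSpecIso_inv_comp_appTop _
  have h₁ : ρ ≫ pullback.fst q q = (ρ ≫ ψ.inv) ≫ Spec.map i₁ ≫ X.isoSpec.inv := by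
    rw [Category.assoc, hpb.isoPullback_inv_fst]
  have h₂ : ρ ≫ pullback.snd q q = (ρ ≫ ψ.inv) ≫ Spec.map i₂ ≫ X.isoSpec.inv := by
    rw [Category.assoc, hpb.isoPullback_inv_snd]
  refine ⟨hY, g.hom.toAlgebra, ?_, ?_, ?_, ?_, ?_⟩
  · have : Etale (Spec.map g) := hg ▸ inferInstance
    exact (HasRingHomProperty.Spec_iff (P := @Etale)).mp this
  · have : IsFinite (Spec.map g) := hg ▸ inferInstance
    exact (IsFinite.SpecMap_iff _).mp this
  · have : g ≫ s.appTop = CommRingCat.ofHom (Algebra.TensorProduct.lmul' k (S := B)).toRingHom := by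
      apply Spec.map_injective
      rw [Spec.map_comp, hg, reassoc_of% Scheme.isoSpec_inv_naturality s, reassoc_of% hs,
        ← Category.assoc, Iso.comp_inv_eq]
      apply pullback.hom_ext
      · rw [Category.assoc, pullback.diagonal_fst, Category.comp_id, Category.assoc,
          hpb.isoPullback_hom_fst, ← Category.assoc, ← Spec.map_comp]
        have : i₁ ≫ CommRingCat.ofHom (Algebra.TensorProduct.lmul' k (S := B)).toRingHom = 𝟙 _ := by
          ext b
          exact (Algebra.TensorProduct.lmul'_apply_tmul b 1).trans (mul_one b)
        rw [this, Spec.map_id, Category.id_comp]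
      · rw [Category.assoc, pullback.diagonal_snd, Category.comp_id, Category.assoc,
          hpb.isoPullback_hom_snd, ← Category.assoc, ← Spec.map_comp]
        have : i₂ ≫ CommRingCat.ofHom (Algebra.TensorProduct.lmul' k (S := B)).toRingHom = 𝟙 _ := by
          ext b
          exact (Algebra.TensorProduct.lmul'_apply_tmul 1 b).trans (one_mul b)
        rw [this, Spec.map_id, Category.id_comp]
    exact congrArg CommRingCat.Hom.hom this
  · rw [h₁, ← Category.assoc, ← hg, ← Category.assoc, ← Spec.map_comp]
    rfl
  · rw [h₂, ← Category.assoc, ← hg, ← Category.assoc, ← Spec.map_comp]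
    rfl

end Monodromy

/-! ### Effaceability. -/

section Effaceability

open TensorProduct

lemma ringHomEssSmooth_of_isLocalization {k B R : Type u} [CommRing k] [CommRing B] [CommRing R]
    [Algebra k B] [Algebra.Smooth k B] [Algebra B R] (M : Submonoid B) [h : IsLocalization M R] :
    RingHomEssSmooth ((algebraMap B R).comp (algebraMap k B)) := by
  refine ⟨B, _, algebraMap k B, algebraMap B R, M, RingHom.smooth_algebraMap.mpr inferInstance, rfl,
    ?_⟩
  have e : (algebraMap B R).toAlgebra = ‹Algebra B R› := Algebra.algebra_ext _ _ fun _ => rfl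
  rwa [e]

lemma isEssSmooth_semilocalHom_comp {k : Type u} [Field k] {X : Scheme.{u}} [IsAffine X]
    (q : X ⟶ Spec (.of k)) [Algebra k Γ(X, ⊤)] [Algebra.Smooth k Γ(X, ⊤)]
    (hq : Spec.map (CommRingCat.ofHom (algebraMap k Γ(X, ⊤))) = X.isoSpec.inv ≫ q) (x : Set X) :
    IsEssSmooth (semilocalHom X x ≫ q) := by
  have e : semilocalHom X x ≫ q = Spec.map (CommRingCat.ofHom
      ((algebraMap Γ(X, ⊤) (Localization (nonvanishing X x))).comp (algebraMap k Γ(X, ⊤)))) := by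
    rw [CommRingCat.ofHom_comp, Spec.map_comp, hq]
    rfl
  rw [e]
  exact isEssSmooth_specMap _ (ringHomEssSmooth_of_isLocalization (nonvanishing X x))

/-- Naturality of the monodromy isomorphism transports the vanishing from the first projection,
where transfers are available, to the second. -/
lemma CoupleFunctor.map_eq_zero_of_pullback_iso {X Y : Scheme.{u}} {F : CoupleFunctor.{v} X}
    {p₁ p₂ : Y ⟶ X} {h₁ : IsEssFiniteType p₁} {h₂ : IsEssFiniteType p₂}
    (Φ : F.pullback p₁ h₁ ≅ F.pullback p₂ h₂) {P Q : Couple Y} (τ : P ⟶ Q)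
    (h : (F.pullback p₁ h₁).map τ.op = 0) : (F.pullback p₂ h₂).map τ.op = 0 := by
  rw [← cancel_mono (Φ.inv.app (op P)), Φ.inv.naturality τ.op, h, comp_zero, zero_comp]

theorem CoupleFunctor.isEffaceableAt_of_hasFiniteMonodromy {k : Type u} [Field k] [Infinite k]
    {X : Scheme.{u}} (q : X ⟶ Spec (.of k)) [IsAffine X] [IsIntegral X] [Smooth q] (x : Set X)
    (hx : x.Finite) (F : CoupleFunctor.{v} X) (hinv : F.IsHomotopyInvariant q) (tr : F.Transfers)
    (hvan : F.HasVanishing) (hmon : F.HasFiniteMonodromy q) : F.IsEffaceableAt x := by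
  intro m hm Z hZ
  -- If `Z` misses `U`, the empty set serves as `Z'`. Otherwise `I` is proper and `R` is nontrivial,
  -- which the construction of the curve needs.
  by_cases hU : restrictSupp x Z = ⊥
  · refine ⟨⊥, hU.le, le_iInf₂ fun t ht => ht.elim, ?_⟩
    rw [(hvan (semilocalCouple x (restrictSupp x Z)) hU).eq_of_src (F.map _) 0, comp_zero]
  obtain ⟨Y, ρ, _, _, s₀, hs₀, ⟨Φ⟩⟩ := hmon
  let : Algebra k Γ(X, ⊤) := ((Scheme.ΓSpecIso (.of k)).inv ≫ q.appTop).hom.toAlgebra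
  have hq : Spec.map (CommRingCat.ofHom (algebraMap k Γ(X, ⊤))) = X.isoSpec.inv ≫ q :=
    specMap_ΓSpecIso_inv_comp_appTop q
  have : Algebra.Smooth k Γ(X, ⊤) := by
    have h : Smooth (Spec.map (CommRingCat.ofHom (algebraMap k Γ(X, ⊤)))) := hq ▸ inferInstance
    exact RingHom.smooth_algebraMap.mp ((HasRingHomProperty.Spec_iff (P := @Smooth)).mp h)
  obtain ⟨_, _, _, _, hε, hp₁, hp₂⟩ := exists_affine_monodromy q hq ρ s₀ hs₀
  obtain ⟨I, hI⟩ := exists_zeroLocus_eq (Z.preimage X.isoSpec.inv.continuous)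
  have hrestrict := restrictSupp_eq_zeroLocus x Z I hI
  -- Codimension at least `1` excludes the generic point, whose prime ideal has height `0`.
  have h₀ : I ≠ ⊥ := by
    rintro rfl
    have := codim_le_height Z ⊥ hI ⊥ le_rfl
    rw [hZ, Ideal.height_bot] at this
    exact absurd (hm.trans this) (by simp)
  have h₁ : I ≠ ⊤ := by
    rintro rfl
    exact hU (hrestrict.trans (zeroLocus_eq_bot (Ideal.map_top _)))
  have : Nontrivial (Localization (nonvanishing X x)) := by
    by_contra h
    rw [not_nontrivial_iff_subsingleton] at h
    exact hU (hrestrict.trans (zeroLocus_eq_bot (Subsingleton.elim _ _)))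
  let R := Localization (nonvanishing X x)
  obtain ⟨A, _, _, α, σ, s, J, I', 𝔟, hα, hα₁, hσα, hJ, hsfin, hsflat, hs₁, hinf, hsup, hI'J, h𝔟J,
    h𝔟I, hheight⟩ := exists_rectification (R := R) (nonvanishing X x)
      (finite_isMaximal_semilocalRing X x hx) s₀.appTop.hom hε I h₀ h₁
  have hle : restrictSupp x Z ≤ zeroLocus 𝔟 := hrestrict.trans_le (zeroLocus_anti h𝔟I)
  refine ⟨zeroLocus 𝔟, hle, le_iInf₂ fun t ht => ?_, ?_⟩
  · obtain ⟨p, _, hIp, hp⟩ := hheight t.asIdeal t.2 ht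
    rw [← idealHeight_eq_coheight, tsub_le_iff_right, ← hZ]
    exact (codim_le_height Z I hI p hIp).trans hp
  let w : Spec (.of A) ⟶ Y := Spec.map (CommRingCat.ofHom α) ≫ Y.isoSpec.inv
  let σ' : Spec (.of R) ⟶ Spec (.of A) := Spec.map (CommRingCat.ofHom σ.toRingHom)
  have hw : IsEssFiniteType w :=
    (isEssFiniteType_SpecMap _ hα).comp (isEssFiniteType_of_locallyOfFiniteType _)
  have hσ' : IsEssFiniteType (σ' ≫ w) := by
    refine (isEssFiniteType_SpecMap _ (RingHom.FiniteType.of_surjective _ fun r =>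
      ⟨algebraMap R A r, ?_⟩).essFiniteType).comp hw
    exact σ.commutes r
  have hw₁ : w ≫ ρ ≫ pullback.fst q q =
      Spec.map (CommRingCat.ofHom (algebraMap R A)) ≫ semilocalHom X x := by
    rw [Category.assoc, hp₁, semilocalHom, ← Category.assoc, ← Category.assoc, ← Spec.map_comp,
      ← Spec.map_comp]
    congr 2
    ext b
    exact hα₁ b
  have hw₂ : w ≫ ρ ≫ pullback.snd q q = Spec.map (CommRingCat.ofHom (α.comp
      ((algebraMap (Γ(X, ⊤) ⊗[k] Γ(X, ⊤)) Γ(Y, ⊤)).comp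
        (Algebra.TensorProduct.includeRight (R := k)).toRingHom))) ≫
        X.isoSpec.inv := by
    rw [Category.assoc, hp₂, ← Category.assoc, ← Spec.map_comp]
    rfl
  have hσw : σ' ≫ w = semilocalHom X x ≫ s₀ := by
    rw [semilocalHom, Category.assoc, ← Scheme.isoSpec_inv_naturality, ← Category.assoc,
      ← Category.assoc, ← Spec.map_comp, ← Spec.map_comp]
    congr 2
    ext e
    exact hσα e
  have hσw₁ : (σ' ≫ w) ≫ ρ ≫ pullback.fst q q = semilocalHom X x := by
    rw [hσw, Category.assoc, reassoc_of% hs₀, pullback.diagonal_fst, Category.comp_id]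
  have hσw₂ : (σ' ≫ w) ≫ ρ ≫ pullback.snd q q = semilocalHom X x := by
    rw [hσw, Category.assoc, reassoc_of% hs₀, pullback.diagonal_snd, Category.comp_id]
  have h𝔟σ : 𝔟 ≤ J.map σ.toRingHom := by
    have := Ideal.map_mono (f := σ.toRingHom) h𝔟J
    have hid : σ.toRingHom.comp (algebraMap R A) = RingHom.id R := σ.comp_algebraMap
    rwa [Ideal.map_map, hid, Ideal.map_id] at this
  -- The section is a morphism in `Cp(Y)`, so that either projection to `X` can be applied to it.
  let τ : specCouple (σ' ≫ w) hσ' (zeroLocus 𝔟) ⟶ specCouple w hw (zeroLocus J) :=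
    ⟨Over.homMk σ' rfl, (preimage_zeroLocus σ.toRingHom J).trans_le (zeroLocus_anti h𝔟σ)⟩
  have hft {p : Limits.pullback q q ⟶ X} [LocallyOfFiniteType p] [QuasiCompact p] :
      IsEssFiniteType (ρ ≫ p) := isEssFiniteType_of_locallyOfFiniteType _
  have hτ₁ : (F.pullback (ρ ≫ pullback.fst q q) hft).map τ.op = 0 := by
    refine tr.map_eq_zero_of_algebra hvan hinv (w ≫ ρ ≫ pullback.fst q q) (hw.comp hft)
      ((σ' ≫ w) ≫ ρ ≫ pullback.fst q q) (hσ'.comp hft) ?_ ?_ σ s J I' 𝔟 hsfin hsflat hs₁ hinf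
      hsup hI'J h𝔟J _ rfl
    · rw [hσw₁, hw₁]
    · rw [hσw₁]
      exact isEssSmooth_semilocalHom_comp q hq x
  have hτ₂ : F.map ((Couple.map (ρ ≫ pullback.snd q q) hft).map τ).op = 0 :=
    map_eq_zero_of_pullback_iso Φ τ hτ₁
  let a : semilocalCouple x (zeroLocus 𝔟) ⟶
      (Couple.map (ρ ≫ pullback.snd q q) hft).obj (specCouple (σ' ≫ w) hσ' (zeroLocus 𝔟)) :=
    ⟨Over.homMk (𝟙 _) ((Category.id_comp _).trans hσw₂), le_rfl⟩
  let b : (Couple.map (ρ ≫ pullback.snd q q) hft).obj (specCouple w hw (zeroLocus J)) ⟶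
      selfCouple Z :=
    ⟨Over.homMk (w ≫ ρ ≫ pullback.snd q q) (Category.comp_id _), by
      have : Z.preimage (w ≫ ρ ≫ pullback.snd q q).continuous = zeroLocus J := by
        rw [hJ, ← preimage_zeroLocus, hI]
        ext t
        change (w ≫ ρ ≫ pullback.snd q q) t ∈ Z ↔ _
        rw [hw₂]
        rfl
      exact this.le⟩
  -- Through the second projection the section becomes `j` and `V(J)` is the preimage of `Z`, so the
  -- map to be killed factors through `τ`.
  have e : semilocalCoupleId x hle ≫ semilocalCoupleHom x Z =
      a ≫ (Couple.map (ρ ≫ pullback.snd q q) hft).map τ ≫ b := by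
    apply Couple.hom_ext_left
    change 𝟙 _ ≫ semilocalHom X x = 𝟙 _ ≫ σ' ≫ w ≫ ρ ≫ pullback.snd q q
    rw [Category.id_comp, Category.id_comp, ← hσw₂, Category.assoc]
  rw [← F.map_comp, ← op_comp, e, op_comp, op_comp, F.map_comp, F.map_comp, hτ₂, comp_zero,
    zero_comp]

end Effaceability

end EffacementTheorem

theorem theorem5p4 {k : Type u} [Field k] [Infinite k] {X : Scheme.{u}}
    (q : X ⟶ Spec (CommRingCat.of k)) [IsAffine X] [IsIntegral X] [Smooth q]
    (x : Set X) (hx : x.Finite)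
    (F : EffacementTheorem.CoupleFunctor.{v} X)
    (homotopyInvariant : F.IsHomotopyInvariant q)
    (transfers : F.Transfers)
    (vanishing : F.HasVanishing)
    (finiteMonodromy : F.HasFiniteMonodromy q) :
    F.IsEffaceableAt x :=
  F.isEffaceableAt_of_hasFiniteMonodromy q x hx homotopyInvariant transfers vanishing
    finiteMonodromy
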